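/- Let $q_1,q_2$ be positive integers, $q=\operatorname{lcm}(q_1,q_2)$. A pair of congruence classes $a_0 \bmod q_1$, $c_0 \bmod q_2$ is called admissible if $a_1^2+c_1^4$ is a unit modulo $q$ for all classes $a_1,c_1 \bmod q$ with $a_1\equiv a_0 \bmod q_1$ and $c_1\equiv c_0 \bmod q_2$. For such a pair and for integers $n\ge 1$ put $$a'_n=\sum_{\substack{a,b\in\mathbb Z,\ a^2+b^2=n\\ a\equiv a_0 \bmod q_1}}\mathfrak z'(b),\qquad \mathfrak z'(b)=\#\{c\in\mathbb Z:\ c^2=b,\ c\equiv c_0 \bmod q_2\}.$$ Let $g$ be the multiplicative function supported on cubefree integers with $g(2)=\tfrac12$, $g(4)=\tfrac14$ and, for primes $p\ge 3$, $$g(p)\,p=1+\chi_4(p)\Bigl(1-\frac1p\Bigr),\qquad g(p^2)\,p^2=1+(1+\chi_4(p))\Bigl(1-\frac1p\Bigr),$$ where $\chi_4$ is the nontrivial Dirichlet character modulo $4$; let $g'(n)=g(n)$ if $(n,q)=1$ and $g'(n)=0$ otherwise. For $d\ge1$ and real $x$ put $$A'_d(x)=\sum_{\substack{1\le n\le x\\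 d\mid n}}a'_n,\qquad A'(x)=A'_1(x),\qquad r'_d(x)=A'_d(x)-g'(d)A'(x).$$ (1) For every $\varepsilon>0$ there are $x_0>0$ and $C>0$, depending only on $\varepsilon,q_1,q_2$, such that for every admissible pair $a_0 \bmod q_1$, $c_0 \bmod q_2$, all real $D\ge1$, all $x\ge x_0$ and all real $t\le x$, $$\sum_{\substack{d\le D\\ d\text{ cubefree}}}|r'_d(t)|\le C\,D^{1/4}x^{9/16+\varepsilon}.$$ (2) Consequently, for every $0<\varepsilon<\tfrac1{96}$ and every admissible pair, the sieve hypothesis (R) holds for $(a'_n)$ and $g'$ with $D=D(x)=x^{3/4-8\varepsilon}$: with $L=(\log x)^{2^{24}}$, there is $x_r>0$ such that for all $x\ge x_r$ one has $x^{2/3}<D<x$ and $$\sum_{\substack{d\le DL^2\\ d\text{ cubefree}}}|r'_d(t)|\le A'(x)L^{-2}\qquad\text{for all } t\le x.$$ -/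

import Mathlib

namespace QuarticSieve

/-! ### Sieve notation for a general sequence -/

/-- `d` is cubefree: no cube of a prime divides it. (In particular `0` is not cubefree.) -/
def Cubefree (d : ℕ) : Prop := ∀ p : ℕ, p.Prime → ¬ p ^ 3 ∣ d

/-- `A_d(x) = ∑_{1 ≤ n ≤ x, d ∣ n} a_n`. -/
noncomputable def congruenceSum (a : ℕ → ℝ) (d : ℕ) (x : ℝ) : ℝ :=
  ∑ n ∈ (Finset.Icc 1 ⌊x⌋₊).filter (fun n => d ∣ n), a n

/-- The error term `r_d(x) = A_d(x) - g(d) A(x)`, where `A = A_1`. -/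
noncomputable def remainder (a g : ℕ → ℝ) (d : ℕ) (x : ℝ) : ℝ :=
  congruenceSum a d x - g d * congruenceSum a 1 x

open scoped Classical in
/-- `∑_{d ≤ D, d cubefree} |r_d(t)|`. -/
noncomputable def remainderSum (a g : ℕ → ℝ) (D t : ℝ) : ℝ :=
  ∑ d ∈ (Finset.Icc 1 ⌊D⌋₊).filter Cubefree, |remainder a g d t|

/-- `L = (log x) ^ (2 ^ 24)`. -/
noncomputable def sieveL (x : ℝ) : ℝ := Real.log x ^ (2 ^ 24 : ℕ)

/-- The sieve hypothesis (R) for the sequence `a` and the multiplicative function `g`, with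
level of distribution `D = D(x)`: for all large `x` one has `x ^ (2/3) < D(x) < x` and
`∑_{d ≤ D L², d cubefree} |r_d(t)| ≤ A(x) L⁻²` for every `t ≤ x`. -/
def HypothesisR (a g : ℕ → ℝ) (D : ℝ → ℝ) : Prop :=
  ∃ xr : ℝ, 0 < xr ∧ ∀ x : ℝ, xr ≤ x →
    (x ^ (2 / 3 : ℝ) < D x ∧ D x < x) ∧
    ∀ t : ℝ, t ≤ x →
      remainderSum a g (D x * sieveL x ^ 2) t ≤ congruenceSum a 1 x / sieveL x ^ 2

/-! ### The sequence `a'_n` -/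

/-- The classes `a₀ mod q₁`, `c₀ mod q₂` form an admissible pair: with `q = lcm(q₁, q₂)`,
`a₁² + c₁⁴` is a unit modulo `q` for all classes `a₁`, `c₁` modulo `q` lifting them. -/
def Admissible (q₁ q₂ : ℕ) (a₀ c₀ : ℤ) : Prop :=
  ∀ a₁ c₁ : ℤ, a₁ ≡ a₀ [ZMOD q₁] → c₁ ≡ c₀ [ZMOD q₂] →
    IsUnit ((a₁ ^ 2 + c₁ ^ 4 : ℤ) : ZMod (Nat.lcm q₁ q₂))

/-- The number of `c ∈ ℤ` with `c² = b` and `c ≡ c₀ mod q₂`. Every such `c` has `|c| ≤ |b|`, so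
the finite range imposes no restriction; see `sqWeight_eq_ncard`. -/
noncomputable def sqWeight (q₂ : ℕ) (c₀ b : ℤ) : ℕ :=
  ((Finset.Icc (-(b.natAbs : ℤ)) b.natAbs).filter (fun c => c ^ 2 = b ∧ c ≡ c₀ [ZMOD q₂])).card

/-- `a'_n`: the sum of `sqWeight q₂ c₀ b` over all `(a, b) ∈ ℤ × ℤ` with `a² + b² = n` and
`a ≡ a₀ mod q₁`. All such pairs have `|a|, |b| ≤ n`; see `seqA_eq_finsum`. -/
noncomputable def seqA (q₁ q₂ : ℕ) (a₀ c₀ : ℤ) (n : ℕ) : ℕ :=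
  ∑ ab ∈ (Finset.Icc (-(n : ℤ)) n ×ˢ Finset.Icc (-(n : ℤ)) n).filter
      (fun ab : ℤ × ℤ => ab.1 ^ 2 + ab.2 ^ 2 = n ∧ ab.1 ≡ a₀ [ZMOD q₁]),
    sqWeight q₂ c₀ ab.2

theorem sqWeight_eq_ncard (q₂ : ℕ) (c₀ b : ℤ) :
    sqWeight q₂ c₀ b = {c : ℤ | c ^ 2 = b ∧ c ≡ c₀ [ZMOD q₂]}.ncard := by
  rw [sqWeight, ← Set.ncard_coe_finset]
  congr 1
  ext c
  simp only [Finset.coe_filter, Finset.mem_Icc, Set.mem_ofPred_eq, and_iff_right_iff_imp]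
  rintro ⟨h, -⟩
  rw [← abs_le, Int.natCast_natAbs, ← h, abs_pow]
  exact Int.le_self_sq _

theorem seqA_eq_finsum (q₁ q₂ : ℕ) (a₀ c₀ : ℤ) (n : ℕ) :
    seqA q₁ q₂ a₀ c₀ n =
      ∑ᶠ ab ∈ {ab : ℤ × ℤ | ab.1 ^ 2 + ab.2 ^ 2 = n ∧ ab.1 ≡ a₀ [ZMOD q₁]},
        sqWeight q₂ c₀ ab.2 := by
  rw [seqA, ← finsum_mem_coe_finset]
  refine finsum_congr fun ab => finsum_congr_Prop (propext ?_) fun _ => rfl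
  simp only [Finset.coe_filter, Finset.mem_product, Finset.mem_Icc, Set.mem_ofPred_eq,
    and_iff_right_iff_imp]
  rintro ⟨h, -⟩
  rw [← abs_le, ← abs_le]
  have h1 := Int.le_self_sq |ab.1|
  have h2 := Int.le_self_sq |ab.2|
  rw [sq_abs] at h1 h2
  constructor <;> nlinarith [sq_nonneg ab.1, sq_nonneg ab.2]

/-! ### The multiplicative functions `g` and `g'` -/

/-- The value `g(p ^ k)` for a prime `p`; it vanishes for `k ≥ 3`. -/
noncomputable def localDensity (p : ℕ) : ℕ → ℝ
  | 0 => 1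
  | 1 => if p = 2 then 1 / 2 else (1 + (ZMod.χ₄ (p : ZMod 4) : ℝ) * (1 - 1 / p)) / p
  | 2 => if p = 2 then 1 / 4 else
      (1 + (1 + (ZMod.χ₄ (p : ZMod 4) : ℝ)) * (1 - 1 / p)) / (p : ℝ) ^ 2
  | _ => 0

/-- The multiplicative function `g`, supported on cubefree integers. -/
noncomputable def density (n : ℕ) : ℝ :=
  if n = 0 then 0 else n.factorization.prod localDensity

theorem density_mul_of_coprime {m n : ℕ} (h : m.Coprime n) :
    density (m * n) = density m * density n := by
  unfold density
  by_cases hm : m = 0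
  · simp [hm]
  by_cases hn : n = 0
  · simp [hn]
  simp only [hm, hn, mul_eq_zero, or_self, if_false]
  rw [Nat.factorization_mul_of_coprime h, Finsupp.prod_add_index_of_disjoint]
  simpa using h.disjoint_primeFactors

theorem density_prime_pow {p : ℕ} (hp : p.Prime) (k : ℕ) :
    density (p ^ k) = localDensity p k := by
  simp [density, hp.ne_zero, hp.factorization_pow, localDensity]

/-- `g'(n) = g(n)` if `(n, q) = 1`, where `q = lcm(q₁, q₂)`, and `g'(n) = 0` otherwise. -/
noncomputable def densityCoprime (q₁ q₂ n : ℕ) : ℝ :=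
  if n.Coprime (Nat.lcm q₁ q₂) then density n else 0

end QuarticSieve

namespace QuarticSieve

open UniqueFactorizationMonoid (radical)
open ArithmeticFunction (moebius)

/-! ### The divisor bound -/

/-! Apart from the pairs with c = 0, A'_d(t) is a sum over c of the number of admissible a with |a|
≤ √(t - c⁴) and d ∣ a² + c⁴. If d shares a factor with lcm(q₁, q₂), admissibility makes the
remainder vanish. Otherwise put e = gcd(c², d). As d is cubefree, e is coprime to d/e and c is a
unit modulo d/e. At the primes of e the divisibility only asks for r = rad(e) to divide a. Modulo
d/e it says a ≡ q₁μc² for one of the roots μ of (q₁μ)² + 1 ≡ 0. Möbius inversion over f removes the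
condition that c be coprime to d/e (`sum_pairCount_eq`).

What is left is the number of a in single residue classes modulo r(d/e)q₁. The expected sizes add up
to g(d) times a mass that does not depend on d (`abs_sum_widthU_sub_le`, `density_eq_sum`), so the
mass cancels in r'_d.

The deviations have to be small on average over d. Write d again for the cofactor d/e. The position
of the residue class is (μ/d)(c²/r) plus a constant, so smoothing the count at relative scale 1/H
and expanding it in cosines gives exponential polynomials at the points μ/d with frequencies kc²/r.
If ν² + 1 and ν'² + 1 are divisible by d and d', then (νd' - ν'd)² + (d - d')² is a multiple of dd',
and a positive one for distinct pairs. Hence the points μ/d with d of size X are spaced by a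
constant times 1/X (`rootSet_spaced`), and the large sieve bounds the mean square
(`large_sieve_dyadic`). The Fourier coefficients depend on d through the width of the interval; this
is handled by cutting the moduli into about H log D blocks of ratio exp(1/H).

With u = t^(1/4), and up to divisor and logarithmic factors, smoothing costs u³/H and the Fourier
terms cost √(DHu³), while the remaining errors are O(u²). For D ≤ t^(3/4) the choice H =
2(t^(3/4)/D)^(1/4) makes everything O(D^(1/4) t^(9/16)) (`remainderSum_le_of_le`). For larger D the
trivial bound, t^(3/4) times divisor factors, is already good enough (`remainderSum_le_trivial`).

The second assertion follows because A'(x) is at least a constant times x^(3/4)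
(`congruenceSum_one_ge`), whereas at level x^(3/4 - 8ε) the first bound saves x^ε, which beats any
power of log x. -/

theorem succ_le_mul_rpow_mul {ε : ℝ} (hε : 0 < ε) {p : ℕ} (hp : 2 ≤ p) (k : ℕ) :
    ((k : ℝ) + 1) ≤ (1 + 1 / (ε * Real.log 2)) * ((p : ℝ) ^ k) ^ ε := by
  have hl : 0 < Real.log 2 := Real.log_pos (by norm_num)
  have h2 : ((2 : ℝ) ^ k) ^ ε ≤ ((p : ℝ) ^ k) ^ ε := by
    have : (2 : ℝ) ≤ p := by exact_mod_cast hp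
    gcongr
  have h1 : 1 + k * (ε * Real.log 2) ≤ ((2 : ℝ) ^ k) ^ ε := by
    rw [← Real.rpow_natCast, ← Real.rpow_mul (by norm_num), Real.rpow_def_of_pos (by norm_num)]
    have := Real.add_one_le_exp (Real.log 2 * (k * ε))
    linarith
  have h3 : 0 ≤ 1 / (ε * Real.log 2) := by positivity
  have hc : 1 / (ε * Real.log 2) * (k * (ε * Real.log 2)) = k := by field_simp
  have hk : (0 : ℝ) ≤ k * (ε * Real.log 2) := by positivity
  calc ((k : ℝ) + 1) ≤ (1 + 1 / (ε * Real.log 2)) * (1 + k * (ε * Real.log 2)) := by nlinarith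
    _ ≤ (1 + 1 / (ε * Real.log 2)) * ((2 : ℝ) ^ k) ^ ε := by gcongr
    _ ≤ _ := by gcongr

theorem succ_le_rpow_of_large {ε : ℝ} (hε : 0 < ε) {p : ℕ} (hp : (2 : ℝ) ^ (1 / ε) ≤ p) (k : ℕ) :
    ((k : ℝ) + 1) ≤ ((p : ℝ) ^ k) ^ ε := by
  have h1 : (2 : ℝ) ≤ (p : ℝ) ^ ε := by
    calc (2 : ℝ) = ((2 : ℝ) ^ (1 / ε)) ^ ε := by
          rw [← Real.rpow_mul (by norm_num), one_div_mul_cancel hε.ne', Real.rpow_one]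
      _ ≤ _ := by gcongr
  rw [← Real.rpow_natCast, ← Real.rpow_mul (by positivity), mul_comm, Real.rpow_mul (by positivity),
    Real.rpow_natCast]
  calc ((k : ℝ) + 1) ≤ 2 ^ k := by exact_mod_cast Nat.lt_two_pow_self
    _ ≤ _ := by gcongr

/-- The quotient τ(n)/n^ε is a product over primes of (k + 1)/p^(kε). A factor is at most 1 as soon
as p^ε ≥ 2. The fewer than P smaller primes contribute at most A each. -/
theorem exists_card_divisors_le_rpow {ε : ℝ} (hε : 0 < ε) :
    ∃ C : ℝ, 1 ≤ C ∧ ∀ n : ℕ, n ≠ 0 → (n.divisors.card : ℝ) ≤ C * (n : ℝ) ^ ε := by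
  set A : ℝ := 1 + 1 / (ε * Real.log 2) with hA
  have hl : 0 < Real.log 2 := Real.log_pos (by norm_num)
  have hA1 : 1 ≤ A := by
    have : 0 ≤ 1 / (ε * Real.log 2) := by positivity
    linarith
  set P : ℕ := ⌈(2 : ℝ) ^ (1 / ε)⌉₊ with hP
  refine ⟨A ^ P, one_le_pow₀ hA1, fun n hn => ?_⟩
  have hfac : ((n : ℝ)) ^ ε = ∏ p ∈ n.primeFactors, (((p : ℝ) ^ n.factorization p)) ^ ε := by
    conv_lhs => rw [← Nat.prod_factorization_pow_eq_self hn]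
    rw [Finsupp.prod, Nat.support_factorization]
    push_cast
    rw [Real.finsetProd_rpow _ _ (fun i _ => by positivity)]
  rw [Nat.card_divisors hn, hfac]
  push_cast
  calc ∏ p ∈ n.primeFactors, ((n.factorization p : ℝ) + 1)
      ≤ ∏ p ∈ n.primeFactors, ((if p < P then A else 1) * ((p : ℝ) ^ n.factorization p) ^ ε) := by
        refine Finset.prod_le_prod (fun _ _ => by positivity) fun p hp => ?_
        have hpp := Nat.prime_of_mem_primeFactors hp
        split_ifs with h
        · exact succ_le_mul_rpow_mul hε hpp.two_le _
        · rw [one_mul]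
          refine succ_le_rpow_of_large hε ?_ _
          exact (Nat.le_ceil _).trans (by exact_mod_cast not_lt.mp h)
    _ = (∏ p ∈ n.primeFactors, (if p < P then A else 1)) *
          ∏ p ∈ n.primeFactors, ((p : ℝ) ^ n.factorization p) ^ ε := Finset.prod_mul_distrib
    _ ≤ A ^ P * _ := by
        refine mul_le_mul_of_nonneg_right ?_ (Finset.prod_nonneg fun _ _ => by positivity)
        rw [Finset.prod_ite, Finset.prod_const, Finset.prod_const_one, mul_one]
        refine pow_le_pow_right₀ hA1 ?_
        calc _ ≤ (Finset.range P).card := Finset.card_le_card fun p hp => by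
              simp only [Finset.mem_filter] at hp; simpa using hp.2
          _ = P := Finset.card_range P

theorem sum_one_div_le_one_add_log {D : ℝ} (hD : 1 ≤ D) :
    ∑ d ∈ Finset.Icc 1 ⌊D⌋₊, (1 : ℝ) / d ≤ 1 + Real.log D := by
  have h := harmonic_floor_le_one_add_log D hD
  rw [harmonic_eq_sum_Icc] at h
  push_cast at h
  simpa [one_div] using h

/-! ### The large sieve inequality -/

/-- `e(x) = exp(2πix)`. -/
noncomputable def expChar (x : ℝ) : ℂ := Complex.exp (2 * Real.pi * x * Complex.I)

theorem expChar_add (x y : ℝ) : expChar (x + y) = expChar x * expChar y := by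
  rw [expChar, expChar, expChar, ← Complex.exp_add]; push_cast; ring_nf

theorem norm_expChar (x : ℝ) : ‖expChar x‖ = 1 := by
  rw [expChar]
  have := Complex.norm_exp_ofReal_mul_I (2 * Real.pi * x)
  push_cast at this
  exact this

theorem conj_expChar (x : ℝ) : (starRingEnd ℂ) (expChar x) = expChar (-x) := by
  rw [expChar, expChar, ← Complex.exp_conj]
  congr 1
  simp only [map_mul, Complex.conj_ofReal, Complex.conj_I, Complex.ofReal_neg, map_ofNat]
  ring

theorem expChar_re (x : ℝ) : (expChar x).re = Real.cos (2 * Real.pi * x) := by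
  rw [expChar]
  have := Complex.exp_ofReal_mul_I_re (2 * Real.pi * x)
  push_cast at this
  exact this

theorem hasDerivAt_expChar_mul (m : ℤ) (u : ℝ) :
    HasDerivAt (fun u : ℝ => expChar (m * u)) (2 * Real.pi * m * Complex.I * expChar (m * u)) u := by
  have h1 : HasDerivAt (fun u : ℝ => (2 * Real.pi * ((m * u : ℝ) : ℂ) * Complex.I))
      (2 * Real.pi * m * Complex.I) u := by
    have h0 : HasDerivAt (fun u : ℝ => ((m * u : ℝ) : ℂ)) ((m : ℝ) : ℂ) u := by
      have := ((hasDerivAt_id u).const_mul (m : ℝ)).ofReal_comp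
      simpa using this
    have := (h0.const_mul (2 * (Real.pi : ℂ))).mul_const Complex.I
    simpa [mul_assoc] using this
  have := h1.cexp
  convert! this using 1
  rw [expChar]; ring

theorem continuous_expChar : Continuous expChar := by
  unfold expChar; fun_prop

/-- Two periods are used because the windows [y, y + δ] of the large sieve, with y < 1 and δ ≤ 1,
lie in [0, 2]. -/
theorem integral_expChar (m : ℤ) :
    ∫ u in (0 : ℝ)..2, expChar (m * u) = if m = 0 then 2 else 0 := by
  split_ifs with h
  · subst h
    simp [expChar]
  · have hm : (2 * Real.pi * m * Complex.I) ≠ 0 := by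
      have : (m : ℂ) ≠ 0 := by exact_mod_cast h
      have : (Real.pi : ℂ) ≠ 0 := by exact_mod_cast Real.pi_ne_zero
      simp [*]
    have hd : ∀ u : ℝ, HasDerivAt (fun u : ℝ => expChar (m * u) / (2 * Real.pi * m * Complex.I))
        (expChar (m * u)) u := fun u => by
      have := (hasDerivAt_expChar_mul m u).div_const (2 * Real.pi * m * Complex.I)
      rwa [mul_div_cancel_left₀ _ hm] at this
    rw [intervalIntegral.integral_eq_sub_of_hasDerivAt (fun u _ => hd u)]
    · have h2 : expChar ((m : ℝ) * 2) = 1 := by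
        rw [expChar, Complex.exp_eq_one_iff]
        exact ⟨2 * m, by push_cast; ring⟩
      have h0 : expChar ((m : ℝ) * 0) = 1 := by simp [expChar]
      rw [h2, h0, sub_self]
    · exact (continuous_expChar.comp (by fun_prop)).intervalIntegrable _ _

section
variable {ι : Type*} (s : Finset ι) (β : ι → ℂ) (m : ι → ℤ)

/-- The exponential polynomial with coefficients `β i` and frequencies `m i`. -/
noncomputable def expPoly (u : ℝ) : ℂ := ∑ i ∈ s, β i * expChar (m i * u)

theorem continuous_expPoly : Continuous (expPoly s β m) := by
  unfold expPoly
  refine continuous_finsetSum _ fun i _ => continuous_const.mul ?_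
  exact continuous_expChar.comp (by fun_prop)

theorem hasDerivAt_expPoly (u : ℝ) :
    HasDerivAt (expPoly s β m) (expPoly s (fun i => β i * (2 * Real.pi * m i * Complex.I)) m u) u := by
  unfold expPoly
  refine HasDerivAt.fun_sum fun i _ => ?_
  have := (hasDerivAt_expChar_mul (m i) u).const_mul (β i)
  rwa [← mul_assoc] at this

/-- Parseval for frequencies that may repeat: the surviving cross terms have m i = m j. They are
bounded by 2|βᵢβⱼ| ≤ |βᵢ|² + |βⱼ|², and each index meets at most T of them. -/
theorem integral_normSq_expPoly_le (T : ℝ)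
    (hT : ∀ i ∈ s, ((s.filter fun j => m j = m i).card : ℝ) ≤ T) :
    ∫ u in (0 : ℝ)..2, ‖expPoly s β m u‖ ^ 2 ≤ 2 * T * ∑ i ∈ s, ‖β i‖ ^ 2 := by
  have hpt : ∀ u : ℝ, ((‖expPoly s β m u‖ ^ 2 : ℝ) : ℂ) =
      ∑ i ∈ s, ∑ j ∈ s, β i * (starRingEnd ℂ) (β j) * expChar ((m i - m j : ℤ) * u) := by
    intro u
    push_cast
    rw [← Complex.mul_conj', expPoly, map_sum, Finset.sum_mul_sum]
    refine Finset.sum_congr rfl fun i _ => Finset.sum_congr rfl fun j _ => ?_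
    rw [map_mul, conj_expChar]
    have : ((m i : ℝ) - m j) * u = m i * u + -(m j * u) := by ring
    rw [this, expChar_add]; ring
  have hint : ((∫ u in (0 : ℝ)..2, ‖expPoly s β m u‖ ^ 2 : ℝ) : ℂ) =
      ∑ i ∈ s, ∑ j ∈ s, β i * (starRingEnd ℂ) (β j) * (if m i - m j = 0 then 2 else 0) := by
    rw [← intervalIntegral.integral_ofReal]
    simp_rw [hpt]
    rw [intervalIntegral.integral_finsetSum]
    · refine Finset.sum_congr rfl fun i _ => ?_
      rw [intervalIntegral.integral_finsetSum]
      · refine Finset.sum_congr rfl fun j _ => ?_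
        rw [intervalIntegral.integral_const_mul, integral_expChar]
      · intro j _
        exact (continuous_const.mul (continuous_expChar.comp (by fun_prop))).intervalIntegrable _ _
    · intro i _
      refine Continuous.intervalIntegrable ?_ _ _
      refine continuous_finsetSum _ fun j _ => continuous_const.mul ?_
      exact continuous_expChar.comp (by fun_prop)
  have hnn : 0 ≤ ∫ u in (0 : ℝ)..2, ‖expPoly s β m u‖ ^ 2 :=
    intervalIntegral.integral_nonneg (by norm_num) fun u _ => by positivity
  have h1 : ∫ u in (0 : ℝ)..2, ‖expPoly s β m u‖ ^ 2 ≤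
      ∑ i ∈ s, ∑ j ∈ s, (if m j = m i then (‖β i‖ ^ 2 + ‖β j‖ ^ 2) else 0) := by
    calc ∫ u in (0 : ℝ)..2, ‖expPoly s β m u‖ ^ 2
        = ‖((∫ u in (0 : ℝ)..2, ‖expPoly s β m u‖ ^ 2 : ℝ) : ℂ)‖ := by
          rw [Complex.norm_real, Real.norm_of_nonneg hnn]
      _ ≤ _ := by
          rw [hint]
          refine (norm_sum_le _ _).trans (Finset.sum_le_sum fun i _ => ?_)
          refine (norm_sum_le _ _).trans (Finset.sum_le_sum fun j _ => ?_)
          by_cases h : m j = m i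
          · rw [if_pos (by rw [h, sub_self]), if_pos h]
            simp only [norm_mul, RCLike.norm_conj, Complex.norm_ofNat]
            nlinarith [sq_nonneg (‖β i‖ - ‖β j‖)]
          · rw [if_neg (fun h' => h (by omega)), if_neg h]
            simp
  have h2 : ∀ i ∈ s, ∑ j ∈ s, (if m j = m i then ‖β i‖ ^ 2 else 0) ≤ T * ‖β i‖ ^ 2 := by
    intro i hi
    rw [← Finset.sum_filter, Finset.sum_const, nsmul_eq_mul]
    exact mul_le_mul_of_nonneg_right (hT i hi) (by positivity)
  have h3 : ∑ i ∈ s, ∑ j ∈ s, (if m j = m i then (‖β i‖ ^ 2 + ‖β j‖ ^ 2) else 0) =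
      2 * ∑ i ∈ s, ∑ j ∈ s, (if m j = m i then ‖β i‖ ^ 2 else 0) := by
    have : ∀ i j, (if m j = m i then (‖β i‖ ^ 2 + ‖β j‖ ^ 2) else 0) =
        (if m j = m i then ‖β i‖ ^ 2 else 0) + (if m i = m j then ‖β j‖ ^ 2 else 0) := by
      intro i j
      by_cases h : m j = m i
      · simp [h]
      · simp [h, Ne.symm h]
    simp_rw [this, Finset.sum_add_distrib]
    rw [Finset.sum_comm (f := fun i j => if m i = m j then ‖β j‖ ^ 2 else 0)]
    ring
  rw [h3] at h1
  have h4 := Finset.sum_le_sum h2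
  rw [← Finset.mul_sum] at h4
  linarith

end

/-- A Sobolev-type inequality of Gallagher. -/
theorem le_average_add_integral {g g' h : ℝ → ℝ} (hg : ∀ u, HasDerivAt g (g' u) u)
    (hg' : Continuous g') (hh : Continuous h) (hle : ∀ u, |g' u| ≤ h u) {y δ : ℝ} (hδ : 0 < δ) :
    g y ≤ δ⁻¹ * (∫ u in y..(y + δ), g u) + ∫ u in y..(y + δ), h u := by
  have hcg : Continuous g := continuous_iff_continuousAt.mpr fun u => (hg u).continuousAt
  have hyδ : y ≤ y + δ := by linarith
  have h0 : ∀ u, 0 ≤ h u := fun u => (abs_nonneg _).trans (hle u)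
  have key : ∀ u ∈ Set.Icc y (y + δ), g y ≤ g u + ∫ v in y..(y + δ), h v := by
    intro u hu
    have h1 : ∫ v in y..u, g' v = g u - g y :=
      intervalIntegral.integral_eq_sub_of_hasDerivAt (fun v _ => hg v) (hg'.intervalIntegrable _ _)
    have h2 : |∫ v in y..u, g' v| ≤ ∫ v in y..u, |g' v| :=
      intervalIntegral.abs_integral_le_integral_abs hu.1
    have h3 : ∫ v in y..u, |g' v| ≤ ∫ v in y..u, h v :=
      intervalIntegral.integral_mono_on hu.1 (hg'.abs.intervalIntegrable _ _)
        (hh.intervalIntegrable _ _) fun v _ => hle v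
    have h4 : ∫ v in y..u, h v ≤ ∫ v in y..(y + δ), h v :=
      intervalIntegral.integral_mono_interval le_rfl hu.1 hu.2
        (Filter.Eventually.of_forall h0) (hh.intervalIntegrable _ _)
    have h5 := neg_abs_le (∫ v in y..u, g' v)
    linarith
  have h6 : ∫ _u in y..(y + δ), g y ≤ ∫ u in y..(y + δ), (g u + ∫ v in y..(y + δ), h v) :=
    intervalIntegral.integral_mono_on hyδ (by simp)
      ((hcg.add continuous_const).intervalIntegrable _ _) key
  rw [intervalIntegral.integral_add (hcg.intervalIntegrable _ _) (by simp)] at h6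
  simp only [intervalIntegral.integral_const, add_sub_cancel_left, smul_eq_mul] at h6
  calc g y = δ⁻¹ * (δ * g y) := by field_simp
    _ ≤ δ⁻¹ * ((∫ u in y..(y + δ), g u) + δ * ∫ v in y..(y + δ), h v) := by gcongr
    _ = _ := by field_simp

/-- By the spacing the windows (y, y + δ] are pairwise disjoint. -/
theorem sum_integral_le_of_spaced {P : Type*} (pts : Finset P) (y : P → ℝ) {δ : ℝ}
    (hδ : 0 < δ) (hδ1 : δ ≤ 1) (hy : ∀ p ∈ pts, 0 ≤ y p ∧ y p < 1)
    (hsp : ∀ p ∈ pts, ∀ p' ∈ pts, p ≠ p' → δ ≤ |y p - y p'|) {g : ℝ → ℝ} (hg : Continuous g)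
    (h0 : ∀ u, 0 ≤ g u) :
    ∑ p ∈ pts, ∫ u in (y p)..(y p + δ), g u ≤ ∫ u in (0 : ℝ)..2, g u := by
  have h1 : ∀ p, ∫ u in (y p)..(y p + δ), g u = ∫ u in Set.Ioc (y p) (y p + δ), g u := fun p =>
    intervalIntegral.integral_of_le (by linarith)
  simp_rw [h1]
  rw [intervalIntegral.integral_of_le (by norm_num),
    ← MeasureTheory.integral_biUnion_finset pts (fun p _ => measurableSet_Ioc)]
  · refine MeasureTheory.setIntegral_mono_set ?_ (Filter.Eventually.of_forall h0) ?_
    · exact (hg.integrableOn_Icc (a := 0) (b := 2)).mono_set Set.Ioc_subset_Icc_self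
    · refine LE.le.eventuallyLE fun u hu => ?_
      obtain ⟨p, hp, hu⟩ := Set.mem_iUnion₂.mp hu
      have := hy p hp
      exact ⟨by linarith [hu.1], by linarith [hu.2]⟩
  · intro p hp p' hp' hne
    rw [Function.onFun, Set.disjoint_left]
    rintro u ⟨hu1, hu2⟩ ⟨hu3, hu4⟩
    have := hsp p hp p' hp' hne
    rcases le_abs.mp this with h | h <;> linarith
  · intro p _
    exact (hg.integrableOn_Icc (a := y p) (b := y p + δ)).mono_set Set.Ioc_subset_Icc_self

/-- Gallagher's argument: apply the Sobolev inequality to |F|², whose derivative is at most 2|F||F'|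
≤ N|F|² + N⁻¹|F'|². The weight N balances the two terms, since differentiation multiplies
coefficients by at most 2πN. Disjoint windows and Parseval bound the integrals. Spacing on the line
suffices; distance modulo 1 is not needed. -/
theorem large_sieve {ι P : Type*} (s : Finset ι) (β : ι → ℂ) (m : ι → ℤ) {N : ℝ} (hN : 0 < N)
    (hm : ∀ i ∈ s, |(m i : ℝ)| ≤ N) {T : ℝ}
    (hT : ∀ i ∈ s, ((s.filter fun j => m j = m i).card : ℝ) ≤ T)
    (pts : Finset P) (y : P → ℝ) {δ : ℝ} (hδ : 0 < δ) (hδ1 : δ ≤ 1)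
    (hy : ∀ p ∈ pts, 0 ≤ y p ∧ y p < 1)
    (hsp : ∀ p ∈ pts, ∀ p' ∈ pts, p ≠ p' → δ ≤ |y p - y p'|) :
    ∑ p ∈ pts, ‖expPoly s β m (y p)‖ ^ 2 ≤ 100 * (δ⁻¹ + N) * T * ∑ i ∈ s, ‖β i‖ ^ 2 := by
  rcases s.eq_empty_or_nonempty with rfl | ⟨i₀, hi₀⟩
  · simp [expPoly]
  have hT0 : 0 ≤ T := (Nat.cast_nonneg _).trans (hT i₀ hi₀)
  set β' : ι → ℂ := fun i => β i * (2 * Real.pi * m i * Complex.I) with hβ'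
  set F := expPoly s β m with hF
  set F' := expPoly s β' m with hF'
  have hd : ∀ u, HasDerivAt F (F' u) u := hasDerivAt_expPoly s β m
  have hcF : Continuous F := continuous_expPoly _ _ _
  have hcF' : Continuous F' := continuous_expPoly _ _ _
  have hgd : ∀ u, HasDerivAt (fun u => ‖F u‖ ^ 2) (2 * inner ℝ (F u) (F' u)) u :=
    fun u => (hd u).norm_sq
  set h : ℝ → ℝ := fun u => N * ‖F u‖ ^ 2 + N⁻¹ * ‖F' u‖ ^ 2 with hh
  have hch : Continuous h := by fun_prop
  have hle : ∀ u, |2 * inner ℝ (F u) (F' u)| ≤ h u := by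
    intro u
    rw [abs_mul, abs_two]
    have h1 := abs_real_inner_le_norm (F u) (F' u)
    have h2 : 2 * (‖F u‖ * ‖F' u‖) ≤ h u := by
      have := mul_nonneg (inv_nonneg.mpr hN.le) (sq_nonneg (N * ‖F u‖ - ‖F' u‖))
      have h3 : N⁻¹ * (N * ‖F u‖ - ‖F' u‖) ^ 2 = h u - 2 * (‖F u‖ * ‖F' u‖) := by
        simp only [hh]; field_simp; ring
      linarith
    linarith
  have hpt : ∀ p ∈ pts, ‖F (y p)‖ ^ 2 ≤
      δ⁻¹ * (∫ u in (y p)..(y p + δ), ‖F u‖ ^ 2) + ∫ u in (y p)..(y p + δ), h u := fun p _ =>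
    le_average_add_integral hgd (by fun_prop) hch hle hδ
  have hE : ∫ u in (0 : ℝ)..2, ‖F u‖ ^ 2 ≤ 2 * T * ∑ i ∈ s, ‖β i‖ ^ 2 :=
    integral_normSq_expPoly_le s β m T hT
  have hE' : ∫ u in (0 : ℝ)..2, ‖F' u‖ ^ 2 ≤ 2 * T * ((2 * Real.pi * N) ^ 2 * ∑ i ∈ s, ‖β i‖ ^ 2) := by
    refine (integral_normSq_expPoly_le s β' m T hT).trans ?_
    refine mul_le_mul_of_nonneg_left ?_ (by positivity)
    rw [Finset.mul_sum]
    refine Finset.sum_le_sum fun i hi => ?_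
    have hn : ‖β' i‖ = ‖β i‖ * (2 * Real.pi * |(m i : ℝ)|) := by
      simp [hβ', abs_of_pos Real.pi_pos]
    rw [hn, mul_pow, mul_comm]
    have := hm i hi
    gcongr
  have hI : ∫ u in (0 : ℝ)..2, h u =
      N * (∫ u in (0 : ℝ)..2, ‖F u‖ ^ 2) + N⁻¹ * ∫ u in (0 : ℝ)..2, ‖F' u‖ ^ 2 := by
    simp only [hh]
    rw [intervalIntegral.integral_add, intervalIntegral.integral_const_mul,
      intervalIntegral.integral_const_mul]
    · exact Continuous.intervalIntegrable (by fun_prop) _ _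
    · exact Continuous.intervalIntegrable (by fun_prop) _ _
  set S := ∑ i ∈ s, ‖β i‖ ^ 2 with hS
  have hS0 : 0 ≤ S := Finset.sum_nonneg fun _ _ => by positivity
  calc ∑ p ∈ pts, ‖F (y p)‖ ^ 2
      ≤ ∑ p ∈ pts, (δ⁻¹ * (∫ u in (y p)..(y p + δ), ‖F u‖ ^ 2) +
          ∫ u in (y p)..(y p + δ), h u) := Finset.sum_le_sum hpt
    _ = δ⁻¹ * (∑ p ∈ pts, ∫ u in (y p)..(y p + δ), ‖F u‖ ^ 2) +
          ∑ p ∈ pts, ∫ u in (y p)..(y p + δ), h u := by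
        rw [Finset.sum_add_distrib, Finset.mul_sum]
    _ ≤ δ⁻¹ * (∫ u in (0 : ℝ)..2, ‖F u‖ ^ 2) + ∫ u in (0 : ℝ)..2, h u := by
        refine add_le_add (mul_le_mul_of_nonneg_left ?_ (by positivity)) ?_
        · exact sum_integral_le_of_spaced pts y hδ hδ1 hy hsp (by fun_prop) fun u => by positivity
        · exact sum_integral_le_of_spaced pts y hδ hδ1 hy hsp hch fun u => by
            simp only [hh]; positivity
    _ ≤ δ⁻¹ * (2 * T * S) + (N * (2 * T * S) + N⁻¹ * (2 * T * ((2 * Real.pi * N) ^ 2 * S))) := by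
        rw [hI]; gcongr
    _ = (2 * δ⁻¹ + (2 + 8 * Real.pi ^ 2) * N) * (T * S) := by field_simp; ring
    _ ≤ (100 * (δ⁻¹ + N)) * (T * S) := by
        refine mul_le_mul_of_nonneg_right ?_ (by positivity)
        have hpi : Real.pi ^ 2 ≤ 10 := by nlinarith [Real.pi_lt_d2, Real.pi_pos]
        have : 0 < δ⁻¹ := by positivity
        nlinarith
    _ = _ := by ring

/-! ### Fourier expansion of smoothed integer-part functions -/

/-- The integral of the floor function from `0` to `z`. -/
noncomputable def floorIntegral (z : ℝ) : ℝ := z ^ 2 / 2 - z / 2 - (Int.fract z ^ 2 - Int.fract z) / 2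

theorem floorIntegral_eq (z : ℝ) : floorIntegral z = ⌊z⌋ * z - ⌊z⌋ * (⌊z⌋ + 1) / 2 := by
  rw [floorIntegral, Int.fract]; ring

theorem mul_sub_le_floorIntegral (n : ℤ) (z : ℝ) : n * z - n * (n + 1) / 2 ≤ floorIntegral z := by
  rw [floorIntegral_eq]
  have h1 := Int.floor_le z
  have h2 := Int.lt_floor_add_one z
  rcases lt_trichotomy n ⌊z⌋ with h | h | h
  · have h3 : (n : ℝ) + 1 ≤ ⌊z⌋ := by exact_mod_cast h
    nlinarith
  · rw [h]
  · have h3 : (⌊z⌋ : ℝ) + 1 ≤ n := by exact_mod_cast h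
    nlinarith

/-- `floorIntegral` is convex and piecewise linear, and ⌊z⌋ is a subgradient at z. This places the
floor between the backward and forward difference quotients of `floorIntegral`. -/
theorem floor_mul_sub_le (z y : ℝ) : ⌊z⌋ * (y - z) ≤ floorIntegral y - floorIntegral z := by
  have h1 := mul_sub_le_floorIntegral ⌊z⌋ y
  have h2 := floorIntegral_eq z
  linarith

/-- The Fourier cosine coefficients of the smoothed counting function. -/
noncomputable def cosCoef (A w : ℝ) (k : ℕ) : ℝ :=
  (Real.cos (2 * Real.pi * k * (A + w)) - Real.cos (2 * Real.pi * k * A)) / (Real.pi ^ 2 * k ^ 2 * w)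

/-- The Fourier series of the second Bernoulli polynomial, extended periodically through the
fractional part. -/
theorem hasSum_cos_div_sq (z : ℝ) :
    HasSum (fun k : ℕ => 1 / (k : ℝ) ^ 2 * Real.cos (2 * Real.pi * k * z))
      (Real.pi ^ 2 * (Int.fract z ^ 2 - Int.fract z + 1 / 6)) := by
  have h := hasSum_one_div_nat_pow_mul_cos (k := 1) one_ne_zero (x := Int.fract z)
    ⟨Int.fract_nonneg z, (Int.fract_lt_one z).le⟩
  have hb := bernoulliFun_two (Int.fract z)
  rw [bernoulliFun] at hb
  have he : (-1 : ℝ) ^ (1 + 1) * (2 * Real.pi) ^ (2 * 1) / 2 / ((2 * 1).factorial : ℝ) *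
      (Polynomial.map (algebraMap ℚ ℝ) (Polynomial.bernoulli (2 * 1))).eval (Int.fract z) =
      Real.pi ^ 2 * (Int.fract z ^ 2 - Int.fract z + 1 / 6) := by
    rw [mul_one, hb, Nat.factorial_two]; push_cast; ring
  rw [he] at h
  convert h using 2 with k
  rw [mul_one]
  congr 1
  conv_lhs => rw [← Int.floor_add_fract z]
  rw [mul_add, add_comm]
  have := Real.cos_add_int_mul_two_pi (2 * Real.pi * k * Int.fract z) (k * ⌊z⌋)
  rw [← this]
  congr 1
  push_cast
  ring

/-- The value of the cosine series with coefficients `cosCoef A w`. -/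
noncomputable def cosSeries (A w y : ℝ) : ℝ :=
  ((2 * A + w) - 1) -
    (floorIntegral (A - y + w) - floorIntegral (A - y) + floorIntegral (A + y + w) -
      floorIntegral (A + y)) / w

/-- In the difference quotients of `floorIntegral` at A - y and A + y the polynomial parts add up to
2A + w - 1. The fractional parts have the series `hasSum_cos_div_sq`, and adding the terms at A - y
and A + y leaves only products with cos(2πky). -/
theorem hasSum_cosSeries (A y : ℝ) {w : ℝ} (hw : 0 < w) :
    HasSum (fun k : ℕ => cosCoef A w k * Real.cos (2 * Real.pi * k * y)) (cosSeries A w y) := by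
  have h := ((((hasSum_cos_div_sq (A - y + w)).sub (hasSum_cos_div_sq (A - y))).add
    (hasSum_cos_div_sq (A + y + w))).sub (hasSum_cos_div_sq (A + y))).mul_left
      (1 / (2 * Real.pi ^ 2 * w))
  have hval : cosSeries A w y = 1 / (2 * Real.pi ^ 2 * w) *
      (Real.pi ^ 2 * (Int.fract (A - y + w) ^ 2 - Int.fract (A - y + w) + 1 / 6) -
            Real.pi ^ 2 * (Int.fract (A - y) ^ 2 - Int.fract (A - y) + 1 / 6) +
          Real.pi ^ 2 * (Int.fract (A + y + w) ^ 2 - Int.fract (A + y + w) + 1 / 6) -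
        Real.pi ^ 2 * (Int.fract (A + y) ^ 2 - Int.fract (A + y) + 1 / 6)) := by
    simp only [cosSeries, floorIntegral]
    field_simp
    ring
  rw [hval]
  refine (congrArg (HasSum · _) (funext fun k => ?_)).mpr h
  · rw [cosCoef]
    have e1 : 2 * Real.pi * k * (A - y + w) = 2 * Real.pi * k * (A + w) - 2 * Real.pi * k * y := by
      ring
    have e2 : 2 * Real.pi * k * (A + y + w) = 2 * Real.pi * k * (A + w) + 2 * Real.pi * k * y := by
      ring
    rw [e1, e2, mul_sub _ A y, mul_add _ A y, Real.cos_sub, Real.cos_add, Real.cos_sub, Real.cos_add]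
    rcases Nat.eq_zero_or_pos k with rfl | hk
    · simp
    · have : (k : ℝ) ≠ 0 := by positivity
      field_simp
      ring

/-- The count increases with the width A, so it is at most its mean over [A, A + w]. That mean is
continuous with an absolutely convergent Fourier series. The lower bound `le_floor_add_floor` uses
the mean over [A - w, A]. -/
theorem floor_add_floor_le (A y : ℝ) {w : ℝ} (hw : 0 < w) :
    (⌊A - y⌋ : ℝ) + ⌊A + y⌋ + 1 ≤ 2 * A + w - cosSeries A w y := by
  have h1 := floor_mul_sub_le (A - y) (A - y + w)
  have h2 := floor_mul_sub_le (A + y) (A + y + w)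
  rw [cosSeries]
  have h3 : (⌊A - y⌋ : ℝ) + ⌊A + y⌋ ≤ (floorIntegral (A - y + w) - floorIntegral (A - y) +
      floorIntegral (A + y + w) - floorIntegral (A + y)) / w := by
    rw [le_div_iff₀ hw]; nlinarith
  linarith

theorem le_floor_add_floor (A y : ℝ) {w : ℝ} (hw : 0 < w) :
    2 * A - w - cosSeries (A - w) w y ≤ (⌊A - y⌋ : ℝ) + ⌊A + y⌋ + 1 := by
  have h1 := floor_mul_sub_le (A - y) (A - w - y)
  have h2 := floor_mul_sub_le (A + y) (A - w + y)
  rw [cosSeries]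
  have e1 : A - w - y + w = A - y := by ring
  have e2 : A - w + y + w = A + y := by ring
  rw [e1, e2]
  have h3 : (floorIntegral (A - y) - floorIntegral (A - w - y) +
      floorIntegral (A + y) - floorIntegral (A - w + y)) / w ≤ (⌊A - y⌋ : ℝ) + ⌊A + y⌋ := by
    rw [div_le_iff₀ hw]; nlinarith
  linarith

theorem abs_cosCoef_le_inv (A : ℝ) {w : ℝ} (hw : 0 < w) (k : ℕ) : |cosCoef A w k| ≤ 1 / k := by
  rcases Nat.eq_zero_or_pos k with rfl | hk
  · simp [cosCoef]
  have hk' : (0 : ℝ) < k := by exact_mod_cast hk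
  have hpi := Real.pi_gt_three
  rw [cosCoef, abs_div, abs_of_pos (a := Real.pi ^ 2 * k ^ 2 * w) (by positivity),
    div_le_div_iff₀ (by positivity) hk', one_mul]
  have h : |Real.cos (2 * Real.pi * k * (A + w)) - Real.cos (2 * Real.pi * k * A)| ≤
      2 * Real.pi * k * w := by
    have e : 2 * Real.pi * k * (A + w) - 2 * Real.pi * k * A = 2 * Real.pi * k * w := by ring
    have h := Real.lipschitzWith_cos.dist_le_mul (2 * Real.pi * k * (A + w)) (2 * Real.pi * k * A)
    rw [Real.dist_eq, Real.dist_eq, e, abs_of_pos (a := 2 * Real.pi * k * w) (by positivity)] at h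
    simpa using h
  calc _ ≤ 2 * Real.pi * k * w * k := by gcongr
    _ = 2 * (Real.pi * k ^ 2 * w) := by ring
    _ ≤ Real.pi * (Real.pi * k ^ 2 * w) := by
        have : 0 ≤ Real.pi * k ^ 2 * w := by positivity
        nlinarith
    _ = _ := by ring

/-- The quadratic decay comes from the smoothing and serves only to truncate the series. -/
theorem abs_cosCoef_le_inv_sq (A : ℝ) {w : ℝ} (hw : 0 < w) (k : ℕ) :
    |cosCoef A w k| ≤ w⁻¹ * ((k : ℝ) ^ 2)⁻¹ := by
  rcases Nat.eq_zero_or_pos k with rfl | hk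
  · simp [cosCoef]
  have hk' : (0 : ℝ) < k := by exact_mod_cast hk
  have hpi := Real.pi_gt_three
  rw [cosCoef, abs_div, abs_of_pos (a := Real.pi ^ 2 * k ^ 2 * w) (by positivity),
    div_le_iff₀ (by positivity)]
  have e : w⁻¹ * ((k : ℝ) ^ 2)⁻¹ * (Real.pi ^ 2 * k ^ 2 * w) = Real.pi ^ 2 := by field_simp
  rw [e, abs_le]
  have h1 := Real.cos_le_one (2 * Real.pi * k * (A + w))
  have h2 := Real.cos_le_one (2 * Real.pi * k * A)
  have h3 := Real.neg_one_le_cos (2 * Real.pi * k * (A + w))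
  have h4 := Real.neg_one_le_cos (2 * Real.pi * k * A)
  constructor <;> nlinarith

/-- The difference of cosines is a product of two sines, each at most its argument. For k|2A + w| <
1/2 this improves on the bound 1/k, and the large sieve estimate needs this gain at low frequencies.
-/
theorem abs_cosCoef_le (A : ℝ) {w : ℝ} (hw : 0 < w) (k : ℕ) :
    |cosCoef A w k| ≤ 2 * |2 * A + w| := by
  rcases Nat.eq_zero_or_pos k with rfl | hk
  · simp [cosCoef]
  have hk' : (0 : ℝ) < k := by exact_mod_cast hk
  have hpi := Real.pi_pos
  rw [cosCoef, abs_div, abs_of_pos (a := Real.pi ^ 2 * k ^ 2 * w) (by positivity),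
    div_le_iff₀ (by positivity), Real.cos_sub_cos, abs_mul, abs_mul, abs_neg, abs_two]
  have h1 := Real.abs_sin_le_abs
    (x := (2 * Real.pi * k * (A + w) + 2 * Real.pi * k * A) / 2)
  have h2 := Real.abs_sin_le_abs
    (x := (2 * Real.pi * k * (A + w) - 2 * Real.pi * k * A) / 2)
  have e1 : (2 * Real.pi * k * (A + w) + 2 * Real.pi * k * A) / 2 = Real.pi * k * (2 * A + w) := by
    ring
  have e2 : (2 * Real.pi * k * (A + w) - 2 * Real.pi * k * A) / 2 = Real.pi * k * w := by ring
  rw [e1] at h1 ⊢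
  rw [e2] at h2 ⊢
  rw [abs_mul, abs_of_pos (a := Real.pi * k) (by positivity)] at h1
  rw [abs_of_pos (a := Real.pi * k * w) (by positivity)] at h2
  calc _ ≤ 2 * (Real.pi * k * |2 * A + w|) * (Real.pi * k * w) := by gcongr
    _ = _ := by ring

theorem abs_cosSeries_sub_le (A y : ℝ) {w : ℝ} (hw : 0 < w) {K : ℕ} (hK : 1 ≤ K) :
    |cosSeries A w y - ∑ k ∈ Finset.Ico 1 K, cosCoef A w k * Real.cos (2 * Real.pi * k * y)|
      ≤ 2 / (w * K) := by
  have ht := (hasSum_cosSeries A y hw).tendsto_sum_nat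
  -- The coefficient at k = 0 is a division by zero, hence 0, so including it changes nothing.
  have h0 : ∑ k ∈ Finset.Ico 1 K, cosCoef A w k * Real.cos (2 * Real.pi * k * y) =
      ∑ k ∈ Finset.range K, cosCoef A w k * Real.cos (2 * Real.pi * k * y) := by
    rw [Finset.range_eq_Ico, Finset.sum_eq_sum_Ico_succ_bot (by omega : 0 < K)]
    simp [cosCoef]
  rw [h0]
  refine le_of_tendsto (ht.sub_const _).abs ?_
  filter_upwards [Filter.eventually_ge_atTop K] with n hn
  rw [← Finset.sum_range_add_sum_Ico _ hn, add_sub_cancel_left]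
  refine (Finset.abs_sum_le_sum_abs _ _).trans ?_
  calc ∑ k ∈ Finset.Ico K n, |cosCoef A w k * Real.cos (2 * Real.pi * k * y)|
      ≤ ∑ k ∈ Finset.Ico K n, w⁻¹ * ((k : ℝ) ^ 2)⁻¹ := by
        refine Finset.sum_le_sum fun k _ => ?_
        rw [abs_mul]
        have h1 := abs_cosCoef_le_inv_sq A hw k
        have h2 := Real.abs_cos_le_one (2 * Real.pi * k * y)
        nlinarith [abs_nonneg (cosCoef A w k), abs_nonneg (Real.cos (2 * Real.pi * k * y))]
    _ = w⁻¹ * ∑ k ∈ Finset.Ioo (K - 1) n, ((k : ℝ) ^ 2)⁻¹ := by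
        rw [Finset.mul_sum]
        refine Finset.sum_congr ?_ fun _ _ => rfl
        ext k; simp; omega
    _ ≤ w⁻¹ * (2 / ((K - 1 : ℕ) + 1)) := by
        gcongr
        exact_mod_cast sum_Ioo_inv_sq_le (α := ℝ) (K - 1) n
    _ = _ := by
        have : (((K - 1 : ℕ) : ℝ) + 1) = K := by
          rw [Nat.cast_sub hK]; simp
        rw [this]; field_simp

/-! ### Spacing of the roots of `ν² + 1 ≡ 0` -/

/-- With ν² + 1 = de and ν'² + 1 = d'e', the right side equals dd'(de' + d'e - 2νν' - 2). It is
positive unless the two pairs coincide, and then the integer factor is at least 1. -/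
theorem mul_le_sq_add_sq_of_dvd {d d' ν ν' : ℤ} (hd : 0 < d) (hd' : 0 < d')
    (h : d ∣ ν ^ 2 + 1) (h' : d' ∣ ν' ^ 2 + 1) (hne : ¬ (d = d' ∧ ν = ν')) :
    d * d' ≤ (ν * d' - ν' * d) ^ 2 + (d - d') ^ 2 := by
  obtain ⟨e, he⟩ := h
  obtain ⟨e', he'⟩ := h'
  set m := d * e' + d' * e - 2 * ν * ν' - 2 with hm
  have key : (ν * d' - ν' * d) ^ 2 + (d - d') ^ 2 = d * d' * m := by
    rw [hm]; linear_combination d' ^ 2 * he + d ^ 2 * he'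
  have hpos : 0 < (ν * d' - ν' * d) ^ 2 + (d - d') ^ 2 := by
    by_contra hcon
    have h1 : (ν * d' - ν' * d) ^ 2 = 0 := by
      nlinarith [sq_nonneg (ν * d' - ν' * d), sq_nonneg (d - d')]
    have h2 : (d - d') ^ 2 = 0 := by
      nlinarith [sq_nonneg (ν * d' - ν' * d), sq_nonneg (d - d')]
    have h3 : d = d' := by have := pow_eq_zero_iff (two_ne_zero) |>.mp h2; omega
    have h4 := pow_eq_zero_iff (two_ne_zero) |>.mp h1
    refine hne ⟨h3, ?_⟩
    rw [← h3, ← sub_mul] at h4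
    rcases mul_eq_zero.mp h4 with h5 | h5
    · omega
    · omega
  have hm1 : 0 < m := by
    rw [key] at hpos
    exact pos_of_mul_pos_right hpos (by positivity)
  rw [key]
  have : 0 < d * d' := by positivity
  nlinarith

/-- The residues `μ` modulo `d` with `(qμ)² ≡ -1`. -/
def rootSet (q d : ℕ) : Finset ℕ := (Finset.range d).filter fun μ => d ∣ (q * μ) ^ 2 + 1

/-- For d, d' in [X, 5X/3] one has (d - d')² ≤ 4X²/9, which is less than half of dd' ≥ X². So (νd' -
ν'd)² is at least dd'/2 with ν = qμ and ν' = qμ'. Dividing by qdd' gives a gap of order 1/(qX),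
instead of the 1/X² of general fractions. -/
theorem rootSet_spaced {q d d' μ μ' : ℕ} (hq : 0 < q) (h : μ ∈ rootSet q d) (h' : μ' ∈ rootSet q d')
    (hne : (d, μ) ≠ (d', μ')) {X : ℝ} (hX : 0 < X) (h1 : X ≤ d) (h2 : d ≤ 5 / 3 * X) (h1' : X ≤ d')
    (h2' : d' ≤ 5 / 3 * X) : (3 * q * X)⁻¹ ≤ |(μ : ℝ) / d - μ' / d'| := by
  simp only [rootSet, Finset.mem_filter, Finset.mem_range] at h h'
  have hd : (0 : ℝ) < d := by linarith
  have hd' : (0 : ℝ) < d' := by linarith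
  have hqr : (0 : ℝ) < q := by exact_mod_cast hq
  have hz := mul_le_sq_add_sq_of_dvd (d := d) (d' := d') (ν := q * μ) (ν' := q * μ')
    (by exact_mod_cast hd) (by exact_mod_cast hd') (by exact_mod_cast h.2) (by exact_mod_cast h'.2)
    (by
      rintro ⟨ha, hb⟩
      have ha' : d = d' := by exact_mod_cast ha
      have hb' : q * μ = q * μ' := by exact_mod_cast hb
      exact hne (Prod.ext ha' (Nat.eq_of_mul_eq_mul_left hq hb')))
  have hr : (d : ℝ) * d' ≤ (q * μ * d' - q * μ' * d) ^ 2 + (d - d') ^ 2 := by exact_mod_cast hz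
  set a : ℝ := (μ : ℝ) / d - μ' / d' with ha
  have e : (q * μ * d' - q * μ' * d : ℝ) = q * (d * d') * a := by
    rw [ha]; field_simp
  rw [e] at hr
  have h3 : ((d : ℝ) - d') ^ 2 ≤ 4 / 9 * X ^ 2 := by nlinarith
  have h4 : X ^ 2 ≤ d * d' := by nlinarith
  have h5 : (d : ℝ) * d' ≤ 25 / 9 * X ^ 2 := by nlinarith
  have h6 : (d * d' : ℝ) * 1 ≤ (d * d') * (2 * (d * d') * (q * a) ^ 2) := by nlinarith
  have h7 : 1 ≤ 2 * (d * d' : ℝ) * (q * a) ^ 2 := le_of_mul_le_mul_left h6 (by positivity)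
  have h8 : 1 ≤ (3 * q * X * |a|) ^ 2 := by
    calc (1 : ℝ) ≤ 2 * (d * d' : ℝ) * (q * a) ^ 2 := h7
      _ ≤ 2 * (25 / 9 * X ^ 2) * (q * a) ^ 2 := by gcongr
      _ ≤ 9 * X ^ 2 * (q * a) ^ 2 := by nlinarith [sq_nonneg (X * (q * a))]
      _ = _ := by rw [mul_pow _ |a|, sq_abs]; ring
  have h9 : 1 ≤ 3 * q * X * |a| := by
    have : 0 ≤ 3 * q * X * |a| := by positivity
    nlinarith
  rwa [inv_le_iff_one_le_mul₀' (by positivity)]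

theorem large_sieve_rootSet {ι : Type*} (s : Finset ι) (β : ι → ℂ) (m : ι → ℤ) {N : ℝ} (hN : 0 < N)
    (hm : ∀ i ∈ s, |(m i : ℝ)| ≤ N) {T : ℝ}
    (hT : ∀ i ∈ s, ((s.filter fun j => m j = m i).card : ℝ) ≤ T)
    {q : ℕ} (hq : 0 < q) {X : ℝ} (hX : 1 ≤ X) (B : Finset ℕ)
    (hB : ∀ d ∈ B, X ≤ d ∧ d ≤ 5 / 3 * X) :
    ∑ d ∈ B, ∑ μ ∈ rootSet q d, ‖expPoly s β m ((μ : ℝ) / d)‖ ^ 2 ≤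
      100 * (3 * q * X + N) * T * ∑ i ∈ s, ‖β i‖ ^ 2 := by
  rw [Finset.sum_sigma']
  have hq1 : (1 : ℝ) ≤ q := by exact_mod_cast hq
  have hδ : (0 : ℝ) < (3 * q * X)⁻¹ := by positivity
  have h := large_sieve s β m hN hm hT (B.sigma fun d => rootSet q d)
    (fun p => (p.2 : ℝ) / p.1) hδ (inv_le_one_of_one_le₀ (by nlinarith))
    (fun p hp => by
      rw [Finset.mem_sigma] at hp
      have h1 := (Finset.mem_filter.mp hp.2).1
      rw [Finset.mem_range] at h1
      have h2 : (p.2 : ℝ) < p.1 := by exact_mod_cast h1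
      have h3 : (0 : ℝ) < p.1 := by linarith [(hB _ hp.1).1]
      exact ⟨by positivity, (div_lt_one h3).mpr h2⟩)
    (fun p hp p' hp' hne => by
      rw [Finset.mem_sigma] at hp hp'
      refine rootSet_spaced hq hp.2 hp'.2 ?_ (by linarith) (hB _ hp.1).1 (hB _ hp.1).2
        (hB _ hp'.1).1 (hB _ hp'.1).2
      intro he
      apply hne
      obtain ⟨d, μ⟩ := p
      obtain ⟨d', μ'⟩ := p'
      simp only [Prod.mk.injEq] at he
      obtain ⟨rfl, rfl⟩ := he
      rfl)
  rwa [inv_inv] at h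

/-! ### Counting integers in a residue class -/

/-- Writing a = β + Mm turns the count into that of m with |m + β/M| ≤ U/M, the symmetric form to
which the cosine expansion applies. -/
theorem card_Icc_filter_modEq {M : ℕ} (hM : 0 < M) {U : ℝ} (hU : 0 ≤ U) (β : ℤ) :
    ((((Finset.Icc (-⌊U⌋) ⌊U⌋).filter fun a : ℤ => a ≡ β [ZMOD M]).card : ℤ) : ℝ) =
      (⌊U / M - β / M⌋ : ℝ) + ⌊U / M + β / M⌋ + 1 := by
  have hz : 0 ≤ ⌊U⌋ := Int.floor_nonneg.mpr hU
  have hMz : (0 : ℤ) < M := by exact_mod_cast hM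
  have h0 : Finset.Icc (-⌊U⌋) ⌊U⌋ = Finset.Ioc (-⌊U⌋ - 1) ⌊U⌋ := by
    ext a; simp only [Finset.mem_Icc, Finset.mem_Ioc]; omega
  have h1 : ⌊U / M - β / M⌋ = (⌊U⌋ - β) / (M : ℤ) := by
    rw [← sub_div, Int.floor_div_natCast, Int.floor_sub_intCast]
  have h2 : ⌊U / M + β / M⌋ = (⌊U⌋ + β) / (M : ℤ) := by
    rw [← add_div, Int.floor_div_natCast, Int.floor_add_intCast]
  have h3 : (-⌊U⌋ - 1 - β) / (M : ℤ) = -((⌊U⌋ + β) / (M : ℤ)) - 1 := by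
    have a2 := Int.emod_add_mul_ediv (⌊U⌋ + β) M
    have a3 := Int.emod_lt_of_pos (⌊U⌋ + β) hMz
    have a4 := Int.emod_nonneg (⌊U⌋ + β) hMz.ne'
    refine ((Int.ediv_emod_unique (r := M - 1 - (⌊U⌋ + β) % M) hMz).mpr ⟨?_, ?_, ?_⟩).1
    · rw [mul_sub, mul_neg, mul_one]; omega
    · omega
    · omega
  have h4 := Int.Ioc_filter_modEq_card (-⌊U⌋ - 1) ⌊U⌋ hMz β
  have e1 : ((⌊U⌋ : ℚ) - β) / ((M : ℤ) : ℚ) = ((⌊U⌋ - β : ℤ) : ℚ) / (M : ℕ) := by push_cast; rfl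
  have e2 : (((-⌊U⌋ - 1 : ℤ) : ℚ) - β) / ((M : ℤ) : ℚ) = ((-⌊U⌋ - 1 - β : ℤ) : ℚ) / (M : ℕ) := by
    push_cast; rfl
  rw [e1, e2, Rat.floor_intCast_div_natCast, Rat.floor_intCast_div_natCast, h3] at h4
  rw [h0, h4, h1, h2]
  -- The two integer quotients add up to more than 2⌊U⌋/M - 2 ≥ -2, hence to at least -1, so the
  -- maximum with 0 in the counting formula is harmless.
  have h5 : (0 : ℤ) ≤ (⌊U⌋ - β) / (M : ℤ) - (-((⌊U⌋ + β) / (M : ℤ)) - 1) := by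
    have a1 := Int.emod_add_mul_ediv (⌊U⌋ - β) M
    have a2 := Int.emod_add_mul_ediv (⌊U⌋ + β) M
    have a3 := Int.emod_lt_of_pos (⌊U⌋ - β) hMz
    have a4 := Int.emod_lt_of_pos (⌊U⌋ + β) hMz
    by_contra hcon
    push Not at hcon
    have : (M : ℤ) * ((⌊U⌋ - β) / (M : ℤ) + (⌊U⌋ + β) / (M : ℤ)) ≤ M * (-2) := by
      apply mul_le_mul_of_nonneg_left _ hMz.le; omega
    rw [mul_add] at this
    omega
  rw [max_eq_left h5]
  push_cast
  ring

/-! ### Local decomposition of the condition `d ∣ a² + c⁴` -/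

/-- The divisors `e` of `d` that are coprime to `d / e`. -/
def unitaryDivisors (d : ℕ) : Finset ℕ := d.divisors.filter fun e => e.Coprime (d / e)

theorem Cubefree.of_dvd {d e : ℕ} (hd : Cubefree d) (h : e ∣ d) : Cubefree e :=
  fun p hp hpe => hd p hp (hpe.trans h)

theorem Cubefree.dvd_radical_sq {e : ℕ} (he : Cubefree e) (h0 : e ≠ 0) : e ∣ radical e ^ 2 := by
  rw [Nat.radical_eq_prod_primeFactors]
  conv_lhs => rw [← Nat.prod_factorization_pow_eq_self h0]
  rw [Finsupp.prod, Nat.support_factorization, ← Finset.prod_pow]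
  refine Finset.prod_dvd_prod_of_dvd _ _ fun p hp => pow_dvd_pow p ?_
  by_contra hcon
  have hpp := Nat.prime_of_mem_primeFactors hp
  exact he p hpp ((pow_dvd_pow p (by omega)).trans (Nat.ordProj_dvd e p))

theorem natRadical_dvd_iff {e n : ℕ} (he : e ≠ 0) :
    radical e ∣ n ↔ ∀ p : ℕ, p.Prime → p ∣ e → p ∣ n := by
  rw [Nat.radical_eq_prod_primeFactors]
  constructor
  · intro h p hp hpe
    exact (Finset.dvd_prod_of_mem (fun p => p) (Nat.mem_primeFactors.mpr ⟨hp, hpe, he⟩)).trans h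
  · intro h
    refine Finset.prod_primes_dvd n (fun p hp => (Nat.prime_of_mem_primeFactors hp).prime)
      fun p hp => h p (Nat.prime_of_mem_primeFactors hp) (Nat.dvd_of_mem_primeFactors hp)

theorem Cubefree.dvd_sq_of_radical_dvd {e n : ℕ} (he : Cubefree e) (h0 : e ≠ 0)
    (h : radical e ∣ n) : e ∣ n ^ 2 :=
  (he.dvd_radical_sq h0).trans (pow_dvd_pow_of_dvd h 2)

theorem eq_gcd_of_unitary {d c e : ℕ} (hd : Cubefree d) (hd0 : d ≠ 0)
    (he : e ∣ d) (hc : radical e ∣ c) (hcop : c.Coprime (d / e)) : e = Nat.gcd (c ^ 2) d := by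
  have he0 : e ≠ 0 := ne_zero_of_dvd_ne_zero hd0 he
  have h1 : e ∣ c ^ 2 := (hd.of_dvd he).dvd_sq_of_radical_dvd he0 hc
  conv_rhs => rw [← Nat.mul_div_cancel' he]
  rw [Nat.Coprime.gcd_mul_right_cancel_right e (Nat.Coprime.pow_left 2 hcop).symm]
  exact (Nat.gcd_eq_right h1).symm

/-- A prime dividing both c and d divides d at most twice, so its whole power in d divides c². Thus
gcd(c², d) collects the full prime powers of d at the primes dividing c. -/
theorem gcd_mem_unitaryDivisors {d : ℕ} (hd : Cubefree d) (hd0 : d ≠ 0) (c : ℕ) :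
    Nat.gcd (c ^ 2) d ∈ unitaryDivisors d ∧ radical (Nat.gcd (c ^ 2) d) ∣ c ∧
      c.Coprime (d / Nat.gcd (c ^ 2) d) := by
  set e := Nat.gcd (c ^ 2) d with he
  have hed : e ∣ d := Nat.gcd_dvd_right _ _
  have he0 : e ≠ 0 := ne_zero_of_dvd_ne_zero hd0 hed
  have hc : ∀ p : ℕ, p.Prime → p ∣ e → p ∣ c := fun p hp hpe =>
    hp.dvd_of_dvd_pow (hpe.trans (Nat.gcd_dvd_left _ _))
  have hcop : c.Coprime (d / e) := by
    refine Nat.coprime_of_dvd fun p hp hpc hpd => ?_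
    have hpd' : p ∣ d := hpd.trans (Nat.div_dvd_of_dvd hed)
    have hpe : p ∣ e := Nat.dvd_gcd (hpc.trans (dvd_pow_self c two_ne_zero)) hpd'
    have h2d : p ^ 2 ∣ d := by
      rw [← Nat.mul_div_cancel' hed, sq]; exact mul_dvd_mul hpe hpd
    have h2e : p ^ 2 ∣ e := Nat.dvd_gcd (pow_dvd_pow_of_dvd hpc 2) h2d
    refine hd p hp ?_
    rw [← Nat.mul_div_cancel' hed, pow_succ]
    exact mul_dvd_mul h2e hpd
  refine ⟨?_, (natRadical_dvd_iff he0).mpr hc, hcop⟩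
  rw [unitaryDivisors, Finset.mem_filter, Nat.mem_divisors]
  refine ⟨⟨hed, hd0⟩, Nat.coprime_of_dvd fun p hp hpe hpd => ?_⟩
  exact hp.one_lt.ne' (Nat.dvd_one.mp (hcop ▸ Nat.dvd_gcd (hc p hp hpe) hpd))

/-- Exactly one unitary divisor meets both conditions for a given c, so these conditions partition
the integers c. -/
theorem sum_unitaryDivisors_indicator {R : Type*} [AddCommMonoid R] {d : ℕ} (hd : Cubefree d)
    (hd0 : d ≠ 0) (c : ℕ) (F : ℕ → R) :
    ∑ e ∈ unitaryDivisors d, (if radical e ∣ c ∧ c.Coprime (d / e) then F e else 0) =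
      F (Nat.gcd (c ^ 2) d) := by
  obtain ⟨h1, h2, h3⟩ := gcd_mem_unitaryDivisors hd hd0 c
  rw [Finset.sum_eq_single_of_mem _ h1]
  · rw [if_pos ⟨h2, h3⟩]
  · intro e he hne
    rw [if_neg]
    rintro ⟨h4, h5⟩
    rw [unitaryDivisors, Finset.mem_filter, Nat.mem_divisors] at he
    exact hne (eq_gcd_of_unitary hd hd0 he.1.1 h4 h5)

/-- A prime p of e occurs to exponent 1 or 2 and divides c, so its power divides c⁴, and it divides
a² exactly when p ∣ a. -/
theorem dvd_sq_add_pow_four_iff {d e : ℕ} {a c : ℤ} (he : Cubefree e) (h0 : e ≠ 0)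
    (hcop : e.Coprime d) (hc : radical e ∣ c.natAbs) :
    ((e * d : ℕ) : ℤ) ∣ a ^ 2 + c ^ 4 ↔ ((radical e : ℕ) : ℤ) ∣ a ∧ (d : ℤ) ∣ a ^ 2 + c ^ 4 := by
  have hrc : ((radical e : ℕ) : ℤ) ∣ c := Int.natCast_dvd.mpr hc
  have h2 : ∀ z : ℤ, ((radical e : ℕ) : ℤ) ∣ z → (e : ℤ) ∣ z ^ 2 := fun z hz => by
    have : (e : ℤ) ∣ ((radical e : ℕ) : ℤ) ^ 2 := by exact_mod_cast he.dvd_radical_sq h0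
    exact this.trans (pow_dvd_pow_of_dvd hz 2)
  have hec : (e : ℤ) ∣ c ^ 4 := by
    rw [show c ^ 4 = c ^ 2 * c ^ 2 by ring]
    exact (h2 c hrc).mul_right _
  have hcop' : IsCoprime (e : ℤ) (d : ℤ) := Nat.isCoprime_iff_coprime.mpr hcop
  push_cast
  constructor
  · intro h
    refine ⟨?_, (dvd_mul_left _ _).trans h⟩
    have h3 : (e : ℤ) ∣ a ^ 2 := (dvd_add_left hec).mp ((dvd_mul_right _ _).trans h)
    rw [Int.natCast_dvd, natRadical_dvd_iff h0]
    intro p hp hpe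
    have h4 : (p : ℤ) ∣ a ^ 2 := (Int.natCast_dvd_natCast.mpr hpe).trans h3
    exact Int.natCast_dvd.mp (Int.Prime.dvd_pow' hp h4)
  · rintro ⟨h3, h4⟩
    exact hcop'.mul_dvd (dvd_add (h2 a h3) hec) h4

/-- Since q and c are units modulo d, the only candidate is μ = a/(qc²). It is a root precisely when
d ∣ a² + c⁴. -/
theorem card_rootSet_filter {q d : ℕ} (hd : 0 < d) (hq : q.Coprime d) {a c : ℤ}
    (hc : c.natAbs.Coprime d) :
    ((rootSet q d).filter fun μ : ℕ => a ≡ q * μ * c ^ 2 [ZMOD d]).card =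
      if (d : ℤ) ∣ a ^ 2 + c ^ 4 then 1 else 0 := by
  have : NeZero d := ⟨hd.ne'⟩
  have huq : IsUnit ((q : ℕ) : ZMod d) := (ZMod.isUnit_iff_coprime q d).mpr hq
  have huc : IsUnit ((c : ℤ) : ZMod d) := by
    have h1 : IsUnit ((c.natAbs : ℕ) : ZMod d) := (ZMod.isUnit_iff_coprime _ d).mpr hc
    rcases Int.natAbs_eq c with h | h
    · rw [h]; simpa using h1
    · rw [h]; simpa using h1
  have hmem : ∀ μ : ℕ, μ ∈ rootSet q d ↔ μ < d ∧ ((q : ZMod d) * μ) ^ 2 + 1 = 0 := by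
    intro μ
    rw [rootSet, Finset.mem_filter, Finset.mem_range, ← ZMod.natCast_eq_zero_iff]
    push_cast; rfl
  have hmod : ∀ μ : ℕ, a ≡ q * μ * c ^ 2 [ZMOD d] ↔ (a : ZMod d) = q * μ * (c : ZMod d) ^ 2 := by
    intro μ
    rw [← ZMod.intCast_eq_intCast_iff]
    push_cast; rfl
  have hdvd : (d : ℤ) ∣ a ^ 2 + c ^ 4 ↔ (a : ZMod d) ^ 2 + (c : ZMod d) ^ 4 = 0 := by
    rw [← ZMod.intCast_zmod_eq_zero_iff_dvd]; push_cast; rfl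
  obtain ⟨uq, huq'⟩ := huq
  obtain ⟨uc, huc'⟩ := huc
  split_ifs with h
  · rw [hdvd] at h
    rw [Finset.card_eq_one]
    set z : ZMod d := (↑(uq⁻¹) : ZMod d) * (↑(uc⁻¹) : ZMod d) ^ 2 * a with hz
    have hqz : (q : ZMod d) * z = (↑(uc⁻¹) : ZMod d) ^ 2 * a := by
      rw [hz, ← huq', ← mul_assoc, ← mul_assoc, Units.mul_inv, one_mul]
    have hcc : (↑(uc⁻¹) : ZMod d) * c = 1 := by rw [← huc', Units.inv_mul]
    refine ⟨z.val, ?_⟩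
    ext μ
    rw [Finset.mem_filter, Finset.mem_singleton, hmem, hmod]
    constructor
    · rintro ⟨⟨h1, h2⟩, h3⟩
      have h4 : (q : ZMod d) * μ = q * z := by
        rw [hqz, h3]
        linear_combination (-(q : ZMod d) * μ * ((↑(uc⁻¹) : ZMod d) * c + 1)) * hcc
      have h5 : ((μ : ℕ) : ZMod d) = z := by
        rw [← huq'] at h4
        exact uq.mul_right_inj.mp h4
      rw [← h5, ZMod.val_natCast_of_lt h1]
    · rintro rfl
      rw [ZMod.natCast_zmod_val, hqz]
      refine ⟨⟨ZMod.val_lt z, ?_⟩, ?_⟩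
      · have : ((↑(uc⁻¹) : ZMod d) * c) ^ 4 = 1 := by rw [hcc, one_pow]
        linear_combination (↑(uc⁻¹) : ZMod d) ^ 4 * h - this
      · linear_combination (-(a : ZMod d) * ((↑(uc⁻¹) : ZMod d) * c + 1)) * hcc
  · rw [Finset.card_eq_zero, Finset.filter_eq_empty_iff]
    intro μ hμ h3
    rw [hmem] at hμ
    rw [hmod] at h3
    apply h
    rw [hdvd, h3]
    linear_combination (c : ZMod d) ^ 4 * hμ.2

/-- The residue `κ` modulo `q` with `m κ ≡ a₀`. -/
noncomputable def crtShift (q : ℕ) (a₀ : ℤ) (m : ℕ) : ℕ := ((m : ZMod q)⁻¹ * (a₀ : ZMod q)).val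

theorem crtShift_lt {q : ℕ} (hq : 0 < q) (a₀ : ℤ) (m : ℕ) : crtShift q a₀ m < q := by
  have : NeZero q := ⟨hq.ne'⟩
  exact ZMod.val_lt _

theorem mul_crtShift {q : ℕ} (hq : 0 < q) (a₀ : ℤ) {m : ℕ} (hm : m.Coprime q) :
    (m : ℤ) * crtShift q a₀ m ≡ a₀ [ZMOD q] := by
  have : NeZero q := ⟨hq.ne'⟩
  rw [← ZMod.intCast_eq_intCast_iff]
  push_cast
  rw [crtShift, ZMod.natCast_zmod_val, ← mul_assoc, ZMod.coe_mul_inv_eq_one m hm, one_mul]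

/-- The factor q in the parametrisation of the roots makes qμc² vanish modulo q, and r ∣ c² makes it
vanish modulo r, while rdκ vanishes modulo rd. So the residue is an explicit sum, and divided by rdq
it is (μ/d)(c²/r) + κ/q, linear in μ/d. -/
theorem modEq_crt_iff {q r d : ℕ} (hq : 0 < q) (hrd : r.Coprime d) (hrq : r.Coprime q)
    (hdq : d.Coprime q) {a₀ a c : ℤ} (hc : (r : ℤ) ∣ c ^ 2) (μ : ℕ) :
    ((r : ℤ) ∣ a ∧ a ≡ q * μ * c ^ 2 [ZMOD d] ∧ a ≡ a₀ [ZMOD q]) ↔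
      a ≡ q * μ * c ^ 2 + (r * d : ℕ) * crtShift q a₀ (r * d) [ZMOD (r * d * q : ℕ)] := by
  set κ := crtShift q a₀ (r * d)
  have hκ : ((r * d : ℕ) : ℤ) * κ ≡ a₀ [ZMOD q] := mul_crtShift hq a₀ (Nat.Coprime.mul_left hrq hdq)
  push_cast at hκ ⊢
  rw [← Int.modEq_and_modEq_iff_modEq_mul (m := (r : ℤ) * d) (n := q)
    (by simpa [Int.natAbs_mul] using Nat.Coprime.mul_left hrq hdq),
    ← Int.modEq_and_modEq_iff_modEq_mul (m := (r : ℤ)) (n := d) (by simpa using hrd)]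
  have e1 : a ≡ q * μ * c ^ 2 + r * d * κ [ZMOD r] ↔ (r : ℤ) ∣ a := by
    have h : (q * μ * c ^ 2 + r * d * κ : ℤ) ≡ 0 [ZMOD r] := by
      rw [Int.modEq_zero_iff_dvd]
      exact dvd_add (hc.mul_left _) ((dvd_mul_right _ _).mul_right _)
    exact ⟨fun h' => Int.modEq_zero_iff_dvd.mp (h'.trans h),
      fun h' => (Int.modEq_zero_iff_dvd.mpr h').trans h.symm⟩
  have e2 : (q * μ * c ^ 2 + r * d * κ : ℤ) ≡ q * μ * c ^ 2 [ZMOD d] := by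
    have : (r * d * κ : ℤ) ≡ 0 [ZMOD d] := by
      rw [Int.modEq_zero_iff_dvd]; exact (dvd_mul_left _ _).mul_right _
    simpa using Int.ModEq.add_left (q * μ * c ^ 2 : ℤ) this
  have e3 : (q * μ * c ^ 2 + r * d * κ : ℤ) ≡ a₀ [ZMOD q] := by
    have : (q * μ * c ^ 2 : ℤ) ≡ 0 [ZMOD q] := by
      rw [Int.modEq_zero_iff_dvd]; exact (dvd_mul_right _ _).mul_right _
    simpa using this.add hκ
  rw [e1, and_assoc]
  exact and_congr_right fun _ => and_congr ⟨fun h => h.trans e2.symm, fun h => h.trans e2⟩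
    ⟨fun h => h.trans e3.symm, fun h => h.trans e3⟩

/-! ### Lattice point counts and their smoothed Fourier expansions -/

/-- The number of integers `m` with `|m + y| ≤ θ`, extended to all real `θ`. -/
noncomputable def latticeCount (θ y : ℝ) : ℝ := ⌊θ - y⌋ + ⌊θ + y⌋ + 1

/-- The partial sum over `1 ≤ k < K` of the series `cosSeries A w y`. -/
noncomputable def truncSeries (A w : ℝ) (K : ℕ) (y : ℝ) : ℝ :=
  ∑ k ∈ Finset.Ico 1 K, cosCoef A w k * Real.cos (2 * Real.pi * k * y)

theorem latticeCount_mono (y : ℝ) : Monotone fun θ => latticeCount θ y := by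
  intro θ θ' h
  have h1 : (⌊θ - y⌋ : ℝ) ≤ ⌊θ' - y⌋ := by exact_mod_cast Int.floor_le_floor (by linarith)
  have h2 : (⌊θ + y⌋ : ℝ) ≤ ⌊θ' + y⌋ := by exact_mod_cast Int.floor_le_floor (by linarith)
  simp only [latticeCount]; linarith

/-- Monotonicity allows the width θ to be replaced by Θ above and by Θ - w below. In the application
Θ is constant on a block of moduli, so the Fourier coefficients no longer depend on d. Width change
and smoothing cost at most 3w on either side, truncation another w. -/
theorem abs_sum_latticeCount_sub_le {ι : Type*} (S : Finset ι) (θ Θ y : ι → ℝ) {w : ℝ} (hw : 0 < w)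
    {K : ℕ} (hK1 : 1 ≤ K) (hK : 2 / (w * K) ≤ w) (h1 : ∀ i ∈ S, θ i ≤ Θ i)
    (h2 : ∀ i ∈ S, Θ i ≤ θ i + w) :
    |∑ i ∈ S, (latticeCount (θ i) (y i) - 2 * θ i)| ≤ 4 * w * S.card +
      |∑ i ∈ S, truncSeries (Θ i) w K (y i)| + |∑ i ∈ S, truncSeries (Θ i - 2 * w) w K (y i)| := by
  have hup : ∀ i ∈ S, latticeCount (θ i) (y i) - 2 * θ i ≤ 4 * w - truncSeries (Θ i) w K (y i) := by
    intro i hi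
    have a1 := latticeCount_mono (y i) (h1 i hi)
    have a2 := floor_add_floor_le (Θ i) (y i) hw
    have a3 := abs_le.mp (abs_cosSeries_sub_le (Θ i) (y i) hw hK1)
    have a4 := h2 i hi
    simp only [latticeCount, truncSeries] at *
    linarith
  have hlo : ∀ i ∈ S, -(4 * w) - truncSeries (Θ i - 2 * w) w K (y i) ≤
      latticeCount (θ i) (y i) - 2 * θ i := by
    intro i hi
    have a4 := h2 i hi
    have a1 := latticeCount_mono (y i) (show Θ i - w ≤ θ i by linarith)
    have a2 := le_floor_add_floor (Θ i - w) (y i) hw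
    have e : Θ i - w - w = Θ i - 2 * w := by ring
    rw [e] at a2
    have a3 := abs_le.mp (abs_cosSeries_sub_le (Θ i - 2 * w) (y i) hw hK1)
    have a5 := h1 i hi
    simp only [latticeCount, truncSeries] at *
    linarith
  have s1 := Finset.sum_le_sum hup
  have s2 := Finset.sum_le_sum hlo
  rw [Finset.sum_sub_distrib (f := fun _ => 4 * w), Finset.sum_const, nsmul_eq_mul] at s1
  rw [Finset.sum_sub_distrib (f := fun _ => -(4 * w)), Finset.sum_const, nsmul_eq_mul] at s2
  have b1 := neg_abs_le (∑ i ∈ S, truncSeries (Θ i) w K (y i))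
  have b2 := le_abs_self (∑ i ∈ S, truncSeries (Θ i - 2 * w) w K (y i))
  have b3 := abs_nonneg (∑ i ∈ S, truncSeries (Θ i) w K (y i))
  have b4 := abs_nonneg (∑ i ∈ S, truncSeries (Θ i - 2 * w) w K (y i))
  rw [abs_le]
  constructor <;> linarith

theorem truncSeries_two_pow (A w : ℝ) (J : ℕ) (y : ℝ) :
    truncSeries A w (2 ^ J) y = ∑ j ∈ Finset.range J,
      ∑ k ∈ Finset.Ico (2 ^ j) (2 ^ (j + 1)), cosCoef A w k * Real.cos (2 * Real.pi * k * y) := by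
  rw [truncSeries]
  induction J with
  | zero => simp
  | succ J ih =>
    rw [Finset.sum_range_succ, ← ih, Finset.sum_Ico_consecutive _ Nat.one_le_two_pow
      (Nat.pow_le_pow_right (by norm_num) (by omega))]

/-- The pairs `(c, k)` with `c ∈ C` and `2 ^ j ≤ k < 2 ^ (j + 1)`. -/
abbrev dyadicBox (C : Finset ℤ) (j : ℕ) : Finset (ℤ × ℕ) :=
  C ×ˢ Finset.Ico (2 ^ j) (2 ^ (j + 1))

/-- The part of `∑ c, truncSeries` coming from frequencies in a dyadic range. -/
noncomputable def dyadicPoly (C : Finset ℤ) (A : ℤ → ℝ) (w : ℝ) (n : ℤ → ℤ) (q κ j : ℕ) : ℝ → ℂ :=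
  expPoly (dyadicBox C j) (fun p => (cosCoef (A p.1) w p.2 : ℂ) * expChar (p.2 * (κ / q)))
    (fun p => p.2 * n p.1)

theorem sum_dyadic_eq_re (C : Finset ℤ) (A : ℤ → ℝ) (w : ℝ) (n : ℤ → ℤ) (q κ : ℕ) (j : ℕ) (u : ℝ) :
    ∑ c ∈ C, ∑ k ∈ Finset.Ico (2 ^ j) (2 ^ (j + 1)),
      cosCoef (A c) w k * Real.cos (2 * Real.pi * k * (u * n c + κ / q)) =
    (dyadicPoly C A w n q κ j u).re := by
  rw [dyadicPoly, expPoly, Finset.sum_product, Complex.re_sum]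
  refine Finset.sum_congr rfl fun c _ => ?_
  rw [Complex.re_sum]
  refine Finset.sum_congr rfl fun k _ => ?_
  simp only
  rw [mul_assoc (cosCoef (A c) w k : ℂ), ← expChar_add, Complex.re_ofReal_mul, expChar_re]
  congr 2
  push_cast
  ring

/-- The coefficients in a dyadic range, of size at most `Θ`, have small mean square. -/
theorem large_sieve_dyadic {q r : ℕ} (hq : 0 < q) (hr : 0 < r) {R : ℝ} (hR : 0 < R)
    (C : Finset ℤ) (n : ℤ → ℤ) (hn : ∀ c ∈ C, r * n c = c ^ 2) (hC : ∀ c ∈ C, c ≠ 0 ∧ (c : ℝ) ^ 2 ≤ R)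
    {J : ℕ} {T : ℝ} (hT : ∀ m : ℕ, m ≠ 0 → (m : ℝ) ≤ 2 ^ J * R → (m.divisors.card : ℝ) ≤ T)
    {X : ℝ} (hX : 1 ≤ X) (B : Finset ℕ) (hB : ∀ d ∈ B, X ≤ d ∧ d ≤ 5 / 3 * X)
    (A : ℤ → ℝ) {w : ℝ} (hw : 0 < w) (hA : ∀ c ∈ C, |2 * A c + w| ≤ 3 * (R / (r * X * q)))
    (κ : ℕ) {j : ℕ} (hj : j < J) :
    ∑ d ∈ B, ∑ μ ∈ rootSet q d,
      ‖dyadicPoly C A w n q κ j ((μ : ℝ) / d)‖ ^ 2 ≤ 4000 * T * C.card * (R / r) := by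
  have hqr : (0 : ℝ) < q := by exact_mod_cast hq
  have hrr : (0 : ℝ) < r := by exact_mod_cast hr
  have hX0 : 0 < X := by linarith
  set Θ : ℝ := R / (r * X * q) with hΘ
  have hΘ0 : 0 < Θ := by positivity
  have hncast : ∀ c ∈ C, (n c : ℝ) = (c : ℝ) ^ 2 / r := by
    intro c hc
    rw [eq_div_iff hrr.ne', mul_comm]
    exact_mod_cast hn c hc
  have hm : ∀ p ∈ dyadicBox C j,
      |(((p.2 : ℤ) * n p.1 : ℤ) : ℝ)| ≤ 2 ^ (j + 1) * (R / r) := by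
    rintro ⟨c, k⟩ hp
    rw [Finset.mem_product, Finset.mem_Ico] at hp
    have hk : (k : ℝ) ≤ 2 ^ (j + 1) := by exact_mod_cast hp.2.2.le
    push_cast
    rw [hncast c hp.1, abs_of_nonneg (by positivity)]
    have := (hC c hp.1).2
    gcongr
  -- Equal frequencies mean equal values m = kc². Then |c| is a divisor of m, and |c| with the sign
  -- of c determines c and hence k. So at most 2τ(m) pairs share a frequency.
  have hmult : ∀ p ∈ dyadicBox C j,
      ((((dyadicBox C j).filter
        fun p' => (p'.2 : ℤ) * n p'.1 = p.2 * n p.1).card : ℕ) : ℝ) ≤ 2 * T := by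
    rintro ⟨c, k⟩ hp
    rw [Finset.mem_product, Finset.mem_Ico] at hp
    obtain ⟨hc, hk1, hk2⟩ := hp
    simp only at hc hk1 hk2
    have hk0 : 0 < k := lt_of_lt_of_le (by positivity) hk1
    have hc0 := (hC c hc).1
    set m : ℕ := k * c.natAbs ^ 2 with hmdef
    have hm0 : m ≠ 0 := by
      have := Int.natAbs_ne_zero.mpr hc0
      positivity
    have hmR : (m : ℝ) ≤ 2 ^ J * R := by
      have hk3 : (k : ℝ) ≤ 2 ^ J := by
        have : (2 : ℕ) ^ (j + 1) ≤ 2 ^ J := Nat.pow_le_pow_right (by norm_num) (by omega)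
        exact_mod_cast hk2.le.trans this
      have h2 := (hC c hc).2
      have h3 : ((c.natAbs : ℕ) : ℝ) ^ 2 = (c : ℝ) ^ 2 := by
        rw [Nat.cast_natAbs, Int.cast_abs, sq_abs]
      rw [hmdef]; push_cast
      rw [h3]
      gcongr
    have hcard : ((dyadicBox C j).filter
        fun p' : ℤ × ℕ => (p'.2 : ℤ) * n p'.1 = k * n c).card ≤
        (m.divisors ×ˢ ({1, -1} : Finset ℤ)).card := by
      have key : ∀ p' : ℤ × ℕ, p' ∈ (dyadicBox C j).filter
          (fun p' : ℤ × ℕ => (p'.2 : ℤ) * n p'.1 = k * n c) →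
          p'.1 ∈ C ∧ (p'.2 : ℤ) * p'.1 ^ 2 = k * c ^ 2 := by
        rintro ⟨c', k'⟩ hp'
        rw [Finset.mem_filter, Finset.mem_product] at hp'
        refine ⟨hp'.1.1, ?_⟩
        rw [← hn c hc, ← hn c' hp'.1.1]
        have := hp'.2
        simp only at this ⊢
        linear_combination (r : ℤ) * this
      refine Finset.card_le_card_of_injOn (fun p' => (p'.1.natAbs, p'.1.sign)) ?_ ?_
      · intro p' hp'
        obtain ⟨h1, h2⟩ := key p' hp'
        have h3 := (hC _ h1).1
        simp only [Finset.coe_product, Set.mem_prod, Finset.mem_coe, Nat.mem_divisors,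
          Finset.mem_insert, Finset.mem_singleton]
        refine ⟨⟨?_, hm0⟩, ?_⟩
        · have : p'.1 ∣ (m : ℤ) := by
            have e : (m : ℤ) = p'.2 * p'.1 ^ 2 := by
              rw [h2, hmdef]; push_cast; rw [sq_abs]
            rw [e, sq]
            exact (dvd_mul_right _ _).mul_left _
          exact Int.natAbs_dvd_natAbs.mpr this
        · rcases lt_or_gt_of_ne h3 with h | h
          · right; exact Int.sign_eq_neg_one_of_neg h
          · left; exact Int.sign_eq_one_of_pos h
      · intro p' hp' p'' hp'' he
        obtain ⟨h1, h2⟩ := key p' hp'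
        obtain ⟨h3, h4⟩ := key p'' hp''
        simp only [Prod.mk.injEq] at he
        have e1 : p'.1 = p''.1 := by
          rw [← Int.sign_mul_natAbs p'.1, ← Int.sign_mul_natAbs p''.1, he.1, he.2]
        have h5 : (p'.2 : ℤ) = p''.2 := by
          rw [← h4, e1] at h2
          exact mul_right_cancel₀ (pow_ne_zero 2 (hC _ h3).1) h2
        exact Prod.ext e1 (by exact_mod_cast h5)
    have hcard2 : (m.divisors ×ˢ ({1, -1} : Finset ℤ)).card = m.divisors.card * 2 := by
      rw [Finset.card_product]; rfl
    rw [hcard2] at hcard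
    have h6 : ((((dyadicBox C j).filter
        fun p' : ℤ × ℕ => (p'.2 : ℤ) * n p'.1 = k * n c).card : ℕ) : ℝ) ≤ m.divisors.card * 2 := by
      exact_mod_cast hcard
    have := hT m hm0 hmR
    simp only
    linarith
  have hLS := large_sieve_rootSet (dyadicBox C j)
    (fun p => (cosCoef (A p.1) w p.2 : ℂ) * expChar (p.2 * (κ / q))) (fun p => p.2 * n p.1)
    (N := 2 ^ (j + 1) * (R / r)) (by positivity) hm hmult hq hX B hB
  refine hLS.trans ?_
  rcases C.eq_empty_or_nonempty with rfl | ⟨c₀, hc₀⟩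
  · simp
  have hT0 : 0 ≤ T := by
    have h1 := hmult (c₀, 2 ^ j) (by
      rw [Finset.mem_product, Finset.mem_Ico]
      exact ⟨hc₀, le_rfl, Nat.pow_lt_pow_right (by norm_num) (by omega)⟩)
    have h2 := (Nat.cast_nonneg (α := ℝ) _).trans h1
    linarith
  -- M bounds the coefficients in the dyadic range. In the large sieve factor the spacing term 3qX
  -- is paired with 2^j M · M ≤ 6Θ, where X cancels against Θ = R/(rXq). The frequency term is
  -- paired with (2^j M)² ≤ 1. The outcome depends on neither X nor j.
  set M : ℝ := min (1 / 2 ^ j) (6 * Θ) with hM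
  have hM0 : 0 < M := by rw [hM]; positivity
  have hsum : ∑ p ∈ dyadicBox C j,
      ‖(cosCoef (A p.1) w p.2 : ℂ) * expChar (p.2 * (κ / q))‖ ^ 2 ≤ C.card * 2 ^ j * M ^ 2 := by
    calc _ ≤ ∑ p ∈ dyadicBox C j, M ^ 2 := by
          refine Finset.sum_le_sum ?_
          rintro ⟨c, k⟩ hp
          rw [Finset.mem_product, Finset.mem_Ico] at hp
          have hk : (2 : ℝ) ^ j ≤ k := by exact_mod_cast hp.2.1
          rw [norm_mul, norm_expChar, mul_one, Complex.norm_real, Real.norm_eq_abs]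
          have b1 := abs_cosCoef_le_inv (A c) hw k
          have b2 := abs_cosCoef_le (A c) hw k
          have b3 := hA c hp.1
          have b4 : (1 : ℝ) / k ≤ 1 / 2 ^ j := by gcongr
          gcongr
          exact le_min (b1.trans b4) (by linarith)
      _ = _ := by
          rw [Finset.sum_const, nsmul_eq_mul, Finset.card_product, Nat.card_Ico]
          have : 2 ^ (j + 1) - 2 ^ j = 2 ^ j := by rw [pow_succ]; omega
          rw [this]; push_cast; ring
  calc _ ≤ 100 * (3 * q * X + 2 ^ (j + 1) * (R / r)) * (2 * T) * (C.card * 2 ^ j * M ^ 2) := by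
        gcongr
    _ = 200 * T * C.card * ((3 * q * X) * ((2 ^ j * M) * M) + 2 * (R / r) * (2 ^ j * M) ^ 2) := by
        rw [pow_succ]; ring
    _ ≤ 200 * T * C.card * ((3 * q * X) * (1 * (6 * Θ)) + 2 * (R / r) * 1 ^ 2) := by
        have h1 : 2 ^ j * M ≤ 1 := by
          calc (2 : ℝ) ^ j * M ≤ 2 ^ j * (1 / 2 ^ j) := by gcongr; exact min_le_left _ _
            _ = 1 := by field_simp
        have h2 : M ≤ 6 * Θ := min_le_right _ _
        gcongr
    _ = _ := by
        rw [hΘ]; field_simp; ring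

/-! ### Equidistribution of the lattice counts on average over the modulus -/

theorem sum_sum_norm_le_sqrt {σ : ℕ → Finset ℕ} (D : Finset ℕ) (F : ℕ → ℕ → ℝ) {E : ℝ}
    (hE : ∑ d ∈ D, ∑ μ ∈ σ d, F d μ ^ 2 ≤ E) :
    ∑ d ∈ D, ∑ μ ∈ σ d, F d μ ≤ Real.sqrt ((∑ d ∈ D, ((σ d).card : ℝ)) * E) := by
  apply Real.le_sqrt_of_sq_le
  rw [Finset.sum_sigma'] at hE ⊢
  refine (sq_sum_le_card_mul_sum_sq).trans ?_
  rw [Finset.card_sigma]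
  push_cast
  gcongr

/-- The index of the multiplicative block containing `d`. -/
noncomputable def blockIndex (H : ℝ) (d : ℕ) : ℕ := ⌊H * Real.log d⌋₊

/-- The left end point of the block of index `b`. -/
noncomputable def blockStart (H : ℝ) (b : ℕ) : ℝ := Real.exp (b / H)

theorem one_le_blockStart {H : ℝ} (hH : 0 ≤ H) (b : ℕ) : 1 ≤ blockStart H b :=
  Real.one_le_exp (by positivity)

theorem blockStart_le {H : ℝ} (hH : 0 < H) {d : ℕ} (hd : 0 < d) :
    blockStart H (blockIndex H d) ≤ d := by
  have hd' : (1 : ℝ) ≤ d := by exact_mod_cast hd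
  rw [blockStart, ← Real.le_log_iff_exp_le (by linarith), div_le_iff₀ hH, mul_comm]
  exact Nat.floor_le (mul_nonneg hH.le (Real.log_nonneg hd'))

theorem mul_exp_neg_le_blockStart {H : ℝ} (hH : 0 < H) {d : ℕ} (hd : 0 < d) :
    d * Real.exp (-(1 / H)) ≤ blockStart H (blockIndex H d) := by
  have hd' : (0 : ℝ) < d := by exact_mod_cast hd
  conv_lhs => rw [← Real.exp_log hd']
  rw [← Real.exp_add, blockStart, Real.exp_le_exp]
  have h1 := Nat.lt_floor_add_one (H * Real.log d)
  rw [← sub_eq_add_neg, sub_le_iff_le_add, ← add_div, le_div_iff₀ hH, mul_comm]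
  exact h1.le

/-- For H ≥ 2 a block has ratio at most exp(1/2) < 5/3, the range in which the roots are known to be
spaced. -/
theorem le_blockStart {H : ℝ} (hH : 2 ≤ H) {d : ℕ} (hd : 0 < d) :
    d ≤ 5 / 3 * blockStart H (blockIndex H d) := by
  have h1 := mul_exp_neg_le_blockStart (by linarith : 0 < H) hd
  have hd' : (0 : ℝ) < d := by exact_mod_cast hd
  have h2 : (3 / 5 : ℝ) ≤ Real.exp (-(1 / H)) := by
    have h3 : Real.exp (-(1 / 2)) ≤ Real.exp (-(1 / H)) := by
      rw [Real.exp_le_exp, neg_le_neg_iff]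
      exact one_div_le_one_div_of_le (by norm_num) hH
    have h4 : Real.exp (-(1 / 2)) ^ 2 = (Real.exp 1)⁻¹ := by
      rw [← Real.exp_nat_mul, ← Real.exp_neg]; norm_num
    have h5 : (9 / 25 : ℝ) ≤ (Real.exp 1)⁻¹ := by
      rw [le_inv_comm₀ (by norm_num) (Real.exp_pos 1)]
      have := Real.exp_one_lt_d9
      norm_num at this ⊢; linarith
    have h6 := Real.exp_pos (-(1 / 2))
    nlinarith
  nlinarith

theorem div_blockStart_sub_le {H V : ℝ} (hH : 0 < H) (hV : 0 ≤ V) {d : ℕ} (hd : 0 < d) :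
    V / blockStart H (blockIndex H d) ≤ V / d + V / blockStart H (blockIndex H d) / H := by
  have h1 := mul_exp_neg_le_blockStart hH hd
  have hd' : (0 : ℝ) < d := by exact_mod_cast hd
  have hX := one_le_blockStart hH.le (blockIndex H d)
  set X := blockStart H (blockIndex H d)
  have h2 := Real.add_one_le_exp (-(1 / H))
  have h3 : d * (1 - 1 / H) ≤ X := by nlinarith
  have h4 : 1 - 1 / H ≤ X / d := by rw [le_div_iff₀ hd']; linarith
  have h5 : V / X * (1 - 1 / H) ≤ V / X * (X / d) := by gcongr
  have h6 : V / X * (X / d) = V / d := by field_simp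
  have h7 : V / X * (1 - 1 / H) = V / X - V / X / H := by ring
  linarith

section
variable {q r : ℕ} {R H T Y : ℝ} {C : Finset ℤ} {n : ℤ → ℤ} {J : ℕ} {D : Finset ℕ} {κ : ℕ → ℕ}

/-- The polynomial depends on d only through the block index and κ d. The large sieve is applied to
each of the at most (H log Y + 1)q resulting classes. -/
theorem sum_sq_dyadicPoly_le (hq : 0 < q) (hr : 0 < r) (hR : 0 < R)
    (hn : ∀ c ∈ C, r * n c = c ^ 2) (hC : ∀ c ∈ C, c ≠ 0 ∧ (c : ℝ) ^ 2 ≤ R) (hT0 : 0 ≤ T)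
    (hT : ∀ m : ℕ, m ≠ 0 → (m : ℝ) ≤ 2 ^ J * R → (m.divisors.card : ℝ) ≤ T) (hH : 2 ≤ H)
    (hD : ∀ d ∈ D, 0 < d ∧ (d : ℝ) ≤ Y) (hY : 1 ≤ Y) (hκ : ∀ d ∈ D, κ d < q)
    (A : ℕ → ℤ → ℝ) {w : ℕ → ℝ} (hw : ∀ b, 0 < w b)
    (hA : ∀ b, ∀ c ∈ C, |2 * A b c + w b| ≤ 3 * (R / (r * blockStart H b * q))) {j : ℕ}
    (hj : j < J) :
    ∑ d ∈ D, ∑ μ ∈ rootSet q d,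
      ‖dyadicPoly C (A (blockIndex H d)) (w (blockIndex H d)) n q (κ d) j ((μ : ℝ) / d)‖ ^ 2 ≤
      (H * Real.log Y + 1) * q * (4000 * T * C.card * (R / r)) := by
  have hH0 : 0 < H := by linarith
  have hmaps : ∀ d ∈ D, (blockIndex H d, κ d) ∈
      Finset.range (⌊H * Real.log Y⌋₊ + 1) ×ˢ Finset.range q := by
    intro d hd
    have hd1 : (0 : ℝ) < d := by exact_mod_cast (hD d hd).1
    rw [Finset.mem_product, Finset.mem_range, Finset.mem_range, Nat.lt_succ_iff]
    refine ⟨Nat.floor_le_floor ?_, hκ d hd⟩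
    have := Real.log_le_log hd1 (hD d hd).2
    gcongr
  rw [← Finset.sum_fiberwise_of_maps_to hmaps]
  have hfib : ∀ p ∈ Finset.range (⌊H * Real.log Y⌋₊ + 1) ×ˢ Finset.range q,
      ∑ d ∈ D with (blockIndex H d, κ d) = p, ∑ μ ∈ rootSet q d,
        ‖dyadicPoly C (A (blockIndex H d)) (w (blockIndex H d)) n q (κ d) j ((μ : ℝ) / d)‖ ^ 2 ≤
      4000 * T * C.card * (R / r) := by
    rintro ⟨b, k⟩ _
    have hcongr : ∑ d ∈ D with (blockIndex H d, κ d) = (b, k), ∑ μ ∈ rootSet q d,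
        ‖dyadicPoly C (A (blockIndex H d)) (w (blockIndex H d)) n q (κ d) j ((μ : ℝ) / d)‖ ^ 2 =
        ∑ d ∈ D with (blockIndex H d, κ d) = (b, k), ∑ μ ∈ rootSet q d,
          ‖dyadicPoly C (A b) (w b) n q k j ((μ : ℝ) / d)‖ ^ 2 := by
      refine Finset.sum_congr rfl fun d hd => ?_
      have := (Finset.mem_filter.mp hd).2
      simp only [Prod.mk.injEq] at this
      rw [this.1, this.2]
    rw [hcongr]
    refine large_sieve_dyadic hq hr hR C n hn hC hT (one_le_blockStart hH0.le b) _ ?_ (A b) (hw b)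
      (hA b) k hj
    intro d hd
    rw [Finset.mem_filter, Prod.mk.injEq] at hd
    rw [← hd.2.1]
    exact ⟨blockStart_le hH0 (hD d hd.1).1, le_blockStart hH (hD d hd.1).1⟩
  refine (Finset.sum_le_sum hfib).trans ?_
  rw [Finset.sum_const, nsmul_eq_mul, Finset.card_product, Finset.card_range, Finset.card_range]
  push_cast
  have h1 : (⌊H * Real.log Y⌋₊ : ℝ) ≤ H * Real.log Y :=
    Nat.floor_le (mul_nonneg hH0.le (Real.log_nonneg hY))
  have hrr : (0 : ℝ) < r := by exact_mod_cast hr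
  gcongr

/-- The truncated series is split into J dyadic ranges, and Cauchy–Schwarz over the pairs (d, μ) in
each range brings in the mean square. -/
theorem sum_abs_truncSeries_le (hq : 0 < q) (hr : 0 < r) (hR : 0 < R)
    (hn : ∀ c ∈ C, r * n c = c ^ 2) (hC : ∀ c ∈ C, c ≠ 0 ∧ (c : ℝ) ^ 2 ≤ R) (hT0 : 0 ≤ T)
    (hT : ∀ m : ℕ, m ≠ 0 → (m : ℝ) ≤ 2 ^ J * R → (m.divisors.card : ℝ) ≤ T) (hH : 2 ≤ H)
    (hD : ∀ d ∈ D, 0 < d ∧ (d : ℝ) ≤ Y) (hY : 1 ≤ Y) (hκ : ∀ d ∈ D, κ d < q)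
    (A : ℕ → ℤ → ℝ) {w : ℕ → ℝ} (hw : ∀ b, 0 < w b)
    (hA : ∀ b, ∀ c ∈ C, |2 * A b c + w b| ≤ 3 * (R / (r * blockStart H b * q))) :
    ∑ d ∈ D, |∑ p ∈ C ×ˢ rootSet q d, truncSeries (A (blockIndex H d) p.1) (w (blockIndex H d))
      (2 ^ J) ((p.2 : ℝ) / d * n p.1 + κ d / q)| ≤
      J * Real.sqrt ((∑ d ∈ D, ((rootSet q d).card : ℝ)) *
        ((H * Real.log Y + 1) * q * (4000 * T * C.card * (R / r)))) := by
  have h1 : ∀ d ∈ D, |∑ p ∈ C ×ˢ rootSet q d, truncSeries (A (blockIndex H d) p.1)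
      (w (blockIndex H d)) (2 ^ J) ((p.2 : ℝ) / d * n p.1 + κ d / q)| ≤
      ∑ j ∈ Finset.range J, ∑ μ ∈ rootSet q d,
        ‖dyadicPoly C (A (blockIndex H d)) (w (blockIndex H d)) n q (κ d) j ((μ : ℝ) / d)‖ := by
    intro d _
    have e : ∑ p ∈ C ×ˢ rootSet q d, truncSeries (A (blockIndex H d) p.1)
        (w (blockIndex H d)) (2 ^ J) ((p.2 : ℝ) / d * n p.1 + κ d / q) =
        ∑ j ∈ Finset.range J, ∑ μ ∈ rootSet q d,
          (dyadicPoly C (A (blockIndex H d)) (w (blockIndex H d)) n q (κ d) j ((μ : ℝ) / d)).re := by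
      rw [Finset.sum_product_right, Finset.sum_comm (s := Finset.range J)]
      refine Finset.sum_congr rfl fun μ _ => ?_
      simp_rw [truncSeries_two_pow, ← sum_dyadic_eq_re]
      rw [Finset.sum_comm]
    rw [e]
    refine (Finset.abs_sum_le_sum_abs _ _).trans (Finset.sum_le_sum fun j _ => ?_)
    refine (Finset.abs_sum_le_sum_abs _ _).trans (Finset.sum_le_sum fun μ _ => ?_)
    exact Complex.abs_re_le_norm _
  refine (Finset.sum_le_sum h1).trans ?_
  rw [Finset.sum_comm]
  have h2 : ∀ j ∈ Finset.range J, ∑ d ∈ D, ∑ μ ∈ rootSet q d,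
      ‖dyadicPoly C (A (blockIndex H d)) (w (blockIndex H d)) n q (κ d) j ((μ : ℝ) / d)‖ ≤
      Real.sqrt ((∑ d ∈ D, ((rootSet q d).card : ℝ)) *
        ((H * Real.log Y + 1) * q * (4000 * T * C.card * (R / r)))) := fun j hj =>
    sum_sum_norm_le_sqrt D _ (sum_sq_dyadicPoly_le hq hr hR hn hC hT0 hT hH hD hY hκ A hw hA
      (Finset.mem_range.mp hj))
  refine (Finset.sum_le_sum h2).trans ?_
  rw [Finset.sum_const, Finset.card_range, nsmul_eq_mul]

theorem sum_abs_latticeCount_sub_le (hq : 0 < q) (hr : 0 < r) (hR : 0 < R)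
    (hn : ∀ c ∈ C, r * n c = c ^ 2) (hC : ∀ c ∈ C, c ≠ 0 ∧ (c : ℝ) ^ 2 ≤ R) (hT0 : 0 ≤ T)
    (hT : ∀ m : ℕ, m ≠ 0 → (m : ℝ) ≤ 2 ^ J * R → (m.divisors.card : ℝ) ≤ T) (hH : 2 ≤ H)
    (hD : ∀ d ∈ D, 0 < d ∧ (d : ℝ) ≤ Y) (hY : 1 ≤ Y) (hκ : ∀ d ∈ D, κ d < q)
    (hJ : 2 * (r * Y * q * H / R) ^ 2 ≤ 2 ^ J) (U : ℤ → ℝ) (hU : ∀ c ∈ C, 0 ≤ U c ∧ U c ≤ R) :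
    ∑ d ∈ D, |∑ p ∈ C ×ˢ rootSet q d, (latticeCount (U p.1 / (r * d * q))
        ((p.2 : ℝ) / d * n p.1 + κ d / q) - 2 * (U p.1 / (r * d * q)))| ≤
      ∑ d ∈ D, 8 * (R / (r * d * H)) * (C.card * (rootSet q d).card) +
      2 * (J * Real.sqrt ((∑ d ∈ D, ((rootSet q d).card : ℝ)) *
        ((H * Real.log Y + 1) * q * (4000 * T * C.card * (R / r))))) := by
  have hqr : (0 : ℝ) < q := by exact_mod_cast hq
  have hq1 : (1 : ℝ) ≤ q := by exact_mod_cast hq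
  have hrr : (0 : ℝ) < r := by exact_mod_cast hr
  have hH0 : 0 < H := by linarith
  have hX : ∀ b, 0 < blockStart H b := fun b => by
    linarith [one_le_blockStart hH0.le b]
  -- The smoothing width is 1/H times the largest normalised width on the block. Replacing d by the
  -- block start changes widths by a relative amount at most 1/H, so this change is also at most w.
  set w : ℕ → ℝ := fun b => R / (r * blockStart H b * q) / H with hw
  have hw0 : ∀ b, 0 < w b := fun b => by
    have := hX b
    simp only [hw]; positivity
  have hwΘ : ∀ b, 2 * w b ≤ R / (r * blockStart H b * q) := fun b => by
    have := hX b
    simp only [hw]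
    rw [← mul_div_assoc, div_le_iff₀ hH0, mul_comm]
    gcongr
  set Θ : ℕ → ℤ → ℝ := fun b c => U c / (r * blockStart H b * q) with hΘ
  have hΘ0 : ∀ b, ∀ c ∈ C, 0 ≤ Θ b c := fun b c hc => by
    have := hX b
    have := (hU c hc).1
    simp only [hΘ]; positivity
  have hΘ1 : ∀ b, ∀ c ∈ C, Θ b c ≤ R / (r * blockStart H b * q) := fun b c hc => by
    have := hX b
    have := (hU c hc).2
    simp only [hΘ]; gcongr
  have hmain : ∀ d ∈ D, |∑ p ∈ C ×ˢ rootSet q d, (latticeCount (U p.1 / (r * d * q))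
        ((p.2 : ℝ) / d * n p.1 + κ d / q) - 2 * (U p.1 / (r * d * q)))| ≤
      8 * (R / (r * d * H)) * (C.card * (rootSet q d).card) +
      |∑ p ∈ C ×ˢ rootSet q d, truncSeries (Θ (blockIndex H d) p.1) (w (blockIndex H d)) (2 ^ J)
        ((p.2 : ℝ) / d * n p.1 + κ d / q)| +
      |∑ p ∈ C ×ˢ rootSet q d, truncSeries (Θ (blockIndex H d) p.1 - 2 * w (blockIndex H d))
        (w (blockIndex H d)) (2 ^ J) ((p.2 : ℝ) / d * n p.1 + κ d / q)| := by
    intro d hd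
    obtain ⟨hd0, hdY⟩ := hD d hd
    have hdr : (0 : ℝ) < d := by exact_mod_cast hd0
    set b := blockIndex H d with hb
    have hXd : blockStart H b ≤ d := blockStart_le hH0 hd0
    have hdX : d ≤ 5 / 3 * blockStart H b := le_blockStart hH hd0
    have hXb := hX b
    -- The truncation error is at most w once 2^J ≥ 2/w². The hypothesis on J supplies this because
    -- the block start is at most Y.
    have hK : 2 / (w b * (2 ^ J : ℕ)) ≤ w b := by
      push_cast
      rw [div_le_iff₀ (mul_pos (hw0 b) (by positivity))]
      have h1 : (r * blockStart H b * q * H / R) ^ 2 ≤ (r * Y * q * H / R) ^ 2 := by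
        have := hXd.trans hdY
        gcongr
      have h2 : w b * (r * blockStart H b * q * H / R) = 1 := by
        simp only [hw]; field_simp
      calc (2 : ℝ) = (w b * w b) * (2 * (r * blockStart H b * q * H / R) ^ 2) := by
            linear_combination (-2 : ℝ) * (w b * (r * blockStart H b * q * H / R) + 1) * h2
        _ ≤ (w b * w b) * 2 ^ J := by
            have := hw0 b
            gcongr
            linarith
        _ = _ := by ring
    have h := abs_sum_latticeCount_sub_le (C ×ˢ rootSet q d) (fun p => U p.1 / (r * d * q))
      (fun p => Θ b p.1) (fun p => (p.2 : ℝ) / d * n p.1 + κ d / q) (hw0 b) Nat.one_le_two_pow hK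
      (by
        rintro ⟨c, μ⟩ hp
        have hc := (Finset.mem_product.mp hp).1
        have := (hU c hc).1
        simp only [hΘ]; gcongr)
      (by
        rintro ⟨c, μ⟩ hp
        have hc := (Finset.mem_product.mp hp).1
        have hc' := hU c hc
        have h1 := div_blockStart_sub_le (V := U c / (r * q)) hH0
          (by have := hc'.1; positivity) hd0
        rw [← hb] at h1
        have e1 : U c / (r * q) / blockStart H b = Θ b c := by simp only [hΘ]; field_simp
        have e2 : U c / (r * q) / d = U c / (r * d * q) := by field_simp
        rw [e1, e2] at h1
        refine h1.trans ?_
        have h2 : Θ b c / H ≤ w b := by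
          simp only [hw]
          have := hΘ1 b c hc
          gcongr
        simp only
        linarith)
    refine h.trans ?_
    have h4 : 4 * w b ≤ 8 * (R / (r * d * H)) := by
      have e : w b = R / (r * q * H) / blockStart H b := by simp only [hw]; field_simp
      have h5 : 1 / blockStart H b ≤ 2 / d := by
        rw [div_le_div_iff₀ hXb hdr]; linarith
      have h6 : w b = R / (r * q * H) * (1 / blockStart H b) := by rw [e]; ring
      calc 4 * w b ≤ 4 * (R / (r * 1 * H) * (2 / d)) := by rw [h6]; gcongr
        _ = _ := by field_simp; ring
    rw [Finset.card_product]
    push_cast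
    gcongr
  refine (Finset.sum_le_sum hmain).trans ?_
  rw [Finset.sum_add_distrib, Finset.sum_add_distrib, add_assoc]
  refine add_le_add le_rfl ?_
  rw [two_mul]
  refine add_le_add ?_ ?_
  · refine sum_abs_truncSeries_le hq hr hR hn hC hT0 hT hH hD hY hκ Θ hw0 fun b c hc => ?_
    have h1 := hΘ0 b c hc
    have h2 := hΘ1 b c hc
    have h3 := hw0 b
    have h4 := hwΘ b
    rw [abs_le]; constructor <;> linarith
  · refine sum_abs_truncSeries_le hq hr hR hn hC hT0 hT hH hD hY hκ
      (fun b c => Θ b c - 2 * w b) hw0 fun b c hc => ?_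
    have h1 := hΘ0 b c hc
    have h2 := hΘ1 b c hc
    have h3 := hw0 b
    have h4 := hwΘ b
    rw [abs_le]; constructor <;> linarith

end

/-! ### The number of `a` with `d ∣ a² + c⁴` -/

/-- The number of `a ≡ a₀ [ZMOD q]` with `|a| ≤ U` and `d ∣ a² + c⁴`. -/
noncomputable def pairCount (q : ℕ) (a₀ : ℤ) (d : ℕ) (c : ℤ) (U : ℝ) : ℕ :=
  ((Finset.Icc (-⌊U⌋) ⌊U⌋).filter fun a : ℤ => a ≡ a₀ [ZMOD q] ∧ (d : ℤ) ∣ a ^ 2 + c ^ 4).card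

/-- The count of `a` with `|a| ≤ U` in the residue class modulo `r d q` determined by `μ`. -/
noncomputable def classCount (q : ℕ) (a₀ : ℤ) (r d : ℕ) (c : ℤ) (U : ℝ) (μ : ℕ) : ℝ :=
  latticeCount (U / (r * d * q))
    ((μ : ℝ) / d * (c ^ 2 / (r : ℤ) : ℤ) + (crtShift q a₀ (r * d) : ℕ) / q)

theorem classCount_eq {q r d : ℕ} (hq : 0 < q) (hr : 0 < r) (hd : 0 < d) (hrd : r.Coprime d)
    (hrq : r.Coprime q) (hdq : d.Coprime q) (a₀ : ℤ) {c : ℤ} (hc : (r : ℤ) ∣ c ^ 2) {U : ℝ}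
    (hU : 0 ≤ U) (μ : ℕ) :
    classCount q a₀ r d c U μ = (((Finset.Icc (-⌊U⌋) ⌊U⌋).filter fun a : ℤ =>
      (r : ℤ) ∣ a ∧ a ≡ q * μ * c ^ 2 [ZMOD d] ∧ a ≡ a₀ [ZMOD q]).card : ℝ) := by
  have hqr : (0 : ℝ) < q := by exact_mod_cast hq
  have hrr : (0 : ℝ) < r := by exact_mod_cast hr
  have hdr : (0 : ℝ) < d := by exact_mod_cast hd
  simp_rw [modEq_crt_iff hq hrd hrq hdq hc μ]
  have h := card_Icc_filter_modEq (M := r * d * q) (by positivity) hU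
    (q * μ * c ^ 2 + (r * d : ℕ) * crtShift q a₀ (r * d))
  rw [Int.cast_natCast] at h
  rw [h, classCount, latticeCount]
  have e1 : U / ((r * d * q : ℕ) : ℝ) = U / (r * d * q) := by push_cast; rfl
  have e2 : ((q * μ * c ^ 2 + (r * d : ℕ) * crtShift q a₀ (r * d) : ℤ) : ℝ) / ((r * d * q : ℕ) : ℝ) =
      (μ : ℝ) / d * (c ^ 2 / (r : ℤ) : ℤ) + (crtShift q a₀ (r * d) : ℕ) / q := by
    have e3 : ((c ^ 2 / (r : ℤ) : ℤ) : ℝ) = (c : ℝ) ^ 2 / r := by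
      rw [Int.cast_div hc (by exact_mod_cast hr.ne')]; push_cast; rfl
    rw [e3]; push_cast; field_simp
  rw [e1, e2]

theorem pairCount_eq {q d : ℕ} (hq : 0 < q) (hd : Cubefree d) (hd0 : d ≠ 0) (hdq : d.Coprime q)
    (a₀ c : ℤ) {U : ℝ} (hU : 0 ≤ U) :
    (pairCount q a₀ d c U : ℝ) = ∑ e ∈ unitaryDivisors d,
      if radical e ∣ c.natAbs ∧ c.natAbs.Coprime (d / e) then
        ∑ μ ∈ rootSet q (d / e), classCount q a₀ (radical e) (d / e) c U μ else 0 := by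
  rw [sum_unitaryDivisors_indicator hd hd0 c.natAbs
    fun e => ∑ μ ∈ rootSet q (d / e), classCount q a₀ (radical e) (d / e) c U μ]
  obtain ⟨h1, h2, h3⟩ := gcd_mem_unitaryDivisors hd hd0 c.natAbs
  set e := Nat.gcd (c.natAbs ^ 2) d
  rw [unitaryDivisors, Finset.mem_filter, Nat.mem_divisors] at h1
  obtain ⟨⟨hed, -⟩, hcop⟩ := h1
  have he0 : e ≠ 0 := ne_zero_of_dvd_ne_zero hd0 hed
  have hde : e * (d / e) = d := Nat.mul_div_cancel' hed
  set d' := d / e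
  have hd'0 : 0 < d' := Nat.pos_of_ne_zero fun h => hd0 (by rw [← hde, h, mul_zero])
  have hr0 : 0 < radical e := Nat.radical_pos e
  have hre : radical e ∣ e := UniqueFactorizationMonoid.radical_dvd_self
  have hrd : (radical e).Coprime d' := Nat.Coprime.coprime_dvd_left hre hcop
  have hrq : (radical e).Coprime q := Nat.Coprime.coprime_dvd_left (hre.trans hed) hdq
  have hdq' : d'.Coprime q := Nat.Coprime.coprime_dvd_left ⟨e, by rw [mul_comm]; exact hde.symm⟩ hdq
  have hc : ((radical e : ℕ) : ℤ) ∣ c ^ 2 :=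
    (Int.natCast_dvd.mpr h2).trans (dvd_pow_self c two_ne_zero)
  simp_rw [classCount_eq hq hr0 hd'0 hrd hrq hdq' a₀ hc hU]
  rw [pairCount]
  simp_rw [Finset.card_filter]
  push_cast
  rw [Finset.sum_comm]
  refine Finset.sum_congr rfl fun a _ => ?_
  have hcard := card_rootSet_filter (q := q) hd'0 hdq'.symm (a := a) h3
  have hiff := dvd_sq_add_pow_four_iff (a := a) (hd.of_dvd hed) he0 hcop h2
  rw [hde] at hiff
  simp only [hiff]
  by_cases hra : ((radical e : ℕ) : ℤ) ∣ a ∧ a ≡ a₀ [ZMOD q]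
  · simp only [hra.1, hra.2, true_and, and_true]
    rw [Finset.card_filter] at hcard
    exact_mod_cast hcard.symm
  · rw [if_neg (fun h => hra ⟨h.2.1, h.1⟩), Finset.sum_eq_zero]
    intro μ _
    rw [if_neg (fun h => hra ⟨h.1, h.2.2⟩)]

theorem sum_moebius_filter_dvd {n : ℕ} (hn : n ≠ 0) (c : ℕ) :
    ∑ f ∈ (radical n).divisors, (if f ∣ c then (moebius f : ℝ) else 0) =
      if c.Coprime n then 1 else 0 := by
  have hr0 : radical n ≠ 0 := (Nat.radical_pos n).ne'
  have h1 : (radical n).divisors.filter (fun f => f ∣ c) = (Nat.gcd c (radical n)).divisors := by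
    ext f
    simp only [Finset.mem_filter, Nat.mem_divisors, Nat.dvd_gcd_iff, ne_eq, Nat.gcd_eq_zero_iff]
    tauto
  rw [← Finset.sum_filter, h1]
  have h2 : ∑ f ∈ (Nat.gcd c (radical n)).divisors, moebius f =
      if Nat.gcd c (radical n) = 1 then 1 else 0 := by
    rw [← ArithmeticFunction.coe_mul_zeta_apply, ArithmeticFunction.moebius_mul_coe_zeta,
      ArithmeticFunction.one_apply]
  have h3 : Nat.gcd c (radical n) = 1 ↔ c.Coprime n := by
    constructor
    · intro h
      refine Nat.coprime_of_dvd fun p hp hpc hpn => ?_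
      have hpr : p ∣ radical n := (natRadical_dvd_iff hn).mp dvd_rfl p hp hpn
      exact hp.one_lt.ne' (Nat.dvd_one.mp (h ▸ Nat.dvd_gcd hpc hpr))
    · intro h
      exact Nat.Coprime.coprime_dvd_right UniqueFactorizationMonoid.radical_dvd_self h
  have h4 : (∑ f ∈ (Nat.gcd c (radical n)).divisors, (moebius f : ℝ)) =
      ((∑ f ∈ (Nat.gcd c (radical n)).divisors, moebius f : ℤ) : ℝ) := by push_cast; rfl
  rw [h4, h2]
  simp only [h3]
  split_ifs <;> simp

/-- Möbius inversion detects coprimality of c to d/e. Afterwards c runs freely over the multiples of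
rad(e)f, and the inner sums suit both the large sieve and the evaluation of the main term. -/
theorem sum_pairCount_eq {q d : ℕ} (hq : 0 < q) (hd : Cubefree d) (hd0 : d ≠ 0) (hdq : d.Coprime q)
    (a₀ : ℤ) (C : Finset ℤ) {U : ℤ → ℝ} (hU : ∀ c, 0 ≤ U c) :
    ∑ c ∈ C, (pairCount q a₀ d c (U c) : ℝ) = ∑ e ∈ unitaryDivisors d,
      ∑ f ∈ (radical (d / e)).divisors, (moebius f : ℝ) *
        ∑ c ∈ C.filter (fun c => radical e * f ∣ c.natAbs),
          ∑ μ ∈ rootSet q (d / e), classCount q a₀ (radical e) (d / e) c (U c) μ := by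
  simp_rw [pairCount_eq hq hd hd0 hdq a₀ _ (hU _)]
  rw [Finset.sum_comm]
  refine Finset.sum_congr rfl fun e he => ?_
  rw [unitaryDivisors, Finset.mem_filter, Nat.mem_divisors] at he
  obtain ⟨⟨hed, -⟩, hcop⟩ := he
  have hde : e * (d / e) = d := Nat.mul_div_cancel' hed
  set d' := d / e
  have hd'0 : d' ≠ 0 := fun h => hd0 (by rw [← hde, h, mul_zero])
  simp_rw [Finset.sum_filter, Finset.mul_sum]
  rw [Finset.sum_comm]
  refine Finset.sum_congr rfl fun c _ => ?_
  set F := ∑ μ ∈ rootSet q d', classCount q a₀ (radical e) d' c (U c) μ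
  have h1 : ∀ f ∈ (radical d').divisors, (moebius f : ℝ) *
      (if radical e * f ∣ c.natAbs then F else 0) =
      (if radical e ∣ c.natAbs then F else 0) * (if f ∣ c.natAbs then (moebius f : ℝ) else 0) := by
    intro f hf
    have hfd : f ∣ d' := (Nat.dvd_of_mem_divisors hf).trans
      UniqueFactorizationMonoid.radical_dvd_self
    have hcop' : (radical e).Coprime f := Nat.Coprime.coprime_dvd_left
      UniqueFactorizationMonoid.radical_dvd_self (Nat.Coprime.coprime_dvd_right hfd hcop)
    have hiff : radical e * f ∣ c.natAbs ↔ radical e ∣ c.natAbs ∧ f ∣ c.natAbs :=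
      ⟨fun h => ⟨(dvd_mul_right _ _).trans h, (dvd_mul_left _ _).trans h⟩,
        fun h => hcop'.mul_dvd_of_dvd_of_dvd h.1 h.2⟩
    simp only [hiff]
    by_cases ha : radical e ∣ c.natAbs <;> by_cases hb : f ∣ c.natAbs <;> simp [ha, hb, mul_comm]
  rw [Finset.sum_congr rfl h1, ← Finset.mul_sum, sum_moebius_filter_dvd hd'0]
  by_cases ha : radical e ∣ c.natAbs <;> by_cases hb : c.natAbs.Coprime d' <;> simp [ha, hb]

/-! ### The number of roots of `(q μ)² + 1` and the density -/

theorem card_rootSet_eq_natCard (q : ℕ) {n : ℕ} (hn : 0 < n) :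
    (rootSet q n).card = Nat.card {z : ZMod n // ((q : ZMod n) * z) ^ 2 + 1 = 0} := by
  have : NeZero n := ⟨hn.ne'⟩
  rw [Nat.card_eq_fintype_card, Fintype.card_subtype]
  have hmem : ∀ μ : ℕ, μ ∈ rootSet q n ↔ μ < n ∧ ((q : ZMod n) * (μ : ZMod n)) ^ 2 + 1 = 0 := by
    intro μ
    rw [rootSet, Finset.mem_filter, Finset.mem_range, ← ZMod.natCast_eq_zero_iff]
    push_cast; rfl
  refine Finset.card_bij (fun μ _ => (μ : ZMod n)) ?_ ?_ ?_
  · intro μ hμ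
    simpa using ((hmem μ).mp hμ).2
  · intro μ hμ μ' hμ' h
    have := congrArg ZMod.val h
    rwa [ZMod.val_natCast_of_lt ((hmem μ).mp hμ).1, ZMod.val_natCast_of_lt ((hmem μ').mp hμ').1]
      at this
  · intro z hz
    rw [Finset.mem_filter] at hz
    refine ⟨z.val, (hmem _).mpr ⟨ZMod.val_lt z, ?_⟩, ZMod.natCast_zmod_val z⟩
    rw [ZMod.natCast_zmod_val]; exact hz.2

theorem card_rootSet_mul (q : ℕ) {m n : ℕ} (hm : 0 < m) (hn : 0 < n) (h : m.Coprime n) :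
    (rootSet q (m * n)).card = (rootSet q m).card * (rootSet q n).card := by
  rw [card_rootSet_eq_natCard q hm, card_rootSet_eq_natCard q hn,
    card_rootSet_eq_natCard q (Nat.mul_pos hm hn), ← Nat.card_prod]
  refine Nat.card_congr (Equiv.trans (Equiv.subtypeEquiv (ZMod.chineseRemainder h).toEquiv
    (q := fun z => ((q : ZMod m) * z.1) ^ 2 + 1 = 0 ∧ ((q : ZMod n) * z.2) ^ 2 + 1 = 0)
    fun z => ?_) (Equiv.subtypeProdEquivProd
      (p := fun x : ZMod m => ((q : ZMod m) * x) ^ 2 + 1 = 0)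
      (q := fun x : ZMod n => ((q : ZMod n) * x) ^ 2 + 1 = 0)))
  rw [← (ZMod.chineseRemainder h).map_eq_zero_iff, map_add, map_pow, map_mul, map_one, map_natCast,
    Prod.ext_iff]
  rfl

theorem card_rootSet_eq_of_coprime {q n : ℕ} (hn : 0 < n) (h : q.Coprime n) :
    (rootSet q n).card = Nat.card {z : ZMod n // z ^ 2 + 1 = 0} := by
  rw [card_rootSet_eq_natCard q hn]
  obtain ⟨u, hu⟩ := (ZMod.isUnit_iff_coprime q n).mpr h
  refine Nat.card_congr (Equiv.subtypeEquiv u.mulLeft fun z => ?_)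
  rw [← hu]; rfl

/-- If p ∣ x² - (-1), then p^(k+1) divides (x²)^(p^k) - (-1)^(p^k). Since p^k is odd, x^(p^k) is a
root modulo p^(k+1). -/
theorem exists_sq_add_one_dvd_of_mod_four {p : ℕ} (hp : p.Prime) (h : p % 4 = 1) (k : ℕ) :
    ∃ x : ℤ, (p : ℤ) ^ (k + 1) ∣ x ^ 2 + 1 := by
  have : Fact p.Prime := ⟨hp⟩
  obtain ⟨y, hy⟩ := (ZMod.exists_sq_eq_neg_one_iff (p := p)).mpr (by omega)
  obtain ⟨x, rfl⟩ := ZMod.intCast_surjective y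
  have h1 : (p : ℤ) ∣ x ^ 2 - (-1) := by
    rw [← ZMod.intCast_zmod_eq_zero_iff_dvd]
    push_cast
    linear_combination -hy
  have h2 := dvd_sub_pow_of_dvd_sub h1 k
  have hodd : Odd (p ^ k) := Odd.pow (Nat.odd_iff.mpr (by omega))
  rw [hodd.neg_one_pow, sub_neg_eq_add, ← pow_mul, mul_comm, pow_mul] at h2
  exact ⟨_, h2⟩

/-- If x and y are roots, p^(k+1) divides (y - x)(y + x). As p does not divide 2x, it divides only
one factor, which takes the full power. -/
theorem natCard_sqrt_neg_one_of_mod_four_eq_one {p : ℕ} (hp : p.Prime) (h : p % 4 = 1) (k : ℕ) :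
    Nat.card {z : ZMod (p ^ (k + 1)) // z ^ 2 + 1 = 0} = 2 := by
  obtain ⟨x, hx⟩ := exists_sq_add_one_dvd_of_mod_four hp h k
  have hpz : Prime (p : ℤ) := Nat.prime_iff_prime_int.mp hp
  have hpx : ¬ (p : ℤ) ∣ 2 * x := by
    intro hcon
    rcases hpz.dvd_or_dvd hcon with h2 | h2
    · have := Nat.le_of_dvd (by norm_num) (by exact_mod_cast h2 : p ∣ 2)
      have := hp.two_le
      omega
    · have h3 : (p : ℤ) ∣ x ^ 2 + 1 := (dvd_pow_self _ (by omega)).trans hx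
      have h4 : (p : ℤ) ∣ 1 := (dvd_add_right (h2.trans (dvd_pow_self x two_ne_zero))).mp h3
      exact hpz.not_isUnit (isUnit_of_dvd_one h4)
  have hcast : ∀ z : ℤ, ((z : ZMod (p ^ (k + 1))) = 0) ↔ (p : ℤ) ^ (k + 1) ∣ z := by
    intro z; rw [ZMod.intCast_zmod_eq_zero_iff_dvd]; push_cast; rfl
  have hset : {z : ZMod (p ^ (k + 1)) | z ^ 2 + 1 = 0} =
      {(x : ZMod (p ^ (k + 1))), -(x : ZMod (p ^ (k + 1)))} := by
    ext z
    obtain ⟨y, rfl⟩ := ZMod.intCast_surjective z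
    simp only [Set.mem_ofPred_eq, Set.mem_insert_iff, Set.mem_singleton_iff]
    have e1 : (y : ZMod (p ^ (k + 1))) ^ 2 + 1 = ((y ^ 2 + 1 : ℤ) : ZMod (p ^ (k + 1))) := by
      push_cast; rfl
    have e2 : (y : ZMod (p ^ (k + 1))) = x ↔ (p : ℤ) ^ (k + 1) ∣ y - x := by
      rw [← hcast]; push_cast; rw [sub_eq_zero]
    have e3 : (y : ZMod (p ^ (k + 1))) = -x ↔ (p : ℤ) ^ (k + 1) ∣ y + x := by
      rw [← hcast]; push_cast; rw [add_eq_zero_iff_eq_neg]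
    rw [e1, hcast, e2, e3]
    constructor
    · intro hy
      have h1 : (p : ℤ) ^ (k + 1) ∣ (y - x) * (y + x) := by
        have := dvd_sub hy hx
        rwa [show y ^ 2 + 1 - (x ^ 2 + 1) = (y - x) * (y + x) by ring] at this
      by_cases hd : (p : ℤ) ∣ y - x
      · left
        have hnd : ¬ (p : ℤ) ∣ y + x := fun h2 => hpx (by
          have := dvd_sub h2 hd
          rwa [show y + x - (y - x) = 2 * x by ring] at this)
        exact ((hpz.coprime_iff_not_dvd.mpr hnd).pow_left).dvd_of_dvd_mul_right h1
      · right
        exact ((hpz.coprime_iff_not_dvd.mpr hd).pow_left).dvd_of_dvd_mul_left h1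
    · rintro (h1 | h1)
      · have := dvd_add (h1.mul_left (y + x)) hx
        rwa [show (y + x) * (y - x) + (x ^ 2 + 1) = y ^ 2 + 1 by ring] at this
      · have := dvd_add (h1.mul_left (y - x)) hx
        rwa [show (y - x) * (y + x) + (x ^ 2 + 1) = y ^ 2 + 1 by ring] at this
  have hne : (x : ZMod (p ^ (k + 1))) ≠ -(x : ZMod (p ^ (k + 1))) := by
    intro hcon
    apply hpx
    have : (p : ℤ) ^ (k + 1) ∣ 2 * x := by
      rw [← hcast]; push_cast; linear_combination hcon
    exact (dvd_pow_self _ (by omega)).trans this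
  change Nat.card ({z : ZMod (p ^ (k + 1)) | z ^ 2 + 1 = 0} : Set _) = 2
  rw [hset, Nat.card_coe_set_eq, Set.ncard_pair hne]

theorem natCard_sqrt_neg_one_of_mod_four_eq_three {p : ℕ} (hp : p.Prime) (h : p % 4 = 3) (k : ℕ) :
    Nat.card {z : ZMod (p ^ (k + 1)) // z ^ 2 + 1 = 0} = 0 := by
  have : Fact p.Prime := ⟨hp⟩
  rw [Nat.card_eq_zero]
  left
  refine ⟨fun ⟨z, hz⟩ => ?_⟩
  have h1 := congrArg (ZMod.castHom (dvd_pow_self p (Nat.succ_ne_zero k)) (ZMod p)) hz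
  rw [map_add, map_pow, map_one, map_zero] at h1
  refine (ZMod.exists_sq_eq_neg_one_iff (p := p)).mp
    ⟨ZMod.castHom (dvd_pow_self p (Nat.succ_ne_zero k)) (ZMod p) z, ?_⟩ h
  exact (neg_eq_of_add_eq_zero_left h1).trans (sq _)

theorem card_rootSet_prime_pow {p q : ℕ} (hp : p.Prime) (hp2 : p ≠ 2) (hq : q.Coprime p) (k : ℕ) :
    ((rootSet q (p ^ (k + 1))).card : ℝ) = 1 + (ZMod.χ₄ (p : ZMod 4) : ℝ) := by
  rw [card_rootSet_eq_of_coprime (pow_pos hp.pos _) (hq.pow_right _)]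
  have hodd : p % 2 = 1 := (hp.eq_two_or_odd).resolve_left hp2
  have : p % 4 = 1 ∨ p % 4 = 3 := by omega
  rcases this with h | h
  · rw [natCard_sqrt_neg_one_of_mod_four_eq_one hp h, ZMod.χ₄_nat_one_mod_four h]; norm_num
  · rw [natCard_sqrt_neg_one_of_mod_four_eq_three hp h, ZMod.χ₄_nat_three_mod_four h]; norm_num

theorem card_rootSet_two {q : ℕ} (hq : q.Coprime 2) : (rootSet q 2).card = 1 := by
  rw [card_rootSet_eq_of_coprime (by norm_num) hq, Nat.card_eq_fintype_card]
  decide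

theorem card_rootSet_four {q : ℕ} (hq : q.Coprime 2) : (rootSet q 4).card = 0 := by
  rw [card_rootSet_eq_of_coprime (by norm_num) (by simpa using hq.pow_right 2),
    Nat.card_eq_fintype_card]
  decide

/-- The first summand is the density of pairs with p dividing both a and c. The second is that of c
prime to p with a in one of the root classes modulo p^k. -/
theorem localDensity_eq {p q k : ℕ} (hp : p.Prime) (hq : q.Coprime p) (hk : k = 1 ∨ k = 2) :
    localDensity p k = 1 / (p : ℝ) ^ 2 +
      (1 - 1 / (p : ℝ)) * ((rootSet q (p ^ k)).card : ℝ) / (p : ℝ) ^ k := by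
  have hp0 : (p : ℝ) ≠ 0 := by exact_mod_cast hp.ne_zero
  by_cases hp2 : p = 2
  · subst hp2
    rcases hk with rfl | rfl
    · rw [pow_one, card_rootSet_two hq]; norm_num [localDensity]
    · rw [show 2 ^ 2 = 4 by norm_num, card_rootSet_four hq]; norm_num [localDensity]
  · rcases hk with rfl | rfl
    · rw [card_rootSet_prime_pow hp hp2 hq 0, localDensity, if_neg hp2]
      field_simp
      ring
    · rw [card_rootSet_prime_pow hp hp2 hq 1, localDensity, if_neg hp2]
      field_simp

theorem card_rootSet_prime_pow_le {p q k : ℕ} (hp : p.Prime) (hq : q.Coprime p)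
    (hk : k = 1 ∨ k = 2) : (rootSet q (p ^ k)).card ≤ k + 1 := by
  by_cases hp2 : p = 2
  · subst hp2
    rcases hk with rfl | rfl
    · rw [pow_one, card_rootSet_two hq]; norm_num
    · rw [show 2 ^ 2 = 4 by norm_num, card_rootSet_four hq]; norm_num
  · obtain ⟨m, rfl⟩ : ∃ m, k = m + 1 := ⟨k - 1, by omega⟩
    rw [card_rootSet_eq_of_coprime (pow_pos hp.pos _) (hq.pow_right _)]
    have hodd : p % 2 = 1 := (hp.eq_two_or_odd).resolve_left hp2
    have : p % 4 = 1 ∨ p % 4 = 3 := by omega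
    rcases this with h | h
    · rw [natCard_sqrt_neg_one_of_mod_four_eq_one hp h]; omega
    · rw [natCard_sqrt_neg_one_of_mod_four_eq_three hp h]; omega

theorem card_rootSet_one (q : ℕ) : (rootSet q 1).card = 1 := by
  simp [rootSet]

theorem card_rootSet_eq_prod (q : ℕ) {n : ℕ} (hn : n ≠ 0) :
    (rootSet q n).card = ∏ p ∈ n.primeFactors, (rootSet q (p ^ n.factorization p)).card := by
  have h := Nat.multiplicative_factorization (β := ℕ) (fun n => if n = 0 then 0 else
    (rootSet q n).card) (fun x y hxy => by
      rcases Nat.eq_zero_or_pos x with rfl | hx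
      · simp
      rcases Nat.eq_zero_or_pos y with rfl | hy
      · simp
      rw [if_neg hx.ne', if_neg hy.ne', if_neg (Nat.mul_pos hx hy).ne', card_rootSet_mul q hx hy hxy])
    (by simp [card_rootSet_one]) hn
  simp only [if_neg hn] at h
  rw [h, Finsupp.prod, Nat.support_factorization]
  refine Finset.prod_congr rfl fun p hp => if_neg ?_
  exact pow_ne_zero _ (Nat.prime_of_mem_primeFactors hp).ne_zero

theorem Cubefree.factorization_eq {d p : ℕ} (hd : Cubefree d) (hp : p ∈ d.primeFactors) :
    d.factorization p = 1 ∨ d.factorization p = 2 := by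
  have hpp := Nat.prime_of_mem_primeFactors hp
  have h1 : 0 < d.factorization p := hpp.factorization_pos_of_dvd
    (Nat.mem_primeFactors.mp hp).2.2 (Nat.dvd_of_mem_primeFactors hp)
  have h2 : d.factorization p < 3 := by
    by_contra hcon
    exact hd p hpp ((pow_dvd_pow p (by omega)).trans (Nat.ordProj_dvd d p))
  omega

theorem card_rootSet_le_card_divisors {q d : ℕ} (hd : Cubefree d) (hd0 : d ≠ 0)
    (hq : q.Coprime d) : (rootSet q d).card ≤ d.divisors.card := by
  rw [card_rootSet_eq_prod q hd0, Nat.card_divisors hd0]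
  refine Finset.prod_le_prod' fun p hp => ?_
  exact card_rootSet_prime_pow_le (Nat.prime_of_mem_primeFactors hp)
    (Nat.Coprime.coprime_dvd_right (Nat.dvd_of_mem_primeFactors hp) hq) (hd.factorization_eq hp)

/-- The arithmetic function `n ↦ 1 / n`. -/
noncomputable def invArith : ArithmeticFunction ℝ := ⟨fun n => (n : ℝ)⁻¹, by simp⟩

theorem invArith_isMultiplicative : invArith.IsMultiplicative := by
  refine ⟨by simp [invArith], fun {m n} _ => ?_⟩
  simp [invArith, mul_comm]

theorem sum_moebius_div (n : ℕ) :
    ∑ f ∈ (radical n).divisors, (moebius f : ℝ) / f = ∏ p ∈ n.primeFactors, (1 - 1 / (p : ℝ)) := by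
  have h := ArithmeticFunction.IsMultiplicative.prodPrimeFactors_one_sub_of_squarefree invArith
    invArith_isMultiplicative (n := radical n) UniqueFactorizationMonoid.squarefree_radical
  rw [Nat.primeFactors_radical] at h
  simp only [invArith, ArithmeticFunction.coe_mk] at h
  simp only [div_eq_mul_inv, one_mul]
  exact h.symm

/-- Unitary divisors of d correspond to sets of primes dividing d, so the sum is the expanded
product. -/
theorem sum_unitaryDivisors_eq_prod {d : ℕ} (hd0 : d ≠ 0) (u v : ℕ → ℕ → ℝ) :
    ∑ e ∈ unitaryDivisors d, (∏ p ∈ e.primeFactors, u p (e.factorization p)) *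
      (∏ p ∈ (d / e).primeFactors, v p ((d / e).factorization p)) =
    ∏ p ∈ d.primeFactors, (u p (d.factorization p) + v p (d.factorization p)) := by
  rw [Finset.prod_add]
  have hfac : ∀ e ∈ unitaryDivisors d, e ≠ 0 ∧ d / e ≠ 0 ∧ e.Coprime (d / e) ∧ e * (d / e) = d := by
    intro e he
    rw [unitaryDivisors, Finset.mem_filter, Nat.mem_divisors] at he
    have hde := Nat.mul_div_cancel' he.1.1
    refine ⟨ne_zero_of_dvd_ne_zero hd0 he.1.1, fun h => hd0 ?_, he.2, hde⟩
    rw [← hde, h, mul_zero]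
  have hf : ∀ e ∈ unitaryDivisors d, (∀ p ∈ e.primeFactors, e.factorization p = d.factorization p) ∧
      (∀ p ∈ (d / e).primeFactors, (d / e).factorization p = d.factorization p) ∧
      (d / e).primeFactors = d.primeFactors \ e.primeFactors ∧ e.primeFactors ⊆ d.primeFactors := by
    intro e he
    obtain ⟨h1, h2, h3, h4⟩ := hfac e he
    have h5 : d.factorization = e.factorization + (d / e).factorization := by
      conv_lhs => rw [← h4]
      exact Nat.factorization_mul h1 h2
    have h6 : d.primeFactors = e.primeFactors ∪ (d / e).primeFactors := by
      conv_lhs => rw [← h4]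
      exact Nat.primeFactors_mul h1 h2
    have h7 := h3.disjoint_primeFactors
    refine ⟨fun p hp => ?_, fun p hp => ?_, ?_, ?_⟩
    · rw [h5, Finsupp.add_apply, (Finsupp.notMem_support_iff (f := (d / e).factorization)).mp
        (by rw [Nat.support_factorization]; exact Finset.disjoint_left.mp h7 hp), add_zero]
    · rw [h5, Finsupp.add_apply, (Finsupp.notMem_support_iff (f := e.factorization)).mp
        (by rw [Nat.support_factorization]; exact Finset.disjoint_right.mp h7 hp), zero_add]
    · rw [h6, Finset.union_sdiff_cancel_left h7]
    · rw [h6]; exact Finset.subset_union_left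
  refine Finset.sum_bij (fun e _ => e.primeFactors) ?_ ?_ ?_ ?_
  · intro e he
    rw [Finset.mem_powerset]; exact (hf e he).2.2.2
  · intro e he e' he' heq
    rw [← Nat.prod_factorization_pow_eq_self (hfac e he).1,
      ← Nat.prod_factorization_pow_eq_self (hfac e' he').1, Finsupp.prod, Finsupp.prod,
      Nat.support_factorization, Nat.support_factorization]
    rw [← heq]
    refine Finset.prod_congr rfl fun p hp => ?_
    rw [(hf e he).1 p hp, (hf e' he').1 p (heq ▸ hp)]
  · intro S hS
    rw [Finset.mem_powerset] at hS
    have hpr : ∀ p ∈ d.primeFactors, p.Prime := fun p hp => Nat.prime_of_mem_primeFactors hp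
    set e := ∏ p ∈ S, p ^ d.factorization p with he
    set e' := ∏ p ∈ d.primeFactors \ S, p ^ d.factorization p with he'
    have hee : e * e' = d := by
      rw [mul_comm, he, he', Finset.prod_sdiff hS]
      exact Nat.prod_factorization_pow_eq_self hd0
    have he0 : e ≠ 0 := fun h => hd0 (by rw [← hee, h, zero_mul])
    have hcop : e.Coprime e' := by
      refine Nat.Coprime.prod_left fun p hp => Nat.Coprime.prod_right fun p' hp' => ?_
      rw [Finset.mem_sdiff] at hp'
      refine Nat.Coprime.pow _ _ ((Nat.coprime_primes (hpr p (hS hp)) (hpr p' hp'.1)).mpr ?_)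
      rintro rfl
      exact hp'.2 hp
    have hdiv : d / e = e' := by
      rw [← hee, Nat.mul_div_cancel_left _ (Nat.pos_of_ne_zero he0)]
    refine ⟨e, ?_, ?_⟩
    · rw [unitaryDivisors, Finset.mem_filter, Nat.mem_divisors, hdiv]
      exact ⟨⟨⟨e', hee.symm⟩, hd0⟩, hcop⟩
    · ext p
      rw [Nat.mem_primeFactors_of_ne_zero he0]
      constructor
      · rintro ⟨hp, hpe⟩
        obtain ⟨p', hp', h⟩ := (hp.prime.dvd_finsetProd_iff _).mp hpe
        have := (Nat.prime_dvd_prime_iff_eq hp (hpr p' (hS hp'))).mp (hp.dvd_of_dvd_pow h)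
        rwa [this]
      · intro hp
        refine ⟨hpr p (hS hp), ?_⟩
        have h1 : p ^ d.factorization p ∣ e :=
          Finset.dvd_prod_of_mem (fun p => p ^ d.factorization p) hp
        refine (dvd_pow_self p ?_).trans h1
        exact Finsupp.mem_support_iff.mp (by rw [Nat.support_factorization]; exact hS hp)
  · intro e he
    obtain ⟨h1, h2, h3, -⟩ := hf e he
    rw [Finset.prod_congr rfl fun p hp => by rw [h1 p hp],
      Finset.prod_congr (s₁ := (d / e).primeFactors) rfl fun p hp => by rw [h2 p hp], h3]

/-- The main terms have the weight 1/rad(e)² because rad(e) must divide both a and c. The sum over f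
turns the Möbius weights into factors 1 - 1/p, and the identity then factors into `localDensity_eq`.
-/
theorem density_eq_sum {q d : ℕ} (hd : Cubefree d) (hd0 : d ≠ 0) (hq : q.Coprime d) :
    ∑ e ∈ unitaryDivisors d, ∑ f ∈ (radical (d / e)).divisors, (moebius f : ℝ) / f *
      (((rootSet q (d / e)).card : ℝ) / ((radical e : ℕ) ^ 2 * (d / e : ℕ))) = density d := by
  have hR : density d = ∏ p ∈ d.primeFactors, (1 / (p : ℝ) ^ 2 +
      (1 - 1 / (p : ℝ)) * ((rootSet q (p ^ d.factorization p)).card : ℝ) /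
        (p : ℝ) ^ d.factorization p) := by
    rw [density, if_neg hd0, Finsupp.prod, Nat.support_factorization]
    refine Finset.prod_congr rfl fun p hp => ?_
    exact localDensity_eq (Nat.prime_of_mem_primeFactors hp)
      (Nat.Coprime.coprime_dvd_right (Nat.dvd_of_mem_primeFactors hp) hq) (hd.factorization_eq hp)
  rw [hR, ← sum_unitaryDivisors_eq_prod hd0 (fun p _ => 1 / (p : ℝ) ^ 2)
    (fun p k => (1 - 1 / (p : ℝ)) * ((rootSet q (p ^ k)).card : ℝ) / (p : ℝ) ^ k)]
  refine Finset.sum_congr rfl fun e he => ?_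
  rw [unitaryDivisors, Finset.mem_filter, Nat.mem_divisors] at he
  have hde := Nat.mul_div_cancel' he.1.1
  have h0 : d / e ≠ 0 := fun h => hd0 (by rw [← hde, h, mul_zero])
  rw [← Finset.sum_mul, sum_moebius_div, card_rootSet_eq_prod q h0,
    Nat.radical_eq_prod_primeFactors]
  have hn : ((d / e : ℕ) : ℝ) = ∏ p ∈ (d / e).primeFactors, (p : ℝ) ^ (d / e).factorization p := by
    conv_lhs => rw [← Nat.prod_factorization_pow_eq_self h0]
    rw [Finsupp.prod, Nat.support_factorization]
    push_cast; rfl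
  rw [hn]
  push_cast
  simp only [Finset.prod_div_distrib, Finset.prod_mul_distrib, Finset.prod_const_one,
    Finset.prod_pow]
  field_simp

/-! ### Sums over `c` in residue classes -/

theorem abs_sum_mul_le_of_antitone {a h : ℕ → ℝ} {B : ℝ} (n : ℕ) (hh : Antitone h)
    (h0 : ∀ i, 0 ≤ h i) (hB : ∀ m, |∑ i ∈ Finset.range m, a i| ≤ B) :
    |∑ i ∈ Finset.range n, h i * a i| ≤ B * h 0 := by
  have hB0 : 0 ≤ B := (abs_nonneg _).trans (hB 0)
  have e := Finset.sum_range_by_parts h a n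
  simp only [smul_eq_mul] at e
  rw [e]
  have h1 : |h (n - 1) * ∑ i ∈ Finset.range n, a i| ≤ h (n - 1) * B := by
    rw [abs_mul, abs_of_nonneg (h0 _)]
    exact mul_le_mul_of_nonneg_left (hB n) (h0 _)
  have h2 : |∑ i ∈ Finset.range (n - 1), (h (i + 1) - h i) * ∑ j ∈ Finset.range (i + 1), a j| ≤
      ∑ i ∈ Finset.range (n - 1), (h i - h (i + 1)) * B := by
    refine (Finset.abs_sum_le_sum_abs _ _).trans (Finset.sum_le_sum fun i _ => ?_)
    have := hh (Nat.le_succ i)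
    rw [abs_mul, abs_sub_comm, abs_of_nonneg (by simpa using this)]
    exact mul_le_mul_of_nonneg_left (hB _) (by simpa using this)
  rw [← Finset.sum_mul, Finset.sum_range_sub'] at h2
  refine (abs_sub _ _).trans ?_
  linarith

theorem abs_sum_range_modEq_le {Q : ℕ} (hQ : 0 < Q) (σ : ℤ) (n : ℕ) :
    |∑ i ∈ Finset.range n, ((if ((i : ℤ) + 1) ≡ σ [ZMOD Q] then (Q : ℝ) else 0) - 1)| ≤ Q := by
  have hQz : (0 : ℤ) < Q := by exact_mod_cast hQ
  -- The index i stands for the integer i + 1, so the class σ becomes σ - 1.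
  set v : ℕ := ((σ - 1) % Q).toNat with hv
  have hvz : (v : ℤ) = (σ - 1) % Q := Int.toNat_of_nonneg (Int.emod_nonneg _ hQz.ne')
  have hiff : ∀ i : ℕ, ((i : ℤ) + 1) ≡ σ [ZMOD Q] ↔ i ≡ v [MOD Q] := by
    intro i
    rw [← Int.natCast_modEq_iff, hvz]
    have h1 : (σ - 1) % Q ≡ σ - 1 [ZMOD Q] := Int.mod_modEq _ _
    constructor
    · intro h
      have := h.sub_right 1
      rw [add_sub_cancel_right] at this
      exact this.trans h1.symm
    · intro h
      have := (h.trans h1).add_right 1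
      rwa [sub_add_cancel] at this
  simp_rw [hiff]
  rw [Finset.sum_sub_distrib, ← Finset.sum_filter, Finset.sum_const, Finset.sum_const,
    Finset.card_range, ← Nat.count_eq_card_filter_range, Nat.count_modEq_card n hQ v]
  have h2 : ((n % Q : ℕ) : ℝ) + Q * (n / Q : ℕ) = n := by exact_mod_cast Nat.mod_add_div n Q
  have h3 : ((n % Q : ℕ) : ℝ) < Q := by exact_mod_cast Nat.mod_lt n hQ
  have h4 : (0 : ℝ) ≤ ((n % Q : ℕ) : ℝ) := by positivity
  simp only [nsmul_eq_mul, mul_one]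
  rw [abs_le]
  push_cast
  split_ifs <;> constructor <;> nlinarith

theorem sum_Icc_neg_ne_zero (N : ℕ) (f : ℤ → ℝ) :
    ∑ c ∈ (Finset.Icc (-(N : ℤ)) N).filter (fun c => c ≠ 0), f c =
      ∑ i ∈ Finset.range N, f ((i : ℤ) + 1) + ∑ i ∈ Finset.range N, f (-((i : ℤ) + 1)) := by
  have h1 : (Finset.Icc (-(N : ℤ)) N).filter (fun c => c ≠ 0) =
      (Finset.range N).image (fun i : ℕ => (i : ℤ) + 1) ∪
        (Finset.range N).image (fun i : ℕ => -((i : ℤ) + 1)) := by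
    ext c
    simp only [Finset.mem_filter, Finset.mem_Icc, Finset.mem_union, Finset.mem_image,
      Finset.mem_range]
    constructor
    · rintro ⟨⟨h1, h2⟩, h3⟩
      rcases lt_or_gt_of_ne h3 with h | h
      · exact Or.inr ⟨(-c - 1).toNat, by omega, by omega⟩
      · exact Or.inl ⟨(c - 1).toNat, by omega, by omega⟩
    · rintro (⟨i, hi, rfl⟩ | ⟨i, hi, rfl⟩) <;> omega
  rw [h1, Finset.sum_union, Finset.sum_image, Finset.sum_image]
  · intro i _ j _ h; simp only at h; omega
  · intro i _ j _ h; simp only at h; omega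
  · rw [Finset.disjoint_left]
    intro c hc hc'
    simp only [Finset.mem_image, Finset.mem_range] at hc hc'
    omega

/-- Partial summation against a decreasing weight, once for each sign of c. By evenness the negative
c become positive ones in the class -σ. The error does not depend on the modulus. -/
theorem abs_sum_modEq_sub_le {Q : ℕ} (hQ : 0 < Q) (σ : ℤ) (N : ℕ) {f : ℤ → ℝ} {B : ℝ}
    (heven : ∀ c, f (-c) = f c) (hf : Antitone fun i : ℕ => f ((i : ℤ) + 1)) (h0 : ∀ c, 0 ≤ f c)
    (hB : f 1 ≤ B) :
    |∑ c ∈ (Finset.Icc (-(N : ℤ)) N).filter (fun c => c ≠ 0 ∧ c ≡ σ [ZMOD Q]), f c -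
      (2 * ∑ i ∈ Finset.range N, f ((i : ℤ) + 1)) / Q| ≤ 2 * B := by
  have hQr : (0 : ℝ) < Q := by exact_mod_cast hQ
  rw [← Finset.filter_filter, Finset.sum_filter, sum_Icc_neg_ne_zero]
  have key : ∀ σ : ℤ, |∑ i ∈ Finset.range N, (if ((i : ℤ) + 1) ≡ σ [ZMOD Q] then f ((i : ℤ) + 1) else 0)
      - (∑ i ∈ Finset.range N, f ((i : ℤ) + 1)) / Q| ≤ B := by
    intro σ
    have h1 := abs_sum_mul_le_of_antitone N hf (fun i => h0 _) (abs_sum_range_modEq_le hQ σ)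
    have e : ∑ i ∈ Finset.range N, f ((i : ℤ) + 1) *
        ((if ((i : ℤ) + 1) ≡ σ [ZMOD Q] then (Q : ℝ) else 0) - 1) =
        Q * (∑ i ∈ Finset.range N, (if ((i : ℤ) + 1) ≡ σ [ZMOD Q] then f ((i : ℤ) + 1) else 0)
          - (∑ i ∈ Finset.range N, f ((i : ℤ) + 1)) / Q) := by
      rw [mul_sub, mul_div_cancel₀ _ hQr.ne', Finset.mul_sum, ← Finset.sum_sub_distrib]
      refine Finset.sum_congr rfl fun i _ => ?_
      split_ifs <;> ring
    rw [e, abs_mul, abs_of_pos hQr] at h1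
    have h2 := le_of_mul_le_mul_left h1 hQr
    simp only [Nat.cast_zero, zero_add] at h2
    exact h2.trans hB
  have hneg : ∀ i : ℕ, (-((i : ℤ) + 1) ≡ σ [ZMOD Q]) ↔ ((i : ℤ) + 1 ≡ -σ [ZMOD Q]) := by
    intro i
    constructor
    · intro h; simpa using h.neg
    · intro h; simpa using h.neg
  simp only [hneg, heven]
  have k1 := abs_le.mp (key σ)
  have k2 := abs_le.mp (key (-σ))
  rw [mul_div_assoc, abs_le]
  constructor <;> linarith

/-- The nonzero `c ≡ c₀ [ZMOD q₂]` with `|c| ≤ N`. -/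
noncomputable def rangeC (q₂ : ℕ) (c₀ : ℤ) (N : ℕ) : Finset ℤ :=
  (Finset.Icc (-(N : ℤ)) N).filter fun c => c ≠ 0 ∧ c ≡ c₀ [ZMOD q₂]

theorem filter_dvd_rangeC {q₂ m : ℕ} (hq : 0 < q₂) (hm : m.Coprime q₂) (c₀ : ℤ) (N : ℕ) :
    (rangeC q₂ c₀ N).filter (fun c => m ∣ c.natAbs) =
      (Finset.Icc (-(N : ℤ)) N).filter
        fun c => c ≠ 0 ∧ c ≡ m * crtShift q₂ c₀ m [ZMOD (m * q₂ : ℕ)] := by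
  rw [rangeC, Finset.filter_filter]
  refine Finset.filter_congr fun c _ => ?_
  push_cast
  rw [← Int.modEq_and_modEq_iff_modEq_mul (by simpa using hm), and_assoc]
  refine and_congr_right fun _ => ?_
  have h1 := mul_crtShift hq c₀ hm
  have h2 : (m * crtShift q₂ c₀ m : ℤ) ≡ 0 [ZMOD m] :=
    Int.modEq_zero_iff_dvd.mpr (dvd_mul_right _ _)
  rw [← Int.natCast_dvd]
  constructor
  · rintro ⟨h3, h4⟩
    exact ⟨(Int.modEq_zero_iff_dvd.mpr h4).trans h2.symm, h3.trans h1.symm⟩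
  · rintro ⟨h3, h4⟩
    exact ⟨h4.trans h1, Int.modEq_zero_iff_dvd.mp (h3.trans h2)⟩

/-- Without c = 0 the bound has no additive constant. It thus stays proportional to 1/m even for m >
N, which the sums over e and f rely on. -/
theorem card_filter_dvd_rangeC_le (q₂ : ℕ) (c₀ : ℤ) (N : ℕ) {m : ℕ} (hm : 0 < m) :
    (((rangeC q₂ c₀ N).filter fun c => m ∣ c.natAbs).card : ℝ) ≤ 2 * N / m := by
  have hmz : (0 : ℤ) < m := by exact_mod_cast hm
  have h1 : ((rangeC q₂ c₀ N).filter fun c => m ∣ c.natAbs).card ≤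
      ((Finset.Icc (-((N / m : ℕ) : ℤ)) (N / m : ℕ)).erase 0).card := by
    refine Finset.card_le_card_of_injOn (fun c => c / m) ?_ ?_
    · intro c hc
      simp only [rangeC, Finset.coe_filter, Finset.mem_filter, Finset.mem_Icc,
        Set.mem_ofPred_eq] at hc
      obtain ⟨⟨⟨h1, h2⟩, h3, -⟩, h4⟩ := hc
      obtain ⟨k, rfl⟩ := Int.natCast_dvd.mpr h4
      simp only [Finset.coe_erase, Set.mem_sdiff, Finset.mem_coe, Finset.mem_Icc,
        Set.mem_singleton_iff]
      rw [Int.mul_ediv_cancel_left _ hmz.ne']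
      push_cast
      refine ⟨⟨?_, ?_⟩, ?_⟩
      · rw [neg_le, Int.le_ediv_iff_mul_le hmz]; nlinarith
      · rw [Int.le_ediv_iff_mul_le hmz]; nlinarith
      · rintro rfl; simp at h3
    · intro c hc c' hc' h
      simp only [Finset.coe_filter, Set.mem_ofPred_eq] at hc hc'
      obtain ⟨k, rfl⟩ := Int.natCast_dvd.mpr hc.2
      obtain ⟨k', rfl⟩ := Int.natCast_dvd.mpr hc'.2
      simp only [Int.mul_ediv_cancel_left _ hmz.ne'] at h
      rw [h]
  have h2 : ((Finset.Icc (-((N / m : ℕ) : ℤ)) (N / m : ℕ)).erase 0).card = 2 * (N / m) := by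
    generalize N / m = k
    rw [Finset.card_erase_of_mem (by simp), Int.card_Icc]
    omega
  rw [h2] at h1
  have h3 : ((N / m : ℕ) : ℝ) ≤ (N : ℝ) / m := Nat.cast_div_le
  calc _ ≤ ((2 * (N / m) : ℕ) : ℝ) := by exact_mod_cast h1
    _ ≤ _ := by push_cast; rw [mul_div_assoc]; gcongr

/-- The range `√(t - c⁴)` of `a` for given `c`. -/
noncomputable def widthU (t : ℝ) (c : ℤ) : ℝ := Real.sqrt (t - (c : ℝ) ^ 4)

theorem widthU_nonneg (t : ℝ) (c : ℤ) : 0 ≤ widthU t c := Real.sqrt_nonneg _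

theorem widthU_le (t : ℝ) (c : ℤ) : widthU t c ≤ Real.sqrt t := by
  refine Real.sqrt_le_sqrt ?_
  have : 0 ≤ (c : ℝ) ^ 4 := by positivity
  linarith

/-- The sum of `2 √(t - c⁴)` over all nonzero integers `c` with `|c| ≤ N`. -/
noncomputable def totalMass (t : ℝ) (N : ℕ) : ℝ :=
  2 * (2 * ∑ i ∈ Finset.range N, widthU t ((i : ℤ) + 1))

theorem abs_sum_widthU_sub_le {q₂ m : ℕ} (hq : 0 < q₂) (hm0 : 0 < m) (hm : m.Coprime q₂) (c₀ : ℤ)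
    (N : ℕ) (t : ℝ) :
    |∑ c ∈ (rangeC q₂ c₀ N).filter (fun c => m ∣ c.natAbs), 2 * widthU t c -
      totalMass t N / (m * q₂)| ≤ 4 * Real.sqrt t := by
  rw [filter_dvd_rangeC hq hm]
  have h := abs_sum_modEq_sub_le (Q := m * q₂) (by positivity) (m * crtShift q₂ c₀ m) N
    (f := fun c => 2 * widthU t c) (B := 2 * Real.sqrt t)
    (fun c => by simp [widthU, Even.neg_pow (by decide : Even 4)])
    (by
      intro i j hij
      have hij' : (i : ℝ) ≤ j := by exact_mod_cast hij
      simp only [widthU]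
      refine mul_le_mul_of_nonneg_left (Real.sqrt_le_sqrt (sub_le_sub_left ?_ _)) (by norm_num)
      push_cast
      gcongr)
    (fun c => by have := widthU_nonneg t c; positivity)
    (by have := widthU_le t 1; linarith)
  rw [← Finset.mul_sum (f := fun i : ℕ => widthU t ((i : ℤ) + 1))] at h
  rw [totalMass]
  push_cast at h ⊢
  refine h.trans (by linarith)

/-! ### The sequence as a count of pairs `(a, c)` -/

theorem seqA_eq_card (q₁ q₂ : ℕ) (a₀ c₀ : ℤ) {n K : ℕ} (hK : n ≤ K) :
    seqA q₁ q₂ a₀ c₀ n = ((Finset.Icc (-(K : ℤ)) K ×ˢ Finset.Icc (-(K : ℤ)) K).filter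
      fun p : ℤ × ℤ => p.1 ^ 2 + p.2 ^ 4 = n ∧ p.1 ≡ a₀ [ZMOD q₁] ∧ p.2 ≡ c₀ [ZMOD q₂]).card := by
  simp only [seqA, sqWeight]
  rw [← Finset.card_sigma]
  have habs : ∀ z : ℤ, |z| ≤ z ^ 2 := fun z => by
    have := Int.le_self_sq |z|
    rwa [sq_abs] at this
  refine Finset.card_bij (fun x _ => (x.1.1, x.2)) ?_ ?_ ?_
  · rintro ⟨⟨a, b⟩, c⟩ h
    simp only [Finset.mem_sigma, Finset.mem_filter, Finset.mem_product, Finset.mem_Icc] at h ⊢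
    obtain ⟨⟨⟨⟨h1, h2⟩, h3, h4⟩, h5, h6⟩, ⟨h7, h8⟩, rfl, h10⟩ := h
    have hc := abs_le.mp (habs c)
    have e : (c ^ 2) ^ 2 = c ^ 4 := by ring
    rw [e] at h5
    refine ⟨⟨⟨?_, ?_⟩, ?_, ?_⟩, h5, h6, h10⟩ <;> omega
  · rintro ⟨⟨a, b⟩, c⟩ h ⟨⟨a', b'⟩, c'⟩ h' heq
    simp only [Finset.mem_sigma, Finset.mem_filter] at h h'
    simp only [Prod.mk.injEq] at heq
    obtain ⟨rfl, rfl⟩ := heq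
    obtain ⟨-, -, h1, -⟩ := h
    obtain ⟨-, -, h2, -⟩ := h'
    rw [← h1, ← h2]
  · rintro ⟨a, c⟩ h
    simp only [Finset.mem_filter, Finset.mem_product, Finset.mem_Icc] at h
    obtain ⟨-, h1, h2, h3⟩ := h
    refine ⟨⟨(a, c ^ 2), c⟩, ?_, rfl⟩
    simp only [Finset.mem_sigma, Finset.mem_filter, Finset.mem_product, Finset.mem_Icc]
    have e : (c ^ 2) ^ 2 = c ^ 4 := by ring
    have ha := abs_le.mp (habs a)
    have hc := abs_le.mp (habs c)
    have hcc := abs_le.mp (habs (c ^ 2))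
    have p1 := sq_nonneg a
    have p2 := sq_nonneg (c ^ 2)
    refine ⟨⟨⟨⟨?_, ?_⟩, ?_, ?_⟩, by rw [e, h1], h2⟩, ⟨?_, ?_⟩, trivial, h3⟩
    · omega
    · omega
    · omega
    · omega
    · rw [Int.natAbs_of_nonneg (sq_nonneg c)]; omega
    · rw [Int.natAbs_of_nonneg (sq_nonneg c)]; omega

theorem sum_seqA_eq_card (q₁ q₂ : ℕ) (a₀ c₀ : ℤ) (d K : ℕ) :
    ∑ n ∈ (Finset.Icc 1 K).filter (fun n => d ∣ n), seqA q₁ q₂ a₀ c₀ n =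
      ((Finset.Icc (-(K : ℤ)) K ×ˢ Finset.Icc (-(K : ℤ)) K).filter
      fun p : ℤ × ℤ => (0 < p.1 ^ 2 + p.2 ^ 4 ∧ p.1 ^ 2 + p.2 ^ 4 ≤ K ∧ (d : ℤ) ∣ p.1 ^ 2 + p.2 ^ 4) ∧
        p.1 ≡ a₀ [ZMOD q₁] ∧ p.2 ≡ c₀ [ZMOD q₂]).card := by
  have hpos : ∀ p : ℤ × ℤ, 0 ≤ p.1 ^ 2 + p.2 ^ 4 := fun p => by positivity
  rw [Finset.card_eq_sum_card_fiberwise (f := fun p : ℤ × ℤ => (p.1 ^ 2 + p.2 ^ 4).natAbs)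
    (t := (Finset.Icc 1 K).filter (fun n => d ∣ n))]
  · refine Finset.sum_congr rfl fun n hn => ?_
    simp only [Finset.mem_filter, Finset.mem_Icc] at hn
    rw [seqA_eq_card q₁ q₂ a₀ c₀ hn.1.2, Finset.filter_filter]
    congr 1
    refine Finset.filter_congr fun p _ => ?_
    have h0 := hpos p
    constructor
    · rintro ⟨h1, h2⟩
      have hd : (d : ℤ) ∣ p.1 ^ 2 + p.2 ^ 4 := by rw [h1]; exact_mod_cast hn.2
      refine ⟨⟨⟨?_, ?_, hd⟩, h2⟩, ?_⟩ <;> omega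
    · rintro ⟨⟨_, h2⟩, h3⟩
      exact ⟨by omega, h2⟩
  · intro p hp
    simp only [Finset.coe_filter, Set.mem_ofPred_eq, Finset.mem_Icc] at hp ⊢
    obtain ⟨-, ⟨h1, h2, h3⟩, -⟩ := hp
    exact ⟨⟨by omega, by omega⟩, Int.natCast_dvd.mp h3⟩

/-- The contribution of `c = 0` to `congruenceSum`. -/
noncomputable def zeroPart (q₁ q₂ : ℕ) (a₀ c₀ : ℤ) (d K : ℕ) : ℕ :=
  if (0 : ℤ) ≡ c₀ [ZMOD q₂] then ((Finset.Icc (-(K : ℤ)) K).filter fun a : ℤ =>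
    (0 < a ^ 2 ∧ a ^ 2 ≤ K ∧ (d : ℤ) ∣ a ^ 2) ∧ a ≡ a₀ [ZMOD q₁]).card else 0

theorem mem_Icc_floor_widthU_iff {t : ℝ} {c : ℤ} (h : (c : ℝ) ^ 4 ≤ t) (a : ℤ) :
    a ∈ Finset.Icc (-⌊widthU t c⌋) ⌊widthU t c⌋ ↔ (a : ℝ) ^ 2 + (c : ℝ) ^ 4 ≤ t := by
  rw [Finset.mem_Icc, ← abs_le, Int.le_floor, widthU, Int.cast_abs,
    Real.le_sqrt (abs_nonneg _) (by linarith), sq_abs, le_sub_iff_add_le]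

theorem congruenceSum_seqA (q₁ q₂ : ℕ) (a₀ c₀ : ℤ) (d : ℕ) {t : ℝ} (ht : 0 ≤ t) :
    congruenceSum (fun n => (seqA q₁ q₂ a₀ c₀ n : ℝ)) d t =
      ∑ c ∈ rangeC q₂ c₀ ⌊Real.sqrt (Real.sqrt t)⌋₊, (pairCount q₁ a₀ d c (widthU t c) : ℝ) +
        zeroPart q₁ q₂ a₀ c₀ d ⌊t⌋₊ := by
  set K := ⌊t⌋₊ with hK
  set N := ⌊Real.sqrt (Real.sqrt t)⌋₊ with hN
  have hNiff : ∀ c : ℤ, c ∈ Finset.Icc (-(N : ℤ)) N ↔ (c : ℝ) ^ 4 ≤ t := by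
    intro c
    rw [Finset.mem_Icc, ← abs_le, ← Int.natCast_natAbs, Nat.cast_le, hN,
      Nat.le_floor_iff (Real.sqrt_nonneg _), Nat.cast_natAbs, Int.cast_abs,
      Real.le_sqrt (abs_nonneg _) (Real.sqrt_nonneg _), sq_abs,
      Real.le_sqrt (sq_nonneg _) ht, ← pow_mul]
  have hKiff : ∀ z : ℤ, 0 ≤ z → (z ≤ K ↔ (z : ℝ) ≤ t) := by
    intro z hz
    obtain ⟨n, rfl⟩ := Int.eq_ofNat_of_zero_le hz
    rw [Nat.cast_le, hK, Nat.le_floor_iff ht]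
    simp
  have habs : ∀ z : ℤ, |z| ≤ z ^ 2 := fun z => by
    have := Int.le_self_sq |z|
    rwa [sq_abs] at this
  have h1 : congruenceSum (fun n => (seqA q₁ q₂ a₀ c₀ n : ℝ)) d t =
      ((∑ n ∈ (Finset.Icc 1 K).filter (fun n => d ∣ n), seqA q₁ q₂ a₀ c₀ n : ℕ) : ℝ) := by
    rw [congruenceSum]; push_cast; rfl
  rw [h1, sum_seqA_eq_card, ← Nat.cast_sum, ← Nat.cast_add, Nat.cast_inj, Finset.card_filter,
    Finset.sum_product_right]
  have h0K : (0 : ℤ) ∈ Finset.Icc (-(K : ℤ)) K := by simp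
  rw [← Finset.add_sum_erase _ _ h0K, add_comm]
  congr 1
  · have hsub : rangeC q₂ c₀ N ⊆ (Finset.Icc (-(K : ℤ)) K).erase 0 := by
      intro c hc
      rw [rangeC, Finset.mem_filter, hNiff] at hc
      rw [Finset.mem_erase, Finset.mem_Icc, ← abs_le]
      refine ⟨hc.2.1, ?_⟩
      have h2 := habs c
      have h3 := habs (c ^ 2)
      have h4 : c ^ 4 ≤ K := (hKiff _ (by positivity)).mpr (by push_cast; exact hc.1)
      have e : (c ^ 2) ^ 2 = c ^ 4 := by ring
      rw [e, abs_of_nonneg (sq_nonneg c)] at h3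
      omega
    rw [← Finset.sum_subset hsub]
    · refine Finset.sum_congr rfl fun c hc => ?_
      rw [rangeC, Finset.mem_filter, hNiff] at hc
      rw [← Finset.card_filter, pairCount]
      congr 1
      ext a
      have hc4 : 0 < c ^ 4 := by have := hc.2.1; positivity
      rw [Finset.mem_filter, Finset.mem_filter, mem_Icc_floor_widthU_iff hc.1]
      have h5 := hKiff (a ^ 2 + c ^ 4) (by positivity)
      push_cast at h5
      rw [← h5]
      constructor
      · rintro ⟨_, ⟨_, h7, h8⟩, h9, _⟩
        exact ⟨h7, h9, h8⟩
      · rintro ⟨h6, h7, h8⟩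
        refine ⟨?_, ⟨by positivity, h6, h8⟩, h7, hc.2.2⟩
        have := habs a
        rw [Finset.mem_Icc, ← abs_le]
        omega
    · intro c hc hc'
      rw [Finset.mem_erase] at hc
      rw [rangeC, Finset.mem_filter, hNiff] at hc'
      refine Finset.sum_eq_zero fun a _ => if_neg ?_
      rintro ⟨⟨_, h2, _⟩, _, h5⟩
      refine hc' ⟨?_, hc.1, h5⟩
      have h6 := (hKiff (a ^ 2 + c ^ 4) (by positivity)).mp h2
      push_cast at h6
      nlinarith [sq_nonneg (a : ℝ)]
  · rw [zeroPart]
    split_ifs with h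
    · rw [Finset.card_filter]
      refine Finset.sum_congr rfl fun a _ => ?_
      simp [h]
    · refine Finset.sum_eq_zero fun a _ => if_neg ?_
      rintro ⟨_, _, h5⟩
      exact h h5

/-- For c = 0 the condition is d ∣ a², and each nonzero a is counted for at most τ(a²) moduli. -/
theorem sum_zeroPart_le (q₁ q₂ : ℕ) (a₀ c₀ : ℤ) (K : ℕ) {T : ℝ} (hT0 : 0 ≤ T)
    (hT : ∀ m : ℕ, m ≠ 0 → m ≤ K → (m.divisors.card : ℝ) ≤ T) (B : Finset ℕ) :
    ∑ d ∈ B, (zeroPart q₁ q₂ a₀ c₀ d K : ℝ) ≤ 2 * T * Real.sqrt K := by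
  have hle : ∀ d, zeroPart q₁ q₂ a₀ c₀ d K ≤ ∑ a ∈ (Finset.Icc (-(Nat.sqrt K : ℤ)) (Nat.sqrt K)).filter
      (fun c => c ≠ 0), if d ∣ a.natAbs ^ 2 then 1 else 0 := by
    intro d
    rw [zeroPart]
    split_ifs
    swap
    · exact Nat.zero_le _
    rw [← Finset.card_filter]
    refine Finset.card_le_card fun a ha => ?_
    rw [Finset.mem_filter] at ha
    obtain ⟨_, ⟨h1, h2, h3⟩, _⟩ := ha
    rw [Finset.mem_filter, Finset.mem_filter, Finset.mem_Icc, ← abs_le, ← Int.natCast_natAbs,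
      Nat.cast_le, Nat.le_sqrt']
    have e : ((a.natAbs ^ 2 : ℕ) : ℤ) = a ^ 2 := by push_cast; rw [sq_abs]
    refine ⟨⟨by zify; rw [sq_abs]; exact h2, ?_⟩, ?_⟩
    · rintro rfl; simp at h1
    · rw [← e] at h3; exact_mod_cast h3
  calc ∑ d ∈ B, (zeroPart q₁ q₂ a₀ c₀ d K : ℝ)
      ≤ ∑ d ∈ B, ∑ a ∈ (Finset.Icc (-(Nat.sqrt K : ℤ)) (Nat.sqrt K)).filter
          (fun c => c ≠ 0), (if d ∣ a.natAbs ^ 2 then 1 else 0 : ℝ) := by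
        refine Finset.sum_le_sum fun d _ => ?_
        have := hle d
        exact_mod_cast this
    _ = ∑ a ∈ (Finset.Icc (-(Nat.sqrt K : ℤ)) (Nat.sqrt K)).filter (fun c => c ≠ 0),
          ∑ d ∈ B, (if d ∣ a.natAbs ^ 2 then 1 else 0 : ℝ) := Finset.sum_comm
    _ ≤ ∑ a ∈ (Finset.Icc (-(Nat.sqrt K : ℤ)) (Nat.sqrt K)).filter (fun c => c ≠ 0), T := by
        refine Finset.sum_le_sum fun a ha => ?_
        rw [Finset.mem_filter, Finset.mem_Icc, ← abs_le, ← Int.natCast_natAbs, Nat.cast_le,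
          Nat.le_sqrt'] at ha
        have hne : a.natAbs ^ 2 ≠ 0 := pow_ne_zero 2 (Int.natAbs_ne_zero.mpr ha.2)
        refine le_trans ?_ (hT _ hne ha.1)
        rw [Finset.sum_ite, Finset.sum_const_zero, add_zero, Finset.sum_const, nsmul_eq_mul, mul_one]
        refine Nat.cast_le.mpr (Finset.card_le_card fun d hd => ?_)
        exact Nat.mem_divisors.mpr ⟨(Finset.mem_filter.mp hd).2, hne⟩
    _ = 2 * T * (Nat.sqrt K : ℝ) := by
        rw [sum_Icc_neg_ne_zero (Nat.sqrt K) fun _ => T]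
        simp only [Finset.sum_const, Finset.card_range, nsmul_eq_mul]
        ring
    _ ≤ _ := by
        gcongr
        exact Real.nat_sqrt_le_real_sqrt

/-! ### Bounds for the density -/

theorem localDensity_bounds {p k : ℕ} (hp : p.Prime) (hk : k = 1 ∨ k = 2) :
    0 ≤ localDensity p k ∧ localDensity p k ≤ (k + 1) / (p : ℝ) ^ k := by
  have hp0 : (0 : ℝ) < p := by exact_mod_cast hp.pos
  by_cases hp2 : p = 2
  · subst hp2
    rcases hk with rfl | rfl <;> norm_num [localDensity]
  · have h1 : 0 < 1 / (p : ℝ) := by positivity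
    have h2 : 1 / (p : ℝ) ≤ 1 := by
      rw [div_le_one hp0]; exact_mod_cast hp.one_le
    rcases hk with rfl | rfl <;>
      simp only [localDensity, if_neg hp2, pow_one] <;>
      rcases ZMod.isQuadratic_χ₄ (p : ZMod 4) with h | h | h <;> rw [h] <;>
      refine ⟨div_nonneg (by push_cast; linarith) (by positivity), ?_⟩ <;>
      refine div_le_div_of_nonneg_right ?_ (by positivity) <;> push_cast <;> linarith

theorem density_bounds {d : ℕ} (hd : Cubefree d) (hd0 : d ≠ 0) :
    0 ≤ density d ∧ density d ≤ (d.divisors.card : ℝ) / d := by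
  have hb : ∀ p ∈ d.primeFactors, 0 ≤ localDensity p (d.factorization p) ∧
      localDensity p (d.factorization p) ≤
        ((d.factorization p : ℕ) + 1) / (p : ℝ) ^ d.factorization p := fun p hp =>
    localDensity_bounds (Nat.prime_of_mem_primeFactors hp) (hd.factorization_eq hp)
  rw [density, if_neg hd0, Finsupp.prod, Nat.support_factorization]
  refine ⟨Finset.prod_nonneg fun p hp => (hb p hp).1, ?_⟩
  have hn : (d : ℝ) = ∏ p ∈ d.primeFactors, (p : ℝ) ^ d.factorization p := by
    conv_lhs => rw [← Nat.prod_factorization_pow_eq_self hd0]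
    rw [Finsupp.prod, Nat.support_factorization]
    push_cast; rfl
  rw [Nat.card_divisors hd0]
  rw [hn]
  push_cast
  rw [← Finset.prod_div_distrib]
  exact Finset.prod_le_prod (fun p hp => (hb p hp).1) fun p hp => (hb p hp).2

theorem density_one : density 1 = 1 := by simp [density]

/-! ### Moduli that are not coprime to `q` -/

theorem seqA_eq_zero_of_admissible {q₁ q₂ : ℕ} {a₀ c₀ : ℤ} (h : Admissible q₁ q₂ a₀ c₀) {d n : ℕ}
    (hd : ¬ d.Coprime (Nat.lcm q₁ q₂)) (hdn : d ∣ n) : seqA q₁ q₂ a₀ c₀ n = 0 := by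
  rw [seqA_eq_card q₁ q₂ a₀ c₀ le_rfl, Finset.card_eq_zero, Finset.filter_eq_empty_iff]
  rintro ⟨a, c⟩ - ⟨h1, h2, h3⟩
  have hu := h a c h2 h3
  dsimp only at h1
  rw [h1, Int.cast_natCast, ZMod.isUnit_iff_coprime] at hu
  exact hd (hu.coprime_dvd_left hdn)

/-- Admissibility forces every represented n to be coprime to lcm(q₁, q₂), so both terms of the
remainder vanish. -/
theorem remainder_eq_zero_of_admissible {q₁ q₂ : ℕ} {a₀ c₀ : ℤ} (h : Admissible q₁ q₂ a₀ c₀)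
    {d : ℕ} (hd : ¬ d.Coprime (Nat.lcm q₁ q₂)) (t : ℝ) :
    remainder (fun n => (seqA q₁ q₂ a₀ c₀ n : ℝ)) (densityCoprime q₁ q₂) d t = 0 := by
  rw [remainder, densityCoprime, if_neg hd, zero_mul, sub_zero, congruenceSum]
  refine Finset.sum_eq_zero fun n hn => ?_
  rw [seqA_eq_zero_of_admissible h hd (Finset.mem_filter.mp hn).2, Nat.cast_zero]

/-! ### The remainder for a single modulus -/

/-- The contribution of `c ≠ 0` to `congruenceSum`. -/
noncomputable def mainPart (q₁ q₂ : ℕ) (a₀ c₀ : ℤ) (d : ℕ) (t : ℝ) : ℝ :=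
  ∑ c ∈ rangeC q₂ c₀ ⌊Real.sqrt (Real.sqrt t)⌋₊, (pairCount q₁ a₀ d c (widthU t c) : ℝ)

/-- The deviation of the lattice point counts modulo `r d` over `c` divisible by `r f` from
their expected size. -/
noncomputable def fluctuation (q₁ q₂ : ℕ) (a₀ c₀ : ℤ) (t : ℝ) (r f d : ℕ) : ℝ :=
  |∑ p ∈ ((rangeC q₂ c₀ ⌊Real.sqrt (Real.sqrt t)⌋₊).filter fun c => r * f ∣ c.natAbs) ×ˢ
      rootSet q₁ d,
    (classCount q₁ a₀ r d p.1 (widthU t p.1) p.2 - 2 * (widthU t p.1 / (r * d * q₁)))|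

/-- The part of the error term that belongs to a unitary divisor with radical `r` and a
squarefree `f`. -/
noncomputable def localError (q₁ q₂ : ℕ) (a₀ c₀ : ℤ) (t : ℝ) (r f d : ℕ) : ℝ :=
  4 * Real.sqrt t * ((rootSet q₁ d).card / (r * d)) + fluctuation q₁ q₂ a₀ c₀ t r f d

theorem localError_nonneg (q₁ q₂ : ℕ) (a₀ c₀ : ℤ) (t : ℝ) (r f d : ℕ) :
    0 ≤ localError q₁ q₂ a₀ c₀ t r f d :=
  add_nonneg (by positivity) (abs_nonneg _)

theorem abs_moebius_cast_le_one (f : ℕ) : |(moebius f : ℝ)| ≤ 1 := by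
  have := ArithmeticFunction.abs_moebius_le_one (n := f)
  exact_mod_cast this

theorem radical_coprime {e q : ℕ} (h : e.Coprime q) : (radical e).Coprime q :=
  h.coprime_dvd_left (UniqueFactorizationMonoid.radical_dvd_self)

/-- For each e and f the count is its fluctuation plus a constant times the total width of the
intervals over c. That width is the common mass divided by rfq₂, up to O(√t). The masses then
recombine through `density_eq_sum`. -/
theorem abs_mainPart_sub_le {q₁ q₂ d : ℕ} (hq₁ : 0 < q₁) (hq₂ : 0 < q₂) (a₀ c₀ : ℤ)
    (hd : Cubefree d) (hd0 : d ≠ 0) (hd1 : d.Coprime q₁) (hd2 : d.Coprime q₂) (t : ℝ) :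
    |mainPart q₁ q₂ a₀ c₀ d t -
      totalMass t ⌊Real.sqrt (Real.sqrt t)⌋₊ / (q₁ * q₂) * density d| ≤
    ∑ e ∈ unitaryDivisors d, ∑ f ∈ (radical (d / e)).divisors,
      localError q₁ q₂ a₀ c₀ t (radical e) f (d / e) := by
  set N := ⌊Real.sqrt (Real.sqrt t)⌋₊ with hN
  rw [mainPart, sum_pairCount_eq hq₁ hd hd0 hd1 a₀ _ (widthU_nonneg t),
    ← density_eq_sum hd hd0 hd1.symm, Finset.mul_sum, ← Finset.sum_sub_distrib]
  refine (Finset.abs_sum_le_sum_abs _ _).trans (Finset.sum_le_sum fun e he => ?_)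
  rw [Finset.mul_sum, ← Finset.sum_sub_distrib]
  refine (Finset.abs_sum_le_sum_abs _ _).trans (Finset.sum_le_sum fun f hf => ?_)
  rw [unitaryDivisors, Finset.mem_filter, Nat.mem_divisors] at he
  have hde := Nat.mul_div_cancel' he.1.1
  set d' := d / e with hd'
  have hd'0 : d' ≠ 0 := fun h => hd0 (by rw [← hde, h, mul_zero])
  have he0 : e ≠ 0 := fun h => hd0 (by rw [← hde, h, zero_mul])
  set r := radical e with hr
  have hr0 : 0 < r := Nat.pos_of_ne_zero UniqueFactorizationMonoid.radical_ne_zero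
  have hfd : f ∣ d' := (Nat.dvd_of_mem_divisors hf).trans
    UniqueFactorizationMonoid.radical_dvd_self
  have hf0 : 0 < f := Nat.pos_of_mem_divisors hf
  have hm : (r * f).Coprime q₂ := Nat.Coprime.mul_left
    (radical_coprime (hd2.coprime_dvd_left he.1.1))
    (hd2.coprime_dvd_left (hfd.trans ⟨e, by rw [mul_comm]; exact hde.symm⟩))
  have hV := abs_sum_widthU_sub_le hq₂ (Nat.mul_pos hr0 hf0) hm c₀ N t
  set C := (rangeC q₂ c₀ N).filter (fun c => r * f ∣ c.natAbs) with hC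
  set S := ∑ p ∈ C ×ˢ rootSet q₁ d',
    (classCount q₁ a₀ r d' p.1 (widthU t p.1) p.2 - 2 * (widthU t p.1 / (r * d' * q₁))) with hS
  set V := ∑ c ∈ C, 2 * widthU t c with hVdef
  set ρ : ℝ := ((rootSet q₁ d').card : ℝ) with hρ
  have hq1r : (0 : ℝ) < q₁ := by exact_mod_cast hq₁
  have hq1r' : (1 : ℝ) ≤ q₁ := by exact_mod_cast hq₁
  have hq2r : (0 : ℝ) < q₂ := by exact_mod_cast hq₂
  have hrr : (0 : ℝ) < r := by exact_mod_cast hr0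
  have hfr : (0 : ℝ) < f := by exact_mod_cast hf0
  have hdr : (0 : ℝ) < d' := by exact_mod_cast Nat.pos_of_ne_zero hd'0
  have hsum : ∑ c ∈ C, ∑ μ ∈ rootSet q₁ d', classCount q₁ a₀ r d' c (widthU t c) μ =
      S + ρ / (r * d' * q₁) * V := by
    rw [hS, Finset.sum_sub_distrib, Finset.sum_product, Finset.sum_product]
    simp only [Finset.sum_const, nsmul_eq_mul]
    rw [hVdef, Finset.mul_sum]
    have : ∀ c, ρ / (r * d' * q₁) * (2 * widthU t c) =
      ((rootSet q₁ d').card : ℝ) * (2 * (widthU t c / (r * d' * q₁))) := fun c => by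
        rw [hρ]; ring
    simp only [this]
    ring
  rw [hsum]
  have e1 : (moebius f : ℝ) * (S + ρ / (r * d' * q₁) * V) -
      totalMass t N / (q₁ * q₂) * ((moebius f : ℝ) / f * (ρ / (r ^ 2 * d'))) =
      (moebius f : ℝ) * (S + ρ / (r * d' * q₁) * (V - totalMass t N / (((r * f : ℕ) : ℝ) * q₂))) := by
    push_cast
    field_simp
    ring
  rw [e1, abs_mul]
  refine (mul_le_of_le_one_left (abs_nonneg _) (abs_moebius_cast_le_one f)).trans ?_
  refine (abs_add_le _ _).trans ?_
  rw [localError, fluctuation, ← hN, ← hC, ← hS, add_comm, abs_mul,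
    abs_of_nonneg (show 0 ≤ ρ / (r * d' * q₁) by positivity)]
  refine add_le_add ?_ le_rfl
  have h3 : ρ / (r * d' * q₁) ≤ ρ / (r * d') := by
    apply div_le_div_of_nonneg_left (by positivity) (by positivity)
    exact le_mul_of_one_le_right (by positivity) hq1r'
  calc _ ≤ ρ / (r * d') * (4 * Real.sqrt t) := by gcongr
    _ = _ := by ring

theorem abs_latticeCount_sub_le (θ y : ℝ) : |latticeCount θ y - 2 * θ| ≤ 1 := by
  rw [latticeCount, abs_le]
  have h1 := Int.floor_le (θ - y)
  have h2 := Int.lt_floor_add_one (θ - y)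
  have h3 := Int.floor_le (θ + y)
  have h4 := Int.lt_floor_add_one (θ + y)
  constructor <;> linarith

theorem card_rangeC_le (q₂ : ℕ) (c₀ : ℤ) (t : ℝ) :
    ((rangeC q₂ c₀ ⌊Real.sqrt (Real.sqrt t)⌋₊).card : ℝ) ≤ 2 * Real.sqrt (Real.sqrt t) := by
  have h := card_filter_dvd_rangeC_le q₂ c₀ ⌊Real.sqrt (Real.sqrt t)⌋₊ one_pos
  simp only [one_dvd, Finset.filter_true, Nat.cast_one, div_one] at h
  have := Nat.floor_le (Real.sqrt_nonneg (Real.sqrt t))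
  linarith

theorem sqrt_sqrt_le {t : ℝ} (ht : 1 ≤ t) : Real.sqrt (Real.sqrt t) ≤ Real.sqrt t := by
  have h1 : 1 ≤ Real.sqrt t := Real.one_le_sqrt.mpr ht
  rw [Real.sqrt_le_iff]
  exact ⟨by linarith, by nlinarith⟩

theorem abs_mainPart_one_sub_le {q₁ q₂ : ℕ} (hq₁ : 0 < q₁) (hq₂ : 0 < q₂) (a₀ c₀ : ℤ) {t : ℝ}
    (ht : 1 ≤ t) :
    |mainPart q₁ q₂ a₀ c₀ 1 t - totalMass t ⌊Real.sqrt (Real.sqrt t)⌋₊ / (q₁ * q₂)| ≤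
      6 * Real.sqrt t := by
  have hc1 : Cubefree 1 := fun p hp h => by
    have := Nat.dvd_one.mp h
    simp [hp.one_lt.ne'] at this
  have h := abs_mainPart_sub_le hq₁ hq₂ a₀ c₀ hc1 one_ne_zero (Nat.coprime_one_left q₁)
    (Nat.coprime_one_left q₂) t
  have hu : unitaryDivisors 1 = {1} := by simp [unitaryDivisors]
  rw [hu, density_one, mul_one, Finset.sum_singleton, Nat.div_one,
    UniqueFactorizationMonoid.radical_one, Nat.divisors_one, Finset.sum_singleton] at h
  refine h.trans ?_
  rw [localError, card_rootSet_one, fluctuation]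
  have h2 : |∑ p ∈ ((rangeC q₂ c₀ ⌊Real.sqrt (Real.sqrt t)⌋₊).filter fun c => 1 * 1 ∣ c.natAbs) ×ˢ
      rootSet q₁ 1, (classCount q₁ a₀ 1 1 p.1 (widthU t p.1) p.2 -
        2 * (widthU t p.1 / ((1 : ℕ) * (1 : ℕ) * q₁)))| ≤ 2 * Real.sqrt (Real.sqrt t) := by
    refine (Finset.abs_sum_le_sum_abs _ _).trans ((Finset.sum_le_sum fun p _ =>
      abs_latticeCount_sub_le _ _).trans ?_)
    rw [Finset.sum_const, Finset.card_product, card_rootSet_one]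
    simpa using card_rangeC_le q₂ c₀ t
  have := sqrt_sqrt_le ht
  push_cast at h2 ⊢
  linarith

/-- Both A_d and A_1 are compared with the same mass, which cancels in A_d - g(d)A_1. -/
theorem abs_remainder_le {q₁ q₂ d : ℕ} (hq₁ : 0 < q₁) (hq₂ : 0 < q₂) (a₀ c₀ : ℤ)
    (hd : Cubefree d) (hd0 : d ≠ 0) (hdq : d.Coprime (Nat.lcm q₁ q₂)) {t : ℝ} (ht : 1 ≤ t) :
    |remainder (fun n => (seqA q₁ q₂ a₀ c₀ n : ℝ)) (densityCoprime q₁ q₂) d t| ≤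
      ∑ e ∈ unitaryDivisors d, ∑ f ∈ (radical (d / e)).divisors,
        localError q₁ q₂ a₀ c₀ t (radical e) f (d / e) +
      zeroPart q₁ q₂ a₀ c₀ d ⌊t⌋₊ +
      density d * (6 * Real.sqrt t + zeroPart q₁ q₂ a₀ c₀ 1 ⌊t⌋₊) := by
  have h1 := abs_mainPart_sub_le hq₁ hq₂ a₀ c₀ hd hd0
    (hdq.coprime_dvd_right (Nat.dvd_lcm_left _ _)) (hdq.coprime_dvd_right (Nat.dvd_lcm_right _ _)) t
  have h2 := abs_mainPart_one_sub_le hq₁ hq₂ a₀ c₀ ht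
  have hg := (density_bounds hd hd0).1
  have ht0 : 0 ≤ t := by linarith
  rw [remainder, densityCoprime, if_pos hdq, congruenceSum_seqA _ _ _ _ _ ht0,
    congruenceSum_seqA _ _ _ _ _ ht0, ← mainPart, ← mainPart]
  set J := totalMass t ⌊Real.sqrt (Real.sqrt t)⌋₊ / (q₁ * q₂ : ℝ)
  set Z : ℝ := (zeroPart q₁ q₂ a₀ c₀ d ⌊t⌋₊ : ℝ)
  set Z₁ : ℝ := (zeroPart q₁ q₂ a₀ c₀ 1 ⌊t⌋₊ : ℝ)
  have e1 : mainPart q₁ q₂ a₀ c₀ d t + Z - density d * (mainPart q₁ q₂ a₀ c₀ 1 t + Z₁) =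
      (mainPart q₁ q₂ a₀ c₀ d t - J * density d) + Z -
        density d * ((mainPart q₁ q₂ a₀ c₀ 1 t - J) + Z₁) := by ring
  have hZ : 0 ≤ Z := Nat.cast_nonneg _
  have hZ1 : 0 ≤ Z₁ := Nat.cast_nonneg _
  rw [e1]
  refine (abs_sub _ _).trans (add_le_add ((abs_add_le _ _).trans ?_) ?_)
  · rw [abs_of_nonneg hZ]
    linarith
  · rw [abs_mul, abs_of_nonneg hg]
    refine mul_le_mul_of_nonneg_left ((abs_add_le _ _).trans ?_) hg
    rw [abs_of_nonneg hZ1]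
    linarith

/-! ### Sums over cubefree moduli -/

theorem sum_le_sum_of_mapsTo_injOn {α β : Type*} {s : Finset α} {t : Finset β} (i : α → β)
    {f : α → ℝ} {g : β → ℝ} (hmaps : ∀ x ∈ s, i x ∈ t) (hinj : Set.InjOn i s)
    (hfg : ∀ x ∈ s, f x ≤ g (i x)) (hg : ∀ y ∈ t, 0 ≤ g y) : ∑ x ∈ s, f x ≤ ∑ y ∈ t, g y := by
  classical
  calc ∑ x ∈ s, f x ≤ ∑ x ∈ s, g (i x) := Finset.sum_le_sum hfg
    _ = ∑ y ∈ s.image i, g y := (Finset.sum_image hinj).symm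
    _ ≤ _ := Finset.sum_le_sum_of_subset_of_nonneg
        (Finset.image_subset_iff.mpr hmaps) fun y hy _ => hg y hy

open scoped Classical in
/-- The cubefree positive integers up to `D` that are coprime to `q`. -/
noncomputable def modSet (q : ℕ) (D : ℝ) : Finset ℕ :=
  (Finset.Icc 1 ⌊D⌋₊).filter fun d => Cubefree d ∧ d.Coprime q

theorem mem_modSet {q : ℕ} {D : ℝ} (hD : 0 ≤ D) {d : ℕ} :
    d ∈ modSet q D ↔ (0 < d ∧ (d : ℝ) ≤ D) ∧ Cubefree d ∧ d.Coprime q := by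
  simp only [modSet, Finset.mem_filter, Finset.mem_Icc, Nat.le_floor_iff hD, Nat.succ_le_iff]

/-- The change of variables (d, e) ↦ (e, d/e) is injective, and all terms are nonnegative, so the
summation range may be enlarged. -/
theorem sum_unitaryDivisors_le {q : ℕ} {D : ℝ} (hD : 1 ≤ D) {X : ℕ → ℕ → ℕ → ℝ}
    (hX : ∀ e f d, 0 ≤ X e f d) :
    ∑ d ∈ modSet q D, ∑ e ∈ unitaryDivisors d, ∑ f ∈ (radical (d / e)).divisors, X e f (d / e) ≤
      ∑ e ∈ modSet q D, ∑ f ∈ Finset.Icc 1 ⌊D⌋₊,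
        ∑ d ∈ (modSet q (D / e)).filter (fun d => f ∣ d), X e f d := by
  have hD0 : 0 ≤ D := by linarith
  calc _ ≤ ∑ e ∈ modSet q D, ∑ d ∈ modSet q (D / e), ∑ f ∈ (radical d).divisors, X e f d := by
        rw [Finset.sum_sigma' (modSet q D) unitaryDivisors,
          Finset.sum_sigma' (modSet q D) (fun e => modSet q (D / (e : ℝ)))]
        refine sum_le_sum_of_mapsTo_injOn (fun x : (_ : ℕ) × ℕ => (⟨x.2, x.1 / x.2⟩ : (_ : ℕ) × ℕ))
          ?_ ?_ (fun x _ => ?_) fun y _ => Finset.sum_nonneg fun f _ => hX _ _ _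
        · rintro ⟨d, e⟩ h
          simp only [Finset.mem_sigma, unitaryDivisors, Finset.mem_filter, Nat.mem_divisors,
            mem_modSet hD0] at h
          obtain ⟨⟨⟨h1, h2⟩, h3, h4⟩, ⟨h5, h6⟩, h7⟩ := h
          have hde := Nat.mul_div_cancel' h5
          have he0 : 0 < e := Nat.pos_of_dvd_of_pos h5 h1
          have her : (0 : ℝ) < e := by exact_mod_cast he0
          simp only [Finset.mem_sigma, mem_modSet hD0, mem_modSet (div_nonneg hD0 her.le)]
          refine ⟨⟨⟨he0, ?_⟩, h3.of_dvd h5, h4.coprime_dvd_left h5⟩,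
            ⟨Nat.div_pos (Nat.le_of_dvd h1 h5) he0, ?_⟩, h3.of_dvd (Nat.div_dvd_of_dvd h5),
            h4.coprime_dvd_left (Nat.div_dvd_of_dvd h5)⟩
          · exact le_trans (by exact_mod_cast Nat.le_of_dvd h1 h5) h2
          · rw [le_div_iff₀ her]
            refine le_trans (le_of_eq ?_) h2
            rw [mul_comm]; exact_mod_cast hde
        · rintro ⟨d, e⟩ h ⟨d', e'⟩ h' heq
          simp only [Finset.coe_sigma, Set.mem_sigma_iff, Finset.mem_coe, unitaryDivisors,
            Finset.mem_filter, Nat.mem_divisors] at h h'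
          simp only [Sigma.mk.injEq, heq_eq_eq] at heq
          obtain ⟨rfl, h8⟩ := heq
          have h9 : d = d' := by
            rw [← Nat.mul_div_cancel' h.2.1.1, ← Nat.mul_div_cancel' h'.2.1.1, h8]
          subst h9; rfl
        · exact le_rfl
    _ ≤ _ := by
        refine Finset.sum_le_sum fun e he => ?_
        rw [mem_modSet hD0] at he
        have he1 : (1 : ℝ) ≤ e := by exact_mod_cast he.1.1
        have hDe : D / e ≤ D := div_le_self hD0 he1
        simp_rw [Finset.sum_filter]
        rw [Finset.sum_comm (s := Finset.Icc 1 ⌊D⌋₊)]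
        refine Finset.sum_le_sum fun d hd => ?_
        rw [mem_modSet (by positivity)] at hd
        rw [← Finset.sum_filter]
        refine Finset.sum_le_sum_of_subset_of_nonneg (fun f hf => ?_) fun _ _ _ => hX _ _ _
        have hfd : f ∣ d := (Nat.dvd_of_mem_divisors hf).trans
          UniqueFactorizationMonoid.radical_dvd_self
        rw [Finset.mem_filter, Finset.mem_Icc, Nat.le_floor_iff hD0]
        refine ⟨⟨Nat.pos_of_mem_divisors hf, ?_⟩, hfd⟩
        have : (f : ℝ) ≤ d := by exact_mod_cast Nat.le_of_dvd hd.1.1 hfd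
        linarith [hd.1.2]

/-- A cubefree e is rad(e)s with s ∣ rad(e), so a given radical r occurs at most τ(r) times. -/
theorem sum_inv_radical_le {q : ℕ} {D W : ℝ} (hD : 1 ≤ D) (hW : 0 ≤ W)
    (hT : ∀ m : ℕ, m ≠ 0 → (m : ℝ) ≤ D → (m.divisors.card : ℝ) ≤ W) :
    ∑ e ∈ modSet q D, (1 : ℝ) / (radical e : ℕ) ≤ W * (1 + Real.log D) := by
  have hD0 : 0 ≤ D := by linarith
  calc _ ≤ ∑ r ∈ Finset.Icc 1 ⌊D⌋₊, ∑ _s ∈ r.divisors, (1 : ℝ) / r := by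
        rw [Finset.sum_sigma']
        refine sum_le_sum_of_mapsTo_injOn (fun e => ⟨radical e, e / radical e⟩) ?_ ?_
          (fun x _ => le_rfl) fun y _ => by positivity
        · intro e he
          rw [mem_modSet hD0] at he
          have hr : radical e ∣ e := UniqueFactorizationMonoid.radical_dvd_self
          have hr0 : 0 < radical e := Nat.pos_of_dvd_of_pos hr he.1.1
          simp only [Finset.mem_sigma, Finset.mem_Icc, Nat.mem_divisors, Nat.le_floor_iff hD0]
          refine ⟨⟨hr0, le_trans (by exact_mod_cast Nat.le_of_dvd he.1.1 hr) he.1.2⟩, ?_, hr0.ne'⟩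
          have := he.2.1.dvd_radical_sq he.1.1.ne'
          rw [sq] at this
          exact Nat.dvd_of_mul_dvd_mul_left hr0 (by rwa [Nat.mul_div_cancel' hr])
        · intro e _ e' _ heq
          simp only [Sigma.mk.injEq, heq_eq_eq] at heq
          rw [← Nat.mul_div_cancel' (UniqueFactorizationMonoid.radical_dvd_self (a := e)),
            ← Nat.mul_div_cancel' (UniqueFactorizationMonoid.radical_dvd_self (a := e')),
            heq.2, heq.1]
    _ ≤ ∑ r ∈ Finset.Icc 1 ⌊D⌋₊, W * ((1 : ℝ) / r) := by
        refine Finset.sum_le_sum fun r hr => ?_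
        rw [Finset.mem_Icc, Nat.le_floor_iff hD0] at hr
        rw [Finset.sum_const, nsmul_eq_mul]
        exact mul_le_mul_of_nonneg_right (hT r (by omega) hr.2) (by positivity)
    _ ≤ _ := by
        rw [← Finset.mul_sum]
        exact mul_le_mul_of_nonneg_left (sum_one_div_le_one_add_log hD) hW

theorem sum_inv_filter_dvd_le {q f : ℕ} {D Y : ℝ} (hf : 0 < f) (hD : 1 ≤ D) (hY0 : 0 ≤ Y)
    (hY : Y ≤ D) :
    ∑ d ∈ (modSet q Y).filter (fun d => f ∣ d), (1 : ℝ) / d ≤ (1 + Real.log D) / f := by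
  have hfr : (0 : ℝ) < f := by exact_mod_cast hf
  have hfr1 : (1 : ℝ) ≤ f := by exact_mod_cast hf
  calc _ ≤ ∑ m ∈ Finset.Icc 1 ⌊D⌋₊, (1 : ℝ) / m * (1 / f) := by
        refine sum_le_sum_of_mapsTo_injOn (fun d => d / f) ?_ ?_ ?_ fun y _ => by positivity
        · intro d hd
          rw [Finset.mem_filter, mem_modSet hY0] at hd
          rw [Finset.mem_Icc, Nat.le_floor_iff (by linarith)]
          refine ⟨Nat.div_pos (Nat.le_of_dvd hd.1.1.1 hd.2) hf, ?_⟩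
          have : ((d / f : ℕ) : ℝ) ≤ d := by exact_mod_cast Nat.div_le_self d f
          linarith [hd.1.1.2]
        · intro d hd d' hd' heq
          simp only [Finset.coe_filter, Set.mem_ofPred_eq] at hd hd'
          dsimp only at heq
          rw [← Nat.mul_div_cancel' hd.2, ← Nat.mul_div_cancel' hd'.2, heq]
        · intro d hd
          rw [Finset.mem_filter] at hd
          rw [Nat.cast_div hd.2 hfr.ne']
          apply le_of_eq
          field_simp
    _ ≤ _ := by
        rw [← Finset.sum_mul, div_eq_mul_one_div (1 + Real.log D)]
        exact mul_le_mul_of_nonneg_right (sum_one_div_le_one_add_log hD) (by positivity)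

theorem card_filter_dvd_modSet_le {q f : ℕ} {Y : ℝ} (hf : 0 < f) (hY : 0 ≤ Y) :
    (((modSet q Y).filter fun d => f ∣ d).card : ℝ) ≤ Y / f := by
  have hfr : (0 : ℝ) < f := by exact_mod_cast hf
  have h1 : ((modSet q Y).filter fun d => f ∣ d).card ≤ (Finset.Icc 1 (⌊Y⌋₊ / f)).card := by
    refine Finset.card_le_card_of_injOn (fun d => d / f) ?_ ?_
    · intro d hd
      simp only [Finset.coe_filter, Set.mem_ofPred_eq, mem_modSet hY] at hd
      simp only [Finset.coe_Icc, Set.mem_Icc]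
      exact ⟨Nat.div_pos (Nat.le_of_dvd hd.1.1.1 hd.2) hf, Nat.div_le_div_right (Nat.le_floor hd.1.1.2)⟩
    · intro d hd d' hd' heq
      simp only [Finset.coe_filter, Set.mem_ofPred_eq] at hd hd'
      dsimp only at heq
      rw [← Nat.mul_div_cancel' hd.2, ← Nat.mul_div_cancel' hd'.2, heq]
  rw [Nat.card_Icc, Nat.add_sub_cancel] at h1
  calc _ ≤ ((⌊Y⌋₊ / f : ℕ) : ℝ) := by exact_mod_cast h1
    _ ≤ (⌊Y⌋₊ : ℝ) / f := Nat.cast_div_le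
    _ ≤ _ := by
      have := Nat.floor_le hY
      gcongr

theorem sum_density_le {D W : ℝ} (q : ℕ) (hD : 1 ≤ D) (hW : 0 ≤ W)
    (hT : ∀ m : ℕ, m ≠ 0 → (m : ℝ) ≤ D → (m.divisors.card : ℝ) ≤ W) :
    ∑ d ∈ modSet q D, density d ≤ W * (1 + Real.log D) := by
  have hD0 : 0 ≤ D := by linarith
  calc _ ≤ ∑ d ∈ Finset.Icc 1 ⌊D⌋₊, W * (1 / (d : ℝ)) := by
        refine sum_le_sum_of_mapsTo_injOn id ?_ Function.injective_id.injOn ?_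
          fun y _ => by positivity
        · intro d hd
          rw [mem_modSet hD0] at hd
          exact Finset.mem_Icc.mpr ⟨hd.1.1, Nat.le_floor hd.1.2⟩
        · intro d hd
          rw [mem_modSet hD0] at hd
          refine (density_bounds hd.2.1 hd.1.1.ne').2.trans ?_
          rw [div_eq_mul_one_div]
          exact mul_le_mul_of_nonneg_right (hT d hd.1.1.ne' hd.1.2) (by positivity)
    _ ≤ _ := by
        rw [← Finset.mul_sum]
        exact mul_le_mul_of_nonneg_left (sum_one_div_le_one_add_log hD) hW

/-! ### The remainder on average over the modulus -/

/-- Here u = t^(1/4), and W majorises the logarithms and divisor functions. There are at most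
2u/(rf) values of c and at most D/f moduli, and the large sieve contributes u²/r. The square root
therefore carries the exact factor 1/(rf), and summation over e and f costs only powers of W. -/
theorem sum_fluctuation_le {q₁ q₂ r e f J : ℕ} (hq₁ : 0 < q₁) (a₀ c₀ : ℤ) {u D H W : ℝ}
    (hu : 1 ≤ u) (hr : 0 < r) (hre : r ≤ e) (heD : (e : ℝ) ≤ D) (hf : 0 < f) (hH : 2 ≤ H)
    (hqW : (q₁ : ℝ) ≤ W) (hL : 1 + Real.log D ≤ W) (hJW : (J : ℝ) ≤ W) (hDt : D ≤ u ^ 4)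
    (hT : ∀ m : ℕ, m ≠ 0 → (m : ℝ) ≤ 2 ^ J * u ^ 4 → (m.divisors.card : ℝ) ≤ W)
    (hJ : 2 * (D * q₁ * H / u ^ 2) ^ 2 ≤ 2 ^ J) :
    ∑ d ∈ (modSet (Nat.lcm q₁ q₂) (D / e)).filter (fun d => f ∣ d),
      fluctuation q₁ q₂ a₀ c₀ (u ^ 4) r f d ≤
    (16 * W ^ 2 * (u ^ 3 / H) + 180 * W ^ 3 * Real.sqrt (D * H * u ^ 3)) * (1 / r * (1 / f)) := by
  have hu0 : 0 < u := by linarith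
  have hrr : (0 : ℝ) < r := by exact_mod_cast hr
  have hr1 : (1 : ℝ) ≤ r := by exact_mod_cast hr
  have hfr : (0 : ℝ) < f := by exact_mod_cast hf
  have hf1 : (1 : ℝ) ≤ f := by exact_mod_cast hf
  have her : (0 : ℝ) < e := by exact_mod_cast lt_of_lt_of_le hr hre
  have he1 : (1 : ℝ) ≤ e := by exact_mod_cast lt_of_lt_of_le hr hre
  have hre' : (r : ℝ) ≤ e := by exact_mod_cast hre
  have hqr : (1 : ℝ) ≤ q₁ := by exact_mod_cast hq₁
  have hW1 : 1 ≤ W := hqr.trans hqW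
  have hD1 : 1 ≤ D := he1.trans heD
  have hD0 : 0 < D := by linarith
  have hY1 : 1 ≤ D / e := by rwa [one_le_div her]
  have hYD : D / e ≤ D := div_le_self hD0.le he1
  have hs : Real.sqrt (u ^ 4) = u ^ 2 := by
    rw [show u ^ 4 = (u ^ 2) ^ 2 by ring, Real.sqrt_sq (by positivity)]
  have hss : Real.sqrt (Real.sqrt (u ^ 4)) = u := by rw [hs, Real.sqrt_sq hu0.le]
  have hmod : ∀ d ∈ (modSet (Nat.lcm q₁ q₂) (D / e)).filter (fun d => f ∣ d),
      (0 < d ∧ (d : ℝ) ≤ D / e) ∧ Cubefree d ∧ d.Coprime (Nat.lcm q₁ q₂) := fun d hd =>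
    (mem_modSet (by positivity)).mp (Finset.mem_filter.mp hd).1
  have hJ1 : (1 : ℝ) ≤ 2 ^ J := one_le_pow₀ (by norm_num)
  have hu24 : u ^ 2 ≤ u ^ 4 := pow_le_pow_right₀ hu (by norm_num)
  have hρ : ∀ d ∈ (modSet (Nat.lcm q₁ q₂) (D / e)).filter (fun d => f ∣ d),
      ((rootSet q₁ d).card : ℝ) ≤ W := fun d hd => by
    obtain ⟨⟨h1, h2⟩, h3, h4⟩ := hmod d hd
    refine le_trans ?_ (hT d h1.ne' ?_)
    · exact_mod_cast card_rootSet_le_card_divisors h3 h1.ne'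
        (h4.coprime_dvd_right (Nat.dvd_lcm_left _ _)).symm
    · calc (d : ℝ) ≤ u ^ 4 := h2.trans (hYD.trans hDt)
        _ ≤ _ := le_mul_of_one_le_left (by positivity) hJ1
  set N := ⌊Real.sqrt (Real.sqrt (u ^ 4))⌋₊ with hN
  have hNu : (N : ℝ) ≤ u := by
    rw [hN, hss]; exact Nat.floor_le hu0.le
  set C := (rangeC q₂ c₀ N).filter (fun c => r * f ∣ c.natAbs) with hC
  set B := (modSet (Nat.lcm q₁ q₂) (D / e)).filter (fun d => f ∣ d) with hB
  have hCcard : (C.card : ℝ) ≤ 2 * u / (r * f) := by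
    have := card_filter_dvd_rangeC_le q₂ c₀ N (Nat.mul_pos hr hf)
    push_cast at this
    exact this.trans (by gcongr)
  have key := sum_abs_latticeCount_sub_le (q := q₁) (r := r) (R := u ^ 2) (H := H)
    (n := fun c => c ^ 2 / (r : ℤ)) (T := W) (Y := D / e) (C := C) (J := J) (D := B)
    (κ := fun d => crtShift q₁ a₀ (r * d)) hq₁ hr (by positivity)
    (fun c hc => by
      have h1 := (Finset.mem_filter.mp hc).2
      have h2 : (r : ℤ) ∣ c := Int.natCast_dvd.mpr ((dvd_mul_right r f).trans h1)
      exact Int.mul_ediv_cancel' (dvd_pow h2 two_ne_zero))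
    (fun c hc => by
      have h1 := (Finset.mem_filter.mp hc).1
      rw [rangeC, Finset.mem_filter, Finset.mem_Icc, ← abs_le] at h1
      refine ⟨h1.2.1, ?_⟩
      have h2 : |(c : ℝ)| ≤ N := by exact_mod_cast h1.1
      rw [← sq_abs]
      exact pow_le_pow_left₀ (abs_nonneg _) (h2.trans hNu) 2)
    (by linarith)
    (fun m hm hm2 => hT m hm (hm2.trans (by gcongr)))
    hH (fun d hd => (hmod d hd).1) hY1 (fun d _ => crtShift_lt hq₁ a₀ _)
    (le_trans (by
      have : (r : ℝ) * (D / e) ≤ D := by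
        rw [mul_div_assoc', div_le_iff₀ her, mul_comm]
        exact mul_le_mul_of_nonneg_left hre' hD0.le
      gcongr) hJ)
    (widthU (u ^ 4)) (fun c _ => ⟨widthU_nonneg _ _, (widthU_le _ _).trans hs.le⟩)
  have e0 : ∑ d ∈ B, fluctuation q₁ q₂ a₀ c₀ (u ^ 4) r f d = ∑ d ∈ B,
      |∑ p ∈ C ×ˢ rootSet q₁ d, (latticeCount (widthU (u ^ 4) p.1 / (r * d * q₁))
        ((p.2 : ℝ) / d * ((fun c => c ^ 2 / (r : ℤ)) p.1 : ℤ) +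
          ((fun d => crtShift q₁ a₀ (r * d)) d : ℕ) / q₁) -
        2 * (widthU (u ^ 4) p.1 / (r * d * q₁)))| := rfl
  rw [e0]
  refine key.trans ?_
  rw [add_mul (16 * W ^ 2 * (u ^ 3 / H))]
  refine add_le_add ?_ ?_
  · have hsum := sum_inv_filter_dvd_le (q := Nat.lcm q₁ q₂) hf hD1 (by positivity) hYD
    calc _ ≤ ∑ d ∈ B, 16 * u ^ 3 / H * W * (1 / r) * (1 / f) * (1 / (d : ℝ)) := by
          refine Finset.sum_le_sum fun d hd => ?_
          have hd0 : (0 : ℝ) < d := by exact_mod_cast (hmod d hd).1.1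
          calc _ ≤ 8 * (u ^ 2 / (r * d * H)) * (2 * u / (r * f) * W) := by
                have := hρ d hd
                gcongr
            _ = 16 * u ^ 3 / H * W * (1 / r) * (1 / f) * (1 / (d : ℝ)) * (1 / r) := by
                field_simp; ring
            _ ≤ _ := mul_le_of_le_one_right (by positivity) ((div_le_one hrr).mpr hr1)
      _ ≤ 16 * u ^ 3 / H * W * (1 / r) * (1 / f) * (W / f) := by
          rw [← Finset.mul_sum]
          refine mul_le_mul_of_nonneg_left (hsum.trans ?_) (by positivity)
          gcongr
      _ = 16 * W ^ 2 * (u ^ 3 / H) * (1 / r * (1 / f)) * (1 / f) := by ring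
      _ ≤ _ := mul_le_of_le_one_right (by positivity) ((div_le_one hfr).mpr hf1)
  · have hρsum : ∑ d ∈ B, ((rootSet q₁ d).card : ℝ) ≤ D / f * W := by
      calc _ ≤ ∑ _d ∈ B, W := Finset.sum_le_sum hρ
        _ = B.card * W := by rw [Finset.sum_const, nsmul_eq_mul]
        _ ≤ _ := by
          have : (B.card : ℝ) ≤ D / e / f := card_filter_dvd_modSet_le hf (by positivity)
          have h2 : D / e / f ≤ D / f := by gcongr
          exact mul_le_mul_of_nonneg_right (this.trans h2) (by linarith)
    have hlog : H * Real.log (D / e) + 1 ≤ H * W := by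
      have : Real.log (D / e) ≤ Real.log D := Real.log_le_log (by positivity) hYD
      nlinarith
    have hlog0 : 0 ≤ Real.log (D / e) := Real.log_nonneg hY1
    have hin : (∑ d ∈ B, ((rootSet q₁ d).card : ℝ)) *
        ((H * Real.log (D / e) + 1) * q₁ * (4000 * W * C.card * (u ^ 2 / r))) ≤
        (90 * W ^ 2 * Real.sqrt (D * H * u ^ 3) * (1 / r * (1 / f))) ^ 2 := by
      calc _ ≤ D / f * W * (H * W * W * (4000 * W * (2 * u / (r * f)) * (u ^ 2 / r))) := by
            gcongr
        _ = 8000 * W ^ 4 * (D * H * u ^ 3) * (1 / r * (1 / f)) ^ 2 := by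
            field_simp; ring
        -- The constant is rounded up to the square 90².
        _ ≤ 8100 * W ^ 4 * (D * H * u ^ 3) * (1 / r * (1 / f)) ^ 2 := by gcongr; norm_num
        _ = _ := by
            have hS := Real.sq_sqrt (show 0 ≤ D * H * u ^ 3 by positivity)
            linear_combination -(8100 * W ^ 4 * (1 / (r : ℝ) * (1 / f)) ^ 2) * hS
    have hsqrt := Real.sqrt_le_iff.mpr ⟨show 0 ≤ 90 * W ^ 2 * Real.sqrt (D * H * u ^ 3) *
      (1 / (r : ℝ) * (1 / f)) by positivity, hin⟩
    have hmul := mul_le_mul hJW hsqrt (Real.sqrt_nonneg _) (zero_le_one.trans hW1)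
    refine (mul_le_mul_of_nonneg_left hmul zero_le_two).trans (le_of_eq ?_)
    ring

theorem sum_localError_le {q₁ q₂ r e f J : ℕ} (hq₁ : 0 < q₁) (a₀ c₀ : ℤ) {u D H W : ℝ}
    (hu : 1 ≤ u) (hr : 0 < r) (hre : r ≤ e) (heD : (e : ℝ) ≤ D) (hf : 0 < f) (hH : 2 ≤ H)
    (hqW : (q₁ : ℝ) ≤ W) (hL : 1 + Real.log D ≤ W) (hJW : (J : ℝ) ≤ W) (hDt : D ≤ u ^ 4)
    (hT : ∀ m : ℕ, m ≠ 0 → (m : ℝ) ≤ 2 ^ J * u ^ 4 → (m.divisors.card : ℝ) ≤ W)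
    (hJ : 2 * (D * q₁ * H / u ^ 2) ^ 2 ≤ 2 ^ J) :
    ∑ d ∈ (modSet (Nat.lcm q₁ q₂) (D / e)).filter (fun d => f ∣ d),
      localError q₁ q₂ a₀ c₀ (u ^ 4) r f d ≤
    (W ^ 3 * (4 * u ^ 2 + 16 * (u ^ 3 / H) + 180 * Real.sqrt (D * H * u ^ 3))) *
      (1 / r * (1 / f)) := by
  have h1 := sum_fluctuation_le (q₂ := q₂) hq₁ a₀ c₀ hu hr hre heD hf hH hqW hL hJW hDt hT hJ
  have hu0 : 0 < u := by linarith
  have hrr : (0 : ℝ) < r := by exact_mod_cast hr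
  have hfr : (0 : ℝ) < f := by exact_mod_cast hf
  have he1 : (1 : ℝ) ≤ e := by exact_mod_cast lt_of_lt_of_le hr hre
  have hqr : (1 : ℝ) ≤ q₁ := by exact_mod_cast hq₁
  have hW1 : 1 ≤ W := hqr.trans hqW
  have hD1 : 1 ≤ D := he1.trans heD
  have hD0 : 0 < D := by linarith
  have hYD : D / e ≤ D := div_le_self hD0.le he1
  have hs : Real.sqrt (u ^ 4) = u ^ 2 := by
    rw [show u ^ 4 = (u ^ 2) ^ 2 by ring, Real.sqrt_sq (by positivity)]
  have hJ1 : (1 : ℝ) ≤ 2 ^ J := one_le_pow₀ (by norm_num)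
  have h2 : ∑ d ∈ (modSet (Nat.lcm q₁ q₂) (D / e)).filter (fun d => f ∣ d),
      4 * Real.sqrt (u ^ 4) * ((rootSet q₁ d).card / (r * d)) ≤
      4 * u ^ 2 * W ^ 2 * (1 / r * (1 / f)) := by
    calc _ ≤ ∑ d ∈ (modSet (Nat.lcm q₁ q₂) (D / e)).filter (fun d => f ∣ d),
          4 * u ^ 2 * W * (1 / r) * (1 / (d : ℝ)) := by
          refine Finset.sum_le_sum fun d hd => ?_
          obtain ⟨⟨h1, h2⟩, h3, h4⟩ := (mem_modSet (by positivity)).mp (Finset.mem_filter.mp hd).1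
          have hd0 : (0 : ℝ) < d := by exact_mod_cast h1
          have hρ : ((rootSet q₁ d).card : ℝ) ≤ W := by
            refine le_trans ?_ (hT d h1.ne' ?_)
            · exact_mod_cast card_rootSet_le_card_divisors h3 h1.ne'
                (h4.coprime_dvd_right (Nat.dvd_lcm_left _ _)).symm
            · calc (d : ℝ) ≤ u ^ 4 := h2.trans (hYD.trans hDt)
                _ ≤ _ := le_mul_of_one_le_left (by positivity) hJ1
          rw [hs]
          calc _ ≤ 4 * u ^ 2 * (W / (r * d)) := by gcongr
            _ = _ := by field_simp
      _ ≤ 4 * u ^ 2 * W * (1 / r) * (W / f) := by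
          rw [← Finset.mul_sum]
          refine mul_le_mul_of_nonneg_left
            ((sum_inv_filter_dvd_le hf hD1 (by positivity) hYD).trans ?_) (by positivity)
          gcongr
      _ = _ := by ring
  simp only [localError]
  rw [Finset.sum_add_distrib]
  refine (add_le_add h2 h1).trans ?_
  rw [← add_mul]
  refine mul_le_mul_of_nonneg_right ?_ (by positivity)
  have hW23 : W ^ 2 ≤ W ^ 3 := pow_le_pow_right₀ hW1 (by norm_num)
  have a1 : 4 * u ^ 2 * W ^ 2 ≤ W ^ 3 * (4 * u ^ 2) := by nlinarith [sq_nonneg u]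
  have a2 : 16 * W ^ 2 * (u ^ 3 / H) ≤ W ^ 3 * (16 * (u ^ 3 / H)) := by
    have : 0 ≤ u ^ 3 / H := by positivity
    nlinarith
  linarith

theorem sum_sum_localError_le {q₁ q₂ J : ℕ} (hq₁ : 0 < q₁) (a₀ c₀ : ℤ) {u D H W : ℝ}
    (hu : 1 ≤ u) (hD : 1 ≤ D) (hH : 2 ≤ H)
    (hqW : (q₁ : ℝ) ≤ W) (hL : 1 + Real.log D ≤ W) (hJW : (J : ℝ) ≤ W) (hDt : D ≤ u ^ 4)
    (hT : ∀ m : ℕ, m ≠ 0 → (m : ℝ) ≤ 2 ^ J * u ^ 4 → (m.divisors.card : ℝ) ≤ W)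
    (hJ : 2 * (D * q₁ * H / u ^ 2) ^ 2 ≤ 2 ^ J) :
    ∑ d ∈ modSet (Nat.lcm q₁ q₂) D, ∑ e ∈ unitaryDivisors d,
      ∑ f ∈ (radical (d / e)).divisors, localError q₁ q₂ a₀ c₀ (u ^ 4) (radical e) f (d / e) ≤
    W ^ 6 * (4 * u ^ 2 + 16 * (u ^ 3 / H) + 180 * Real.sqrt (D * H * u ^ 3)) := by
  have hqr : (1 : ℝ) ≤ q₁ := by exact_mod_cast hq₁
  have hW1 : 1 ≤ W := hqr.trans hqW
  have hu0 : 0 < u := by linarith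
  have hJ1 : (1 : ℝ) ≤ 2 ^ J := one_le_pow₀ (by norm_num)
  set M := 4 * u ^ 2 + 16 * (u ^ 3 / H) + 180 * Real.sqrt (D * H * u ^ 3) with hM
  have hM0 : 0 ≤ M := by positivity
  refine (sum_unitaryDivisors_le (q := Nat.lcm q₁ q₂) hD
    (X := fun e f d => localError q₁ q₂ a₀ c₀ (u ^ 4) (radical e) f d)
    (fun e f d => localError_nonneg _ _ _ _ _ _ _ _)).trans ?_
  calc _ ≤ ∑ e ∈ modSet (Nat.lcm q₁ q₂) D, ∑ f ∈ Finset.Icc 1 ⌊D⌋₊,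
        W ^ 3 * M * (1 / (radical e : ℕ) * (1 / f)) := by
        refine Finset.sum_le_sum fun e he => Finset.sum_le_sum fun f hf => ?_
        rw [mem_modSet (by linarith)] at he
        have hr : radical e ∣ e := UniqueFactorizationMonoid.radical_dvd_self
        exact sum_localError_le hq₁ a₀ c₀ hu (Nat.pos_of_dvd_of_pos hr he.1.1)
          (Nat.le_of_dvd he.1.1 hr) he.1.2 (Finset.mem_Icc.mp hf).1 hH hqW hL hJW hDt hT hJ
    _ = W ^ 3 * M * ((∑ e ∈ modSet (Nat.lcm q₁ q₂) D, (1 : ℝ) / (radical e : ℕ)) *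
        ∑ f ∈ Finset.Icc 1 ⌊D⌋₊, (1 : ℝ) / f) := by
        simp_rw [Finset.sum_mul_sum, Finset.mul_sum]
    _ ≤ W ^ 3 * M * (W * W * W) := by
        have h1 := sum_inv_radical_le (q := Nat.lcm q₁ q₂) hD (by linarith : 0 ≤ W)
          fun m hm hmD => hT m hm (hmD.trans (hDt.trans
            (le_mul_of_one_le_left (by positivity) hJ1)))
        have h2 := sum_one_div_le_one_add_log hD
        gcongr
        · exact h1.trans (by gcongr)
        · exact h2.trans hL
    _ = _ := by ring

/-! ### The bound for the sum of the remainders -/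

theorem remainderSum_eq_sum_modSet {q₁ q₂ : ℕ} {a₀ c₀ : ℤ} (h : Admissible q₁ q₂ a₀ c₀) {D : ℝ}
    (hD : 0 ≤ D) (t : ℝ) :
    remainderSum (fun n => (seqA q₁ q₂ a₀ c₀ n : ℝ)) (densityCoprime q₁ q₂) D t =
      ∑ d ∈ modSet (Nat.lcm q₁ q₂) D,
        |remainder (fun n => (seqA q₁ q₂ a₀ c₀ n : ℝ)) (densityCoprime q₁ q₂) d t| := by
  classical
  symm
  refine Finset.sum_subset (fun d hd => ?_) fun d hd hd' => ?_
  · rw [mem_modSet hD] at hd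
    rw [Finset.mem_filter, Finset.mem_Icc]
    exact ⟨⟨hd.1.1, Nat.le_floor hd.1.2⟩, hd.2.1⟩
  · rw [Finset.mem_filter, Finset.mem_Icc, Nat.le_floor_iff hD] at hd
    rw [mem_modSet hD] at hd'
    rw [remainder_eq_zero_of_admissible h (fun hc => hd' ⟨hd.1, hd.2, hc⟩), abs_zero]

theorem sqrt_floor_pow_four_le (u : ℝ) : Real.sqrt (⌊u ^ 4⌋₊ : ℕ) ≤ u ^ 2 := by
  rw [Real.sqrt_le_iff]
  refine ⟨by positivity, (Nat.floor_le (by positivity)).trans (le_of_eq (by ring))⟩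

theorem zeroPart_one_le (q₁ q₂ : ℕ) (a₀ c₀ : ℤ) {u W : ℝ} (hW : 0 ≤ W)
    (hT : ∀ m : ℕ, m ≠ 0 → (m : ℝ) ≤ u ^ 4 → (m.divisors.card : ℝ) ≤ W) :
    (zeroPart q₁ q₂ a₀ c₀ 1 ⌊u ^ 4⌋₊ : ℝ) ≤ 2 * W * u ^ 2 := by
  have h := sum_zeroPart_le q₁ q₂ a₀ c₀ ⌊u ^ 4⌋₊ hW
    (fun m hm hmK => hT m hm ((Nat.le_floor_iff (by positivity)).mp hmK)) {1}
  rw [Finset.sum_singleton] at h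
  exact h.trans (mul_le_mul_of_nonneg_left (sqrt_floor_pow_four_le u) (by positivity))

/-- With δ = D^(1/4) and g = t^(3/16) take H = 2g/δ, which is at least 2 because δ ≤ g. The
smoothing error u³/H becomes δg³/2, and √(DHu³) = √(2δ³g⁵) is at most 2δg³, again by δ ≤ g. -/
theorem remainderSum_le_of_le {q₁ q₂ J : ℕ} (hq₁ : 0 < q₁) (hq₂ : 0 < q₂) {a₀ c₀ : ℤ}
    (h : Admissible q₁ q₂ a₀ c₀) {u g δ W : ℝ} (hu : 1 ≤ u) (hg : g ^ 4 = u ^ 3)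
    (hδ : 1 ≤ δ) (hδg : δ ≤ g) (hqW : (q₁ : ℝ) ≤ W) (hL : 1 + Real.log (u ^ 4) ≤ W)
    (hJW : (J : ℝ) ≤ W)
    (hT : ∀ m : ℕ, m ≠ 0 → (m : ℝ) ≤ 2 ^ J * u ^ 4 → (m.divisors.card : ℝ) ≤ W)
    (hJ : 8 * q₁ ^ 2 * u ^ 4 ≤ (2 : ℝ) ^ J) :
    remainderSum (fun n => (seqA q₁ q₂ a₀ c₀ n : ℝ)) (densityCoprime q₁ q₂) (δ ^ 4) (u ^ 4) ≤
      400 * W ^ 6 * (δ * g ^ 3) := by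
  have hu0 : 0 < u := by linarith
  have hδ0 : 0 < δ := by linarith
  have hg1 : 1 ≤ g := hδ.trans hδg
  have hqr : (1 : ℝ) ≤ q₁ := by exact_mod_cast hq₁
  have hW1 : 1 ≤ W := hqr.trans hqW
  have hW0 : 0 ≤ W := by linarith
  have hJ1 : (1 : ℝ) ≤ 2 ^ J := one_le_pow₀ (by norm_num)
  have hD1 : 1 ≤ δ ^ 4 := one_le_pow₀ hδ
  have ht1 : 1 ≤ u ^ 4 := one_le_pow₀ hu
  have hDt : δ ^ 4 ≤ u ^ 4 := by
    calc δ ^ 4 ≤ g ^ 4 := by gcongr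
      _ = u ^ 3 := hg
      _ ≤ u ^ 4 := pow_le_pow_right₀ hu (by norm_num)
  have hLD : 1 + Real.log (δ ^ 4) ≤ W :=
    le_trans (by have := Real.log_le_log (by positivity) hDt; linarith) hL
  have hT4 : ∀ m : ℕ, m ≠ 0 → (m : ℝ) ≤ u ^ 4 → (m.divisors.card : ℝ) ≤ W := fun m hm hmu =>
    hT m hm (hmu.trans (le_mul_of_one_le_left (by positivity) hJ1))
  have hH : 2 ≤ 2 * g / δ := by rw [le_div_iff₀ hδ0]; linarith
  have hu2 : u ^ 2 ≤ g ^ 3 := by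
    refine le_of_pow_le_pow_left₀ (n := 4) (by norm_num) (by positivity) ?_
    calc (u ^ 2) ^ 4 = u ^ 8 := by ring
      _ ≤ u ^ 9 := pow_le_pow_right₀ hu (by norm_num)
      _ = (u ^ 3) ^ 3 := by ring
      _ = (g ^ 3) ^ 4 := by rw [← hg]; ring
  have hJ' : 2 * (δ ^ 4 * q₁ * (2 * g / δ) / u ^ 2) ^ 2 ≤ (2 : ℝ) ^ J := by
    refine le_trans ?_ hJ
    have e1 : δ ^ 4 * q₁ * (2 * g / δ) / u ^ 2 = 2 * q₁ * (δ ^ 3 * g) / u ^ 2 := by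
      field_simp
    have e2 : δ ^ 3 * g ≤ u ^ 3 := by
      calc δ ^ 3 * g ≤ g ^ 3 * g := by gcongr
        _ = u ^ 3 := by rw [← hg]; ring
    have e3 : 2 * q₁ * (δ ^ 3 * g) / u ^ 2 ≤ 2 * q₁ * u := by
      rw [div_le_iff₀ (by positivity)]
      calc _ ≤ 2 * (q₁ : ℝ) * u ^ 3 := by gcongr
        _ = _ := by ring
    rw [e1]
    calc _ ≤ 2 * (2 * (q₁ : ℝ) * u) ^ 2 := by gcongr
      _ = 8 * q₁ ^ 2 * u ^ 2 := by ring
      _ ≤ _ := by gcongr; norm_num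
  have h1 := sum_sum_localError_le (q₂ := q₂) hq₁ a₀ c₀ hu hD1 hH hqW hLD hJW hDt hT hJ'
  have hz := sum_zeroPart_le q₁ q₂ a₀ c₀ ⌊u ^ 4⌋₊ hW0
    (fun m hm hmK => hT4 m hm ((Nat.le_floor_iff (by positivity)).mp hmK))
    (modSet (Nat.lcm q₁ q₂) (δ ^ 4))
  have hz' := hz.trans (mul_le_mul_of_nonneg_left (sqrt_floor_pow_four_le u) (by positivity))
  have hz1 := zeroPart_one_le q₁ q₂ a₀ c₀ hW0 hT4
  have hg' := sum_density_le (Nat.lcm q₁ q₂) hD1 hW0 fun m hm hmD => hT4 m hm (hmD.trans hDt)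
  have hs : Real.sqrt (u ^ 4) = u ^ 2 := by
    rw [show u ^ 4 = (u ^ 2) ^ 2 by ring, Real.sqrt_sq (by positivity)]
  set E := δ * g ^ 3 with hE
  have hEu : u ^ 2 ≤ E := hu2.trans (le_mul_of_one_le_left (by positivity) hδ)
  have hE0 : 0 ≤ E := by positivity
  have b1 : u ^ 3 / (2 * g / δ) = E / 2 := by
    rw [← hg, hE]; field_simp
  have b2 : Real.sqrt (δ ^ 4 * (2 * g / δ) * u ^ 3) ≤ 2 * E := by
    rw [Real.sqrt_le_iff]
    refine ⟨by positivity, ?_⟩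
    have : δ ^ 4 * (2 * g / δ) * u ^ 3 = 2 * δ ^ 2 * g ^ 5 * δ := by
      rw [← hg]; field_simp
    rw [this]
    calc _ ≤ 2 * δ ^ 2 * g ^ 5 * g := by gcongr
      _ = 2 * E ^ 2 := by rw [hE]; ring
      _ ≤ _ := by nlinarith [sq_nonneg E]
  have hW6 : ∀ k ≤ 6, W ^ k ≤ W ^ 6 := fun k hk => pow_le_pow_right₀ hW1 hk
  rw [remainderSum_eq_sum_modSet h (by positivity)]
  calc _ ≤ ∑ d ∈ modSet (Nat.lcm q₁ q₂) (δ ^ 4), (_ + _ + density d *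
        (6 * Real.sqrt (u ^ 4) + zeroPart q₁ q₂ a₀ c₀ 1 ⌊u ^ 4⌋₊)) := by
        refine Finset.sum_le_sum fun d hd => ?_
        rw [mem_modSet (by positivity)] at hd
        exact abs_remainder_le hq₁ hq₂ a₀ c₀ hd.2.1 hd.1.1.ne' hd.2.2 ht1
    _ ≤ W ^ 6 * (4 * u ^ 2 + 16 * (u ^ 3 / (2 * g / δ)) +
          180 * Real.sqrt (δ ^ 4 * (2 * g / δ) * u ^ 3)) + 2 * W * u ^ 2 +
          W * W * (6 * u ^ 2 + 2 * W * u ^ 2) := by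
        rw [Finset.sum_add_distrib, Finset.sum_add_distrib, ← Finset.sum_mul, hs]
        refine add_le_add (add_le_add h1 hz') ?_
        refine mul_le_mul (hg'.trans (mul_le_mul_of_nonneg_left hLD hW0)) (by linarith)
          (by positivity) (by positivity)
    _ ≤ W ^ 6 * (4 * E + 16 * (E / 2) + 180 * (2 * E)) + 2 * W ^ 6 * E + 8 * W ^ 6 * E := by
        rw [b1]
        refine add_le_add (add_le_add (by gcongr) ?_) ?_
        · have := hW6 1 (by norm_num)
          rw [pow_one] at this
          gcongr
        · calc W * W * (6 * u ^ 2 + 2 * W * u ^ 2) = 6 * W ^ 2 * u ^ 2 + 2 * W ^ 3 * u ^ 2 := by ring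
            _ ≤ 6 * W ^ 6 * E + 2 * W ^ 6 * E := by
              have a2 := hW6 2 (by norm_num)
              have a3 := hW6 3 (by norm_num)
              gcongr
            _ = _ := by ring
    _ = 382 * (W ^ 6 * E) := by ring
    _ ≤ _ := by
        have : 0 ≤ W ^ 6 * E := by positivity
        linarith

theorem congruenceSum_one_le (q₁ q₂ : ℕ) (a₀ c₀ : ℤ) {u W : ℝ} (hu : 1 ≤ u) (hW : 1 ≤ W)
    (hT : ∀ m : ℕ, m ≠ 0 → (m : ℝ) ≤ u ^ 4 → (m.divisors.card : ℝ) ≤ W) :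
    congruenceSum (fun n => (seqA q₁ q₂ a₀ c₀ n : ℝ)) 1 (u ^ 4) ≤ 8 * W * u ^ 3 := by
  have hu0 : 0 < u := by linarith
  have hs : Real.sqrt (u ^ 4) = u ^ 2 := by
    rw [show u ^ 4 = (u ^ 2) ^ 2 by ring, Real.sqrt_sq (by positivity)]
  have hss : Real.sqrt (Real.sqrt (u ^ 4)) = u := by rw [hs, Real.sqrt_sq hu0.le]
  rw [congruenceSum_seqA _ _ _ _ _ (by positivity)]
  have hz1 := zeroPart_one_le q₁ q₂ a₀ c₀ (by linarith) hT
  have hcard := card_rangeC_le q₂ c₀ (u ^ 4)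
  set C := rangeC q₂ c₀ ⌊Real.sqrt (Real.sqrt (u ^ 4))⌋₊
  rw [hss] at hcard
  have hu2 : 1 ≤ u ^ 2 := one_le_pow₀ hu
  have h1 : ∀ c, (pairCount q₁ a₀ 1 c (widthU (u ^ 4) c) : ℝ) ≤ 3 * u ^ 2 := by
    intro c
    have h2 : pairCount q₁ a₀ 1 c (widthU (u ^ 4) c) ≤
        (Finset.Icc (-⌊widthU (u ^ 4) c⌋) ⌊widthU (u ^ 4) c⌋).card := Finset.card_filter_le _ _
    rw [Int.card_Icc] at h2
    have h3 : 0 ≤ ⌊widthU (u ^ 4) c⌋ := Int.floor_nonneg.mpr (widthU_nonneg _ _)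
    have h4 : ((pairCount q₁ a₀ 1 c (widthU (u ^ 4) c) : ℕ) : ℤ) ≤
        2 * ⌊widthU (u ^ 4) c⌋ + 1 := by omega
    have h5 : ((pairCount q₁ a₀ 1 c (widthU (u ^ 4) c) : ℕ) : ℝ) ≤
        2 * ⌊widthU (u ^ 4) c⌋ + 1 := by exact_mod_cast h4
    have h6 := Int.floor_le (widthU (u ^ 4) c)
    have h7 := widthU_le (u ^ 4) c
    rw [hs] at h7
    linarith
  calc _ ≤ ∑ _c ∈ C, 3 * u ^ 2 + 2 * W * u ^ 2 := add_le_add (Finset.sum_le_sum fun c _ => h1 c) hz1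
    _ ≤ 2 * u * (3 * u ^ 2) + 2 * W * u ^ 2 := by
        rw [Finset.sum_const, nsmul_eq_mul]; gcongr
    _ ≤ _ := by
        have h8 : u ^ 2 ≤ u ^ 3 := pow_le_pow_right₀ hu (by norm_num)
        have h9 : 0 ≤ u ^ 3 := by positivity
        nlinarith [mul_le_mul_of_nonneg_left h8 (show 0 ≤ W by linarith)]

theorem sum_congruenceSum_le (q₁ q₂ : ℕ) (a₀ c₀ : ℤ) {t W : ℝ} (ht : 0 ≤ t)
    (hT : ∀ m : ℕ, m ≠ 0 → (m : ℝ) ≤ t → (m.divisors.card : ℝ) ≤ W) (B : Finset ℕ) :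
    ∑ d ∈ B, congruenceSum (fun n => (seqA q₁ q₂ a₀ c₀ n : ℝ)) d t ≤
      W * congruenceSum (fun n => (seqA q₁ q₂ a₀ c₀ n : ℝ)) 1 t := by
  simp only [congruenceSum, one_dvd, Finset.filter_true, Finset.sum_filter, Finset.mul_sum]
  rw [Finset.sum_comm]
  refine Finset.sum_le_sum fun n hn => ?_
  rw [Finset.mem_Icc, Nat.le_floor_iff ht] at hn
  have hn0 : n ≠ 0 := by omega
  rw [← Finset.sum_filter, Finset.sum_const, nsmul_eq_mul]
  refine mul_le_mul_of_nonneg_right (le_trans ?_ (hT n hn0 hn.2)) (Nat.cast_nonneg _)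
  exact_mod_cast Finset.card_le_card fun d hd =>
    Nat.mem_divisors.mpr ⟨(Finset.mem_filter.mp hd).2, hn0⟩

theorem congruenceSum_seqA_nonneg (q₁ q₂ : ℕ) (a₀ c₀ : ℤ) (d : ℕ) (t : ℝ) :
    0 ≤ congruenceSum (fun n => (seqA q₁ q₂ a₀ c₀ n : ℝ)) d t :=
  Finset.sum_nonneg fun _ _ => Nat.cast_nonneg _

/-- Each n ≤ u⁴ is counted for at most τ(n) moduli, and the densities sum to at most W². No
cancellation is used. -/
theorem remainderSum_le_trivial {q₁ q₂ : ℕ} {a₀ c₀ : ℤ} (h : Admissible q₁ q₂ a₀ c₀)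
    {u D M W : ℝ} (hu : 1 ≤ u) (hD : 1 ≤ D) (hDM : D ≤ M) (huM : u ^ 4 ≤ M)
    (hL : 1 + Real.log M ≤ W)
    (hT : ∀ m : ℕ, m ≠ 0 → (m : ℝ) ≤ M → (m.divisors.card : ℝ) ≤ W) :
    remainderSum (fun n => (seqA q₁ q₂ a₀ c₀ n : ℝ)) (densityCoprime q₁ q₂) D (u ^ 4) ≤
      16 * W ^ 3 * u ^ 3 := by
  have hD0 : 0 < D := by linarith
  have hW1 : 1 ≤ W := by have := Real.log_nonneg (hD.trans hDM); linarith
  have hW0 : 0 ≤ W := by linarith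
  have hA := congruenceSum_one_le q₁ q₂ a₀ c₀ hu hW1 fun m hm hmu => hT m hm (hmu.trans huM)
  have hsum := sum_congruenceSum_le q₁ q₂ a₀ c₀ (t := u ^ 4) (by positivity)
    (fun m hm hmu => hT m hm (hmu.trans huM)) (modSet (Nat.lcm q₁ q₂) D)
  have hg := sum_density_le (Nat.lcm q₁ q₂) hD hW0 fun m hm hmD => hT m hm (hmD.trans hDM)
  have hA0 := congruenceSum_seqA_nonneg q₁ q₂ a₀ c₀ 1 (u ^ 4)
  set A := congruenceSum (fun n => (seqA q₁ q₂ a₀ c₀ n : ℝ)) 1 (u ^ 4) with hAdef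
  have hLD : 1 + Real.log D ≤ W :=
    le_trans (by have := Real.log_le_log hD0 hDM; linarith) hL
  rw [remainderSum_eq_sum_modSet h hD0.le]
  calc _ ≤ ∑ d ∈ modSet (Nat.lcm q₁ q₂) D,
        (congruenceSum (fun n => (seqA q₁ q₂ a₀ c₀ n : ℝ)) d (u ^ 4) + density d * A) := by
        refine Finset.sum_le_sum fun d hd => ?_
        rw [mem_modSet hD0.le] at hd
        rw [remainder, densityCoprime, if_pos hd.2.2]
        refine (abs_sub _ _).trans (le_of_eq ?_)
        rw [abs_of_nonneg (congruenceSum_seqA_nonneg _ _ _ _ _ _),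
          abs_of_nonneg (mul_nonneg (density_bounds hd.2.1 hd.1.1.ne').1 hA0)]
    _ ≤ W * A + W * W * A := by
        rw [Finset.sum_add_distrib, ← Finset.sum_mul]
        refine add_le_add hsum (mul_le_mul_of_nonneg_right (hg.trans ?_) hA0)
        exact mul_le_mul_of_nonneg_left hLD hW0
    _ ≤ 2 * W ^ 2 * A := by nlinarith [mul_nonneg hW0 hA0]
    _ ≤ 2 * W ^ 2 * (8 * W * u ^ 3) := by gcongr
    _ = _ := by ring

theorem exists_uniform_bound (q : ℕ) (hq : 0 < q) {δ : ℝ} (hδ : 0 < δ) :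
    ∃ K : ℝ, 1 ≤ K ∧ ∀ X : ℝ, 1 ≤ X → ∃ J : ℕ, 8 * q ^ 2 * X ≤ (2 : ℝ) ^ J ∧
      (J : ℝ) ≤ K * X ^ δ ∧ (q : ℝ) ≤ K * X ^ δ ∧ 1 + Real.log X ≤ K * X ^ δ ∧
      ∀ m : ℕ, m ≠ 0 → (m : ℝ) ≤ 2 ^ J * X → (m.divisors.card : ℝ) ≤ K * X ^ δ := by
  obtain ⟨C, hC1, hC⟩ := exists_card_divisors_le_rpow (half_pos hδ)
  have hqr : (1 : ℝ) ≤ q := by exact_mod_cast hq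
  have hB : (0 : ℝ) ≤ C * (16 * (q : ℝ) ^ 2) ^ (δ / 2) := by positivity
  have hδ' : 0 < 1 / δ := by positivity
  refine ⟨C * (16 * (q : ℝ) ^ 2) ^ (δ / 2) + q + (1 + 1 / δ), by linarith, fun X hX => ?_⟩
  have hX0 : 0 < X := by linarith
  have hXδ : 1 ≤ X ^ δ := Real.one_le_rpow hX hδ.le
  have h8 : (1 : ℝ) ≤ 8 * q ^ 2 * X := by
    have : (1 : ℝ) ≤ (q : ℝ) ^ 2 := one_le_pow₀ hqr
    nlinarith
  obtain ⟨n, hn1, hn2⟩ := exists_nat_pow_near h8 one_lt_two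
  have hm : ∀ m : ℕ, m ≠ 0 → (m : ℝ) ≤ 2 ^ (n + 1) * X →
      (m.divisors.card : ℝ) ≤ C * (16 * (q : ℝ) ^ 2) ^ (δ / 2) * X ^ δ := by
    intro m hm hmX
    refine (hC m hm).trans ?_
    have h16 : (m : ℝ) ≤ 16 * q ^ 2 * (X * X) := by
      refine hmX.trans ?_
      rw [pow_succ]
      nlinarith
    calc C * (m : ℝ) ^ (δ / 2) ≤ C * (16 * q ^ 2 * (X * X)) ^ (δ / 2) := by gcongr
      _ = _ := by
        rw [Real.mul_rpow (by positivity) (by positivity), Real.mul_rpow hX0.le hX0.le,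
          ← Real.rpow_add hX0, add_halves]
        ring
  have hle : C * (16 * (q : ℝ) ^ 2) ^ (δ / 2) * X ^ δ ≤
      (C * (16 * (q : ℝ) ^ 2) ^ (δ / 2) + q + (1 + 1 / δ)) * X ^ δ := by
    gcongr
    linarith
  refine ⟨n + 1, hn2.le, ?_, ?_, ?_, fun m h0 hmX => (hm m h0 hmX).trans hle⟩
  -- The exponent J = n + 1 is the number of divisors of 2^n, so the divisor bound controls it too.
  · have h2 := hm (2 ^ n) (by positivity) (by
      push_cast
      rw [pow_succ]
      have : (0 : ℝ) < 2 ^ n := by positivity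
      nlinarith)
    rw [Nat.divisors_prime_pow Nat.prime_two, Finset.card_map, Finset.card_range] at h2
    exact h2.trans hle
  · calc (q : ℝ) ≤ q * X ^ δ := le_mul_of_one_le_right (by linarith) hXδ
      _ ≤ _ := by gcongr; linarith
  · have hlog := Real.log_le_rpow_div hX0.le hδ
    calc 1 + Real.log X ≤ X ^ δ + X ^ δ / δ := by linarith
      _ = (1 + 1 / δ) * X ^ δ := by ring
      _ ≤ _ := mul_le_mul_of_nonneg_right (by linarith) (by positivity)

theorem remainderSum_eq_zero_of_lt_one (a g : ℕ → ℝ) (D : ℝ) {t : ℝ} (ht : t < 1) :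
    remainderSum a g D t = 0 := by
  have h0 : ⌊t⌋₊ = 0 := Nat.floor_eq_zero.mpr ht
  simp [remainderSum, remainder, congruenceSum, h0]

theorem exists_remainderSum_le {q₁ q₂ : ℕ} (hq₁ : 0 < q₁) (hq₂ : 0 < q₂) {ε : ℝ} (hε : 0 < ε) :
    ∃ C : ℝ, 0 < C ∧ ∀ a₀ c₀ : ℤ, Admissible q₁ q₂ a₀ c₀ →
      ∀ D : ℝ, 1 ≤ D → ∀ x : ℝ, 1 ≤ x → ∀ t : ℝ, t ≤ x →
        remainderSum (fun n => (seqA q₁ q₂ a₀ c₀ n : ℝ)) (densityCoprime q₁ q₂) D t ≤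
          C * D ^ (1 / 4 : ℝ) * x ^ (9 / 16 + ε) := by
  -- At most six factors W = K t^η occur, so η ≤ ε/6 suffices for small D. The bound η ≤ 1/16 keeps
  -- the exponent 4η - 1/4 nonpositive when D is large.
  set η : ℝ := min (ε / 6) (1 / 16) with hη
  have hη0 : 0 < η := lt_min (by positivity) (by norm_num)
  have hη1 : η ≤ ε / 6 := min_le_left _ _
  have hη2 : η ≤ 1 / 16 := min_le_right _ _
  obtain ⟨K, hK1, hK⟩ := exists_uniform_bound q₁ hq₁ hη0
  have hK0 : 0 < K := by linarith
  refine ⟨400 * K ^ 6, by positivity, fun a₀ c₀ h D hD x hx t htx => ?_⟩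
  have hD0 : 0 < D := by linarith
  rcases lt_or_ge t 1 with ht | ht
  · rw [remainderSum_eq_zero_of_lt_one _ _ _ ht]
    positivity
  have ht0 : 0 < t := by linarith
  suffices hs : remainderSum (fun n => (seqA q₁ q₂ a₀ c₀ n : ℝ)) (densityCoprime q₁ q₂) D t ≤
      400 * K ^ 6 * D ^ (1 / 4 : ℝ) * t ^ (9 / 16 + ε) by
    refine hs.trans ?_
    gcongr
  have hu : (t ^ (1 / 4 : ℝ)) ^ 4 = t := by
    rw [← Real.rpow_natCast, ← Real.rpow_mul ht0.le]; norm_num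
  have hδ : (D ^ (1 / 4 : ℝ)) ^ 4 = D := by
    rw [← Real.rpow_natCast, ← Real.rpow_mul hD0.le]; norm_num
  have hu1 : 1 ≤ t ^ (1 / 4 : ℝ) := Real.one_le_rpow ht (by norm_num)
  rcases le_or_gt D (t ^ (3 / 4 : ℝ)) with hDt | hDt
  · obtain ⟨J, hJ, hJW, hqW, hL, hT⟩ := hK t ht
    have hg : (t ^ (3 / 16 : ℝ)) ^ 4 = (t ^ (1 / 4 : ℝ)) ^ 3 := by
      rw [← Real.rpow_natCast, ← Real.rpow_natCast, ← Real.rpow_mul ht0.le,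
        ← Real.rpow_mul ht0.le]
      norm_num
    have hδg : D ^ (1 / 4 : ℝ) ≤ t ^ (3 / 16 : ℝ) := by
      calc D ^ (1 / 4 : ℝ) ≤ (t ^ (3 / 4 : ℝ)) ^ (1 / 4 : ℝ) := by gcongr
        _ = _ := by rw [← Real.rpow_mul ht0.le]; norm_num
    have key := remainderSum_le_of_le hq₁ hq₂ h hu1 hg
      (Real.one_le_rpow hD (by norm_num)) hδg hqW (by rwa [hu]) hJW (by rwa [hu]) (by rwa [hu])
    rw [hu, hδ] at key
    refine key.trans ?_
    have e1 : (t ^ (3 / 16 : ℝ)) ^ 3 = t ^ (9 / 16 : ℝ) := by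
      rw [← Real.rpow_natCast, ← Real.rpow_mul ht0.le]; norm_num
    have e2 : (t ^ η) ^ 6 ≤ t ^ ε := by
      rw [← Real.rpow_natCast, ← Real.rpow_mul ht0.le]
      refine Real.rpow_le_rpow_of_exponent_le ht ?_
      push_cast; linarith
    rw [e1, mul_pow, Real.rpow_add ht0]
    calc _ = 400 * K ^ 6 * D ^ (1 / 4 : ℝ) * t ^ (9 / 16 : ℝ) * (t ^ η) ^ 6 := by ring
      _ ≤ 400 * K ^ 6 * D ^ (1 / 4 : ℝ) * t ^ (9 / 16 : ℝ) * t ^ ε := by gcongr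
      _ = _ := by ring
  -- Here D exceeds t^(3/4), so M majorises both D and t, and the three factors W cost (M^η)³ =
  -- D^(4η).
  · set M := D ^ (4 / 3 : ℝ) with hM
    have hM1 : 1 ≤ M := Real.one_le_rpow hD (by norm_num)
    have hDM : D ≤ M := by
      calc D = D ^ (1 : ℝ) := (Real.rpow_one D).symm
        _ ≤ _ := Real.rpow_le_rpow_of_exponent_le hD (by norm_num)
    have htM : t ≤ M := by
      calc t = (t ^ (3 / 4 : ℝ)) ^ (4 / 3 : ℝ) := by rw [← Real.rpow_mul ht0.le]; norm_num
        _ ≤ _ := by rw [hM]; gcongr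
    obtain ⟨J, -, -, -, hL, hT⟩ := hK M hM1
    have hJ1 : (1 : ℝ) ≤ 2 ^ J := one_le_pow₀ (by norm_num)
    have key := remainderSum_le_trivial h hu1 hD hDM (by rwa [hu]) hL fun m hm hmM =>
      hT m hm (hmM.trans (le_mul_of_one_le_left (by linarith) hJ1))
    rw [hu] at key
    refine key.trans ?_
    have e1 : (M ^ η) ^ 3 = D ^ (4 * η) := by
      rw [hM, ← Real.rpow_mul hD0.le, ← Real.rpow_natCast, ← Real.rpow_mul hD0.le]
      congr 1; push_cast; ring
    have e2 : (t ^ (1 / 4 : ℝ)) ^ 3 = t ^ (3 / 4 : ℝ) := by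
      rw [← Real.rpow_natCast, ← Real.rpow_mul ht0.le]; norm_num
    have e3 : D ^ (4 * η) * t ^ (3 / 4 : ℝ) ≤ D ^ (1 / 4 : ℝ) * t ^ (9 / 16 + ε) := by
      have f1 : D ^ (4 * η) = D ^ (1 / 4 : ℝ) * D ^ (4 * η - 1 / 4) := by
        rw [← Real.rpow_add hD0]; congr 1; ring
      have f2 : D ^ (4 * η - 1 / 4) ≤ (t ^ (3 / 4 : ℝ)) ^ (4 * η - 1 / 4) :=
        Real.rpow_le_rpow_of_nonpos (by positivity) hDt.le (by linarith)
      rw [f1, mul_assoc]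
      refine mul_le_mul_of_nonneg_left ?_ (by positivity)
      calc _ ≤ (t ^ (3 / 4 : ℝ)) ^ (4 * η - 1 / 4) * t ^ (3 / 4 : ℝ) := by gcongr
        _ = t ^ (3 / 4 * (4 * η - 1 / 4) + 3 / 4) := by
          rw [← Real.rpow_mul ht0.le, ← Real.rpow_add ht0]
        _ ≤ _ := Real.rpow_le_rpow_of_exponent_le ht (by linarith)
    rw [mul_pow, e1, e2]
    calc 16 * (K ^ 3 * D ^ (4 * η)) * t ^ (3 / 4 : ℝ) =
          16 * K ^ 3 * (D ^ (4 * η) * t ^ (3 / 4 : ℝ)) := by ring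
      _ ≤ 400 * K ^ 6 * (D ^ (1 / 4 : ℝ) * t ^ (9 / 16 + ε)) := by
        have : K ^ 3 ≤ K ^ 6 := pow_le_pow_right₀ hK1 (by norm_num)
        gcongr
        norm_num
      _ = _ := by ring

/-! ### The sieve hypothesis -/

/-- For |c| ≤ u/2 the width is at least √(15/16) u² ≥ u²/2, and there are at least u/4 such positive
c. -/
theorem totalMass_ge {u : ℝ} (hu : 4 ≤ u) : u ^ 3 / 2 ≤ totalMass (u ^ 4) ⌊u⌋₊ := by
  have hu0 : 0 < u := by linarith
  have hsub : Finset.range ⌊u / 2⌋₊ ⊆ Finset.range ⌊u⌋₊ :=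
    Finset.range_subset_range.mpr (Nat.floor_le_floor (by linarith))
  have h1 : ∀ i ∈ Finset.range ⌊u / 2⌋₊, u ^ 2 / 2 ≤ widthU (u ^ 4) ((i : ℤ) + 1) := by
    intro i hi
    rw [Finset.mem_range, Nat.lt_iff_add_one_le, Nat.le_floor_iff (by positivity)] at hi
    push_cast at hi
    refine Real.le_sqrt_of_sq_le ?_
    push_cast
    have h2 : ((i : ℝ) + 1) ^ 4 ≤ (u / 2) ^ 4 := by gcongr
    have h3 : (u / 2) ^ 4 = u ^ 4 / 16 := by ring
    have h4 : (u ^ 2 / 2) ^ 2 = u ^ 4 / 4 := by ring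
    have h5 : 0 < u ^ 4 := by positivity
    linarith
  have hfl : u / 4 ≤ ⌊u / 2⌋₊ := by
    have := Nat.lt_floor_add_one (u / 2)
    linarith
  calc u ^ 3 / 2 = 2 * (2 * (u / 4 * (u ^ 2 / 2))) := by ring
    _ ≤ 2 * (2 * (⌊u / 2⌋₊ * (u ^ 2 / 2))) := by gcongr
    _ = 2 * (2 * ∑ _i ∈ Finset.range ⌊u / 2⌋₊, u ^ 2 / 2) := by
      rw [Finset.sum_const, Finset.card_range, nsmul_eq_mul]
    _ ≤ 2 * (2 * ∑ i ∈ Finset.range ⌊u / 2⌋₊, widthU (u ^ 4) ((i : ℤ) + 1)) := by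
      have := Finset.sum_le_sum h1
      linarith
    _ ≤ _ := by
      have := Finset.sum_le_sum_of_subset_of_nonneg hsub
        fun i _ _ => widthU_nonneg (u ^ 4) ((i : ℤ) + 1)
      rw [totalMass]
      linarith

theorem congruenceSum_one_ge {q₁ q₂ : ℕ} (hq₁ : 0 < q₁) (hq₂ : 0 < q₂) (a₀ c₀ : ℤ) {u : ℝ}
    (hu : 24 * (q₁ * q₂ : ℝ) ≤ u) :
    u ^ 3 / (4 * (q₁ * q₂)) ≤ congruenceSum (fun n => (seqA q₁ q₂ a₀ c₀ n : ℝ)) 1 (u ^ 4) := by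
  have hq1 : (1 : ℝ) ≤ q₁ := by exact_mod_cast hq₁
  have hq2 : (1 : ℝ) ≤ q₂ := by exact_mod_cast hq₂
  have hq : (1 : ℝ) ≤ q₁ * q₂ := by nlinarith
  set Q : ℝ := (q₁ * q₂ : ℝ) with hQ
  have hu0 : 0 < u := by linarith
  have hs : Real.sqrt (u ^ 4) = u ^ 2 := by
    rw [show u ^ 4 = (u ^ 2) ^ 2 by ring, Real.sqrt_sq (by positivity)]
  have hss : Real.sqrt (Real.sqrt (u ^ 4)) = u := by rw [hs, Real.sqrt_sq hu0.le]
  have h1 := abs_mainPart_one_sub_le hq₁ hq₂ a₀ c₀ (one_le_pow₀ (by linarith : 1 ≤ u) (n := 4))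
  rw [hs, Real.sqrt_sq hu0.le, ← hQ] at h1
  rw [congruenceSum_seqA _ _ _ _ _ (by positivity), ← mainPart]
  have h2 := totalMass_ge (by linarith : 4 ≤ u)
  have h3 : u ^ 3 / 2 / Q ≤ totalMass (u ^ 4) ⌊u⌋₊ / Q := by gcongr
  -- The lower bound 24Q for u makes the error at most half of the main term u³/(2Q).
  have h4 : 6 * u ^ 2 ≤ u ^ 3 / (4 * Q) := by
    rw [le_div_iff₀ (by positivity)]
    nlinarith [sq_nonneg u, mul_le_mul_of_nonneg_right hu (sq_nonneg u)]
  have h5 : u ^ 3 / 2 / Q = 2 * (u ^ 3 / (4 * Q)) := by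
    field_simp; ring
  have h6 : (0 : ℝ) ≤ zeroPart q₁ q₂ a₀ c₀ 1 ⌊u ^ 4⌋₊ := Nat.cast_nonneg _
  linarith [(abs_le.mp h1).1]

theorem eventually_mul_log_pow_le (n : ℕ) {ε : ℝ} (hε : 0 < ε) (C : ℝ) :
    ∀ᶠ x : ℝ in Filter.atTop, C * Real.log x ^ n ≤ x ^ ε := by
  have h := isLittleO_log_rpow_rpow_atTop (n : ℝ) hε
  have hC : 0 < 1 / (|C| + 1) := by positivity
  filter_upwards [h.bound hC, Filter.eventually_ge_atTop 1] with x hx hx1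
  have hl : 0 ≤ Real.log x := Real.log_nonneg hx1
  rw [Real.rpow_natCast, Real.norm_of_nonneg (by positivity),
    Real.norm_of_nonneg (by positivity), div_mul_eq_mul_div, one_mul,
    le_div_iff₀ (by positivity)] at hx
  have h1 : 0 ≤ Real.log x ^ n := by positivity
  nlinarith [le_abs_self C]

theorem hypothesisR_seqA {q₁ q₂ : ℕ} (hq₁ : 0 < q₁) (hq₂ : 0 < q₂) {ε : ℝ} (hε : 0 < ε)
    (hε' : ε < 1 / 96) {a₀ c₀ : ℤ} (h : Admissible q₁ q₂ a₀ c₀) :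
    HypothesisR (fun n => (seqA q₁ q₂ a₀ c₀ n : ℝ)) (densityCoprime q₁ q₂)
      (fun x => x ^ (3 / 4 - 8 * ε)) := by
  obtain ⟨C, hC0, hC⟩ := exists_remainderSum_le hq₁ hq₂ hε
  have hq1 : (1 : ℝ) ≤ q₁ := by exact_mod_cast hq₁
  have hq2 : (1 : ℝ) ≤ q₂ := by exact_mod_cast hq₂
  set Q : ℝ := (q₁ * q₂ : ℝ) with hQ
  have hQ1 : 1 ≤ Q := by rw [hQ]; nlinarith
  -- The exponents combine to (3/4 - 8ε)/4 + 9/16 + ε = 3/4 - ε. The saved x^ε must absorb constants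
  -- and L² · (L²)^(1/4) ≤ L³, hence the exponent 3 · 2^24.
  have hlog := eventually_mul_log_pow_le (2 ^ 24 * 3) hε (4 * Q * C)
  have hlog1 := Real.tendsto_log_atTop.eventually_ge_atTop 1
  have hx1 := Filter.eventually_gt_atTop (1 : ℝ)
  have hxu := Filter.eventually_ge_atTop ((24 * Q) ^ 4)
  obtain ⟨X, hX⟩ := Filter.eventually_atTop.mp (hlog.and (hlog1.and (hx1.and hxu)))
  refine ⟨max X 1, by positivity, fun x hx => ?_⟩
  obtain ⟨h1, h2, h3, h4⟩ := hX x ((le_max_left _ _).trans hx)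
  have hx0 : 0 < x := by linarith
  refine ⟨⟨Real.rpow_lt_rpow_of_exponent_lt h3 (by linarith), ?_⟩, fun t ht => ?_⟩
  · calc x ^ (3 / 4 - 8 * ε) < x ^ (1 : ℝ) := Real.rpow_lt_rpow_of_exponent_lt h3 (by linarith)
      _ = x := Real.rpow_one x
  dsimp only
  have hL1 : 1 ≤ sieveL x := one_le_pow₀ h2
  have hL3 : 4 * Q * C * sieveL x ^ 3 ≤ x ^ ε := by rwa [sieveL, ← pow_mul]
  generalize sieveL x = L at hL1 hL3 ⊢
  have hL0 : 0 < L := by linarith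
  have hD1 : 1 ≤ x ^ (3 / 4 - 8 * ε) := Real.one_le_rpow h3.le (by linarith)
  have hDL : 1 ≤ x ^ (3 / 4 - 8 * ε) * L ^ 2 := one_le_mul_of_one_le_of_one_le hD1 (one_le_pow₀ hL1)
  refine (hC a₀ c₀ h _ hDL x h3.le t ht).trans ?_
  have hu : (x ^ (1 / 4 : ℝ)) ^ 4 = x := by
    rw [← Real.rpow_natCast, ← Real.rpow_mul hx0.le]; norm_num
  have hu3 : (x ^ (1 / 4 : ℝ)) ^ 3 = x ^ (3 / 4 : ℝ) := by
    rw [← Real.rpow_natCast, ← Real.rpow_mul hx0.le]; norm_num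
  have hA := congruenceSum_one_ge hq₁ hq₂ a₀ c₀ (u := x ^ (1 / 4 : ℝ)) (by
    refine le_of_pow_le_pow_left₀ (n := 4) (by norm_num) (by positivity) ?_
    rwa [hu])
  rw [hu, hu3] at hA
  refine le_trans ?_ (div_le_div_of_nonneg_right hA (by positivity))
  rw [← hQ, le_div_iff₀ (by positivity), le_div_iff₀ (by positivity)]
  have hLq : (L ^ 2) ^ (1 / 4 : ℝ) ≤ L := by
    calc (L ^ 2) ^ (1 / 4 : ℝ) = L ^ (1 / 2 : ℝ) := by
          rw [← Real.rpow_natCast, ← Real.rpow_mul hL0.le]; norm_num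
      _ ≤ L ^ (1 : ℝ) := Real.rpow_le_rpow_of_exponent_le hL1 (by norm_num)
      _ = L := Real.rpow_one L
  have hxx : (x ^ (3 / 4 - 8 * ε)) ^ (1 / 4 : ℝ) * x ^ (9 / 16 + ε) * x ^ ε = x ^ (3 / 4 : ℝ) := by
    rw [← Real.rpow_mul hx0.le, ← Real.rpow_add hx0, ← Real.rpow_add hx0]
    congr 1; ring
  rw [Real.mul_rpow (by positivity) (by positivity)]
  calc _ = (x ^ (3 / 4 - 8 * ε)) ^ (1 / 4 : ℝ) * x ^ (9 / 16 + ε) *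
        (4 * Q * C * (L ^ 2 * (L ^ 2) ^ (1 / 4 : ℝ))) := by ring
    _ ≤ (x ^ (3 / 4 - 8 * ε)) ^ (1 / 4 : ℝ) * x ^ (9 / 16 + ε) *
        (4 * Q * C * (L ^ 2 * L)) := by gcongr
    _ ≤ (x ^ (3 / 4 - 8 * ε)) ^ (1 / 4 : ℝ) * x ^ (9 / 16 + ε) * x ^ ε := by
        gcongr
        calc _ = 4 * Q * C * L ^ 3 := by ring
          _ ≤ _ := hL3
    _ = _ := hxx

end QuarticSieve

theorem mainTheorem7 (q₁ q₂ : ℕ) (hq₁ : 0 < q₁) (hq₂ : 0 < q₂) :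
    (∀ ε : ℝ, 0 < ε → ∃ x₀ C : ℝ, 0 < x₀ ∧ 0 < C ∧
      ∀ a₀ c₀ : ℤ, QuarticSieve.Admissible q₁ q₂ a₀ c₀ →
        ∀ D : ℝ, 1 ≤ D → ∀ x : ℝ, x₀ ≤ x → ∀ t : ℝ, t ≤ x →
          QuarticSieve.remainderSum (fun n => (QuarticSieve.seqA q₁ q₂ a₀ c₀ n : ℝ))
              (QuarticSieve.densityCoprime q₁ q₂) D t
            ≤ C * D ^ (1 / 4 : ℝ) * x ^ (9 / 16 + ε)) ∧
    (∀ ε : ℝ, 0 < ε → ε < 1 / 96 →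
      ∀ a₀ c₀ : ℤ, QuarticSieve.Admissible q₁ q₂ a₀ c₀ →
        QuarticSieve.HypothesisR (fun n => (QuarticSieve.seqA q₁ q₂ a₀ c₀ n : ℝ))
          (QuarticSieve.densityCoprime q₁ q₂) (fun x => x ^ (3 / 4 - 8 * ε))) := by
  refine ⟨fun ε hε => ?_, fun ε hε hε' a₀ c₀ h =>
    QuarticSieve.hypothesisR_seqA hq₁ hq₂ hε hε' h⟩
  obtain ⟨C, hC0, hC⟩ := QuarticSieve.exists_remainderSum_le hq₁ hq₂ hε
  exact ⟨1, C, one_pos, hC0, hC⟩
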